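/- **Setting.** Let $r\ge 0$, $d_0\ge d_1\ge\dots\ge d_r\ge 1$, $N=d_0+\dots+d_r$, $d=d_0$, $\bar d_j=d_0+\dots+d_j$ and $\bar d_{-1}=0$. Let $B$ be a real $N\times N$ matrix, written in blocks according to $N=d_0+\dots+d_r$, whose only nonzero blocks are those directly below the diagonal, and whose $d_j\times d_{j-1}$ block in block row $j$ and block column $j-1$ has rank $d_j$ for $j=1,\dots,r$. On $\mathbb R^{N+1}\ni(t,x)$ let $Y=\langle Bx,\nabla\rangle+\partial_t$, with integral curves $e^{hY}(t,x)=(t+h,e^{hB}x)$, $e^{h\partial_{x_i}}(t,x)=(t,x+h\mathbf e_i)$. For $\beta\in\mathbb N_0^N$ let $\partial^\beta=\partial_{x_1}^{\beta_1}\cdots\partial_{x_N}^{\beta_N}$ and $\langle\beta\rangle_B=\sum_{j=0}^r(2j+1)\sum_{i=\bar d_{j-1}+1}^{\bar d_j}\beta_i$. All derivatives of non-smooth functions are weak derivatives, represented by locally integrable functions. For $p,q\in[1,\infty]$ and a vector field $X\in\{\partial_{x_1},\dots,\partial_{x_N},Y\}$ of weight $m_X$ ($m_{\partial_{x_i}}=1$,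 $m_Y=2$) and $0<\sigma<m_X$, let $$[u]_{X,\sigma,p,q}=\Big(\int_{\mathbb R}\|u(e^{hX}\cdot)-u\|_p^q\frac{dh}{|h|^{1+q\sigma/m_X}}\Big)^{1/q}\ (q<\infty),\qquad [u]_{X,\sigma,p,\infty}=\sup_{h\ne0}\frac{\|u(e^{hX}\cdot)-u\|_p}{|h|^{\sigma/m_X}},$$ where $\|\cdot\|_p$ is the norm of $L^p(\mathbb R^{N+1})$. For $s\in(0,1)$ let $$|u|_{s,p,q}=\sum_{i=1}^d[u]_{\partial_{x_i},s,p,q}+[u]_{Y,s,p,q},\qquad |u|_{1+s,p,q}=\sum_{i=1}^d|\partial_{x_i}u|_{s,p,q}+[u]_{Y,1+s,p,q},$$ $$|u|_{n+s,p,q}=\sum_{i=1}^d|\partial_{x_i}u|_{n-1+s,p,q}+|Yu|_{n-2+s,p,q}\quad(n\ge2),$$ with value $\infty$ if one of the weak derivatives does not exist, and let $\Lambda^{n+s}_{p,q,B}$ be the space of measurable $u:\mathbb R^{N+1}\to\mathbb R$ with $\|u\|_p+|u|_{n+s,p,q}<\infty$. **Corollary 2.6 (fractional regularity in Euclidean directions).**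 Let $n,k\in\mathbb N_0$, $s\in(0,1)$, $\beta\in\mathbb N_0^N$ and $j\in\{0,\dots,r\}$ be such that $$2j+1>n+s-2k-\langle\beta\rangle_B\ge0 .$$ Then there is a constant $c<\infty$, depending only on $B$ (with its block structure) and on $n,s,k,\beta,j$, such that for all $p,q\in[1,\infty]$, every $u\in\Lambda^{n+s}_{p,q,B}$ and every $i\in\{\bar d_{j-1}+1,\dots,\bar d_j\}$, the weak derivative $Y^k\partial^\beta u$ exists as a locally integrable function and $$[Y^k\partial^\beta u]_{\partial_{x_i},\,\frac{n+s-2k-\langle\beta\rangle_B}{2j+1},\,p,q}\le c\,|u|_{n+s,p,q}.$$ -/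

import Mathlib

open MeasureTheory
open scoped ENNReal NNReal ContDiff

namespace Kolmogorov

/-- The index set of the `N = d 0 + ⋯ + d r` space variables, arranged in `r + 1` consecutive
blocks: `⟨j, a⟩` is the `a`-th variable of the `j`-th block (both counted from `0`). -/
abbrev Idx {r : ℕ} (d : Fin (r + 1) → ℕ) : Type := Σ j : Fin (r + 1), Fin (d j)

/-- Space-time `ℝ × ℝ^N`, with points `z = (t, x)`. It carries the Lebesgue measure `volume`. -/
abbrev Pt {r : ℕ} (d : Fin (r + 1) → ℕ) : Type := ℝ × (Idx d → ℝ)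

/-- The standing assumption on `B`: block sizes `d 0 ≥ d 1 ≥ ⋯ ≥ d r ≥ 1`, all blocks of `B` vanish
except those directly below the diagonal, and the block in block row `j` and block column `j - 1`
has full rank `d j`, for `j = 1, …, r`. -/
structure IsKolmogorovMatrix {r : ℕ} (d : Fin (r + 1) → ℕ) (B : Matrix (Idx d) (Idx d) ℝ) :
    Prop where
  antitone : Antitone d
  one_le : 1 ≤ d (Fin.last r)
  eq_zero : ∀ i l : Idx d, (i.1 : ℕ) ≠ (l.1 : ℕ) + 1 → B i l = 0
  rank_eq : ∀ j : Fin r,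
    (B.submatrix (fun a : Fin (d j.succ) => (⟨j.succ, a⟩ : Idx d))
      (fun b : Fin (d j.castSucc) => (⟨j.castSucc, b⟩ : Idx d))).rank = d j.succ

section

variable {r : ℕ} {d : Fin (r + 1) → ℕ}

/-! ### Vector fields acting on smooth functions -/

/-- `∂_{x_i} φ`. -/
noncomputable def pderiv (i : Idx d) (φ : Pt d → ℝ) : Pt d → ℝ :=
  fun z => fderiv ℝ φ z (0, Pi.single i 1)

/-- `Y φ = ⟨B x, ∇φ⟩ + ∂_t φ`. -/
noncomputable def yderiv (B : Matrix (Idx d) (Idx d) ℝ) (φ : Pt d → ℝ) : Pt d → ℝ :=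
  fun z => fderiv ℝ φ z (1, B.mulVec z.2)

/-- The list `x_1, …, x_N` of all the space variables, in their natural order. -/
def idxList (d : Fin (r + 1) → ℕ) : List (Idx d) :=
  (List.finRange (r + 1)).flatMap fun j =>
    (List.finRange (d j)).map fun a => (⟨j, a⟩ : Idx d)

/-- `∂^β φ = ∂_{x_1}^{β_1} ⋯ ∂_{x_N}^{β_N} φ`. -/
noncomputable def mderiv (β : Idx d → ℕ) (φ : Pt d → ℝ) : Pt d → ℝ :=
  (idxList d).foldr (fun i ψ => (pderiv i)^[β i] ψ) φ

/-- The intrinsic length `⟨β⟩_B`: a variable of the `j`-th block has weight `2 j + 1`. -/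
def blength (β : Idx d → ℕ) : ℕ := ∑ i : Idx d, (2 * (i.1 : ℕ) + 1) * β i

/-! ### Weak derivatives -/

/-- The locally integrable function `v` is the weak derivative `∂_{x_i} u`. -/
def IsWeakPDeriv (i : Idx d) (u v : Pt d → ℝ) : Prop :=
  LocallyIntegrable u ∧ LocallyIntegrable v ∧
    ∀ φ : Pt d → ℝ, ContDiff ℝ ∞ φ → HasCompactSupport φ →
      ∫ z, u z * pderiv i φ z = -∫ z, v z * φ z

/-- The locally integrable function `v` is the weak derivative `Y u`. The formal adjoint of `Y`
is `-Y`, because the trace of `B` is zero. -/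
def IsWeakYDeriv (B : Matrix (Idx d) (Idx d) ℝ) (u v : Pt d → ℝ) : Prop :=
  LocallyIntegrable u ∧ LocallyIntegrable v ∧
    ∀ φ : Pt d → ℝ, ContDiff ℝ ∞ φ → HasCompactSupport φ →
      ∫ z, u z * yderiv B φ z = -∫ z, v z * φ z

/-- The locally integrable function `v` is the weak derivative `Y^k ∂^β u`. The formal adjoint of
`Y^k ∂^β` is `(-1)^(k + |β|) ∂^β Y^k`. -/
def IsWeakDeriv (B : Matrix (Idx d) (Idx d) ℝ) (k : ℕ) (β : Idx d → ℕ) (u v : Pt d → ℝ) : Prop :=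
  LocallyIntegrable u ∧ LocallyIntegrable v ∧
    ∀ φ : Pt d → ℝ, ContDiff ℝ ∞ φ → HasCompactSupport φ →
      ∫ z, u z * mderiv β ((yderiv B)^[k] φ) z = (-1) ^ (k + ∑ i, β i) * ∫ z, v z * φ z

/-! ### Integral curves and Besov quasi-norms -/

/-- `e^{h ∂_{x_i}} (t, x) = (t, x + h e_i)`. -/
def pflow (i : Idx d) (h : ℝ) (z : Pt d) : Pt d := (z.1, z.2 + h • Pi.single i 1)

/-- `e^{h Y} (t, x) = (t + h, e^{h B} x)`. -/
noncomputable def yflow (B : Matrix (Idx d) (Idx d) ℝ) (h : ℝ) (z : Pt d) : Pt d :=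
  (z.1 + h, (NormedSpace.exp (h • B)).mulVec z.2)

/-- The fractional Besov quasi-norm `[u]_{X,σ,p,q}` of order `σ` along the vector field `X` of
formal weight `m`, where `flow h z = e^{h X} z`. -/
noncomputable def dirSeminorm (flow : ℝ → Pt d → Pt d) (m σ : ℝ) (p q : ℝ≥0∞) (u : Pt d → ℝ) :
    ℝ≥0∞ :=
  if q = ⊤ then
    ⨆ (h : ℝ) (_ : h ≠ 0),
      eLpNorm (fun z => u (flow h z) - u z) p volume / ENNReal.ofReal (|h| ^ (σ / m))
  else
    (∫⁻ h : ℝ, eLpNorm (fun z => u (flow h z) - u z) p volume ^ q.toReal /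
      ENNReal.ofReal (|h| ^ (1 + q.toReal * (σ / m)))) ^ (1 / q.toReal)

/-- `[u]_{∂_{x_i},σ,p,q}`, with formal weight `1`. -/
noncomputable def pSeminorm (i : Idx d) (σ : ℝ) (p q : ℝ≥0∞) (u : Pt d → ℝ) : ℝ≥0∞ :=
  dirSeminorm (pflow i) 1 σ p q u

/-- `[u]_{Y,σ,p,q}`, with formal weight `2`. -/
noncomputable def ySeminorm (B : Matrix (Idx d) (Idx d) ℝ) (σ : ℝ) (p q : ℝ≥0∞) (u : Pt d → ℝ) :
    ℝ≥0∞ :=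
  dirSeminorm (yflow B) 2 σ p q u

/-- The quasi-norm `|u|_{n+s,p,q}`:
`|u|_s = ∑_{i ≤ d} [u]_{∂_{x_i},s} + [u]_{Y,s}`,
`|u|_{1+s} = |∇_d u|_s + [u]_{Y,1+s}` and
`|u|_{n+s} = |∇_d u|_{n-1+s} + |Y u|_{n-2+s}` for `n ≥ 2`.
The derivatives are weak ones. A weak derivative is unique up to a null set, and the quasi-norm
does not see null sets, so each infimum below is over equal values; it is `∞` if the weak
derivative does not exist as a locally integrable function. -/
noncomputable def besovSeminorm (B : Matrix (Idx d) (Idx d) ℝ) (s : ℝ) (p q : ℝ≥0∞) :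
    ℕ → (Pt d → ℝ) → ℝ≥0∞
  | 0, u => ∑ a : Fin (d 0), pSeminorm ⟨0, a⟩ s p q u + ySeminorm B s p q u
  | 1, u =>
      ∑ a : Fin (d 0), (⨅ (v : Pt d → ℝ) (_ : IsWeakPDeriv ⟨0, a⟩ u v),
        besovSeminorm B s p q 0 v) + ySeminorm B (1 + s) p q u
  | n + 2, u =>
      ∑ a : Fin (d 0), (⨅ (v : Pt d → ℝ) (_ : IsWeakPDeriv ⟨0, a⟩ u v),
        besovSeminorm B s p q (n + 1) v) +
      ⨅ (v : Pt d → ℝ) (_ : IsWeakYDeriv B u v), besovSeminorm B s p q n v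

/-- Membership in the intrinsic Besov space `Λ^{n+s}_{p,q,B}`: `u` is (Lebesgue) measurable and
`‖u‖_p + |u|_{n+s,p,q}` is finite. -/
def MemBesov (B : Matrix (Idx d) (Idx d) ℝ) (n : ℕ) (s : ℝ) (p q : ℝ≥0∞) (u : Pt d → ℝ) : Prop :=
  AEStronglyMeasurable u volume ∧ eLpNorm u p volume + besovSeminorm B s p q n u < ⊤

end

end Kolmogorov

/-!
The group of dilations for which `∂_{x_i}` in block `j` has weight `2 j + 1` and `Y` has weight `2`
governs the proof. The fields of the first block and `Y` generate all others: `[∂_{x_b}, Y]` is the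
derivative in the direction `B e_b`, and by the rank condition the vectors `B e_b`, with `b` in
block `j`, span block `j + 1`.

A function `u` with `|u|_{n+s,p,q} < ∞` has weak derivatives of intrinsic order up to `n` along the
generating fields, and there is one function `F` of the scale `ρ` that bounds the increments of all
of them: those of a derivative of order `n - m`, over times up to `ρ^w` along a field of weight
`w > m`, are at most `ρ^m F(ρ)` in `L^p` (`IsControlled`). The Besov norm enters only through the
norm of `ρ^(-s) F(ρ)` in `L^q(dρ/ρ)` (`scaleNorm`): as the modulus of continuity along a flow is
subadditive, its supremum over `|τ| ≤ h` is bounded by an average, so passing to this supremum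
costs a constant only (`exists_isControlled`). Weak derivatives in the directions of the higher
blocks are obtained from commutators, and `Y^k ∂^β` lowers the order of control by `2 k + ⟨β⟩_B`
(`exists_isWeakDeriv`). It remains to bound increments of a function `v` that is controlled to
order `m`, where `m + s < 2 j + 1`, in the directions of block `j`.

Translation by a small multiple of `ρ^(2j+1)` in such a direction is a product of flows of
generating fields of weight `w`, run for times `c ρ^w` with `|c| ≤ 1`: conjugating a translation by
`ρ y`, with `y` in the first block, by the flow of `Y` gives the translation by `ρ exp(c ρ² B) y`,
and a Vandermonde system extracts the term `ρ^(2j+1) B^j y` (`exists_isAdmissible_pflow`). Along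
such a product, repeated Taylor expansion shows that `v` becomes a polynomial of degree `m` in `ρ`,
whose coefficients are functions, up to an error `ρ^m F(ρ)` in `L^p`
(`IsAdmissible.exists_taylor`). Against a test function, the increment itself is
`O(ρ^(2j+1)) = o(ρ^m)`, because the derivative falls on the test function, and `F` is small along
some scales `ρ → 0`. So the polynomial is the constant `v`, and the increment is of size `ρ^m F(ρ)`
(`exists_eLpNorm_pflow_sub_le`). The substitution `h = κ ρ^(2j+1)` turns this into the Besov
estimate of order `(m + s) / (2 j + 1)` (`dirSeminorm_le_scaleNorm`).

The remainder in Taylor's formula is estimated by duality: its pairings with test functions are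
scalar Taylor remainders, and a converse Hölder inequality recovers the `L^p` norm
(`eLpNorm_le_of_test`). This treats all `p`, including `1` and `∞`, at once.
-/

namespace Kolmogorov

set_option linter.unusedSectionVars false

open Filter Topology Set

/-! ### A converse Hölder inequality -/

section ConverseHolder

variable {E : Type*} [NormedAddCommGroup E] [NormedSpace ℝ E] [FiniteDimensional ℝ E]
  [MeasurableSpace E] [BorelSpace E] {μ : Measure E} [μ.IsAddHaarMeasure]

open scoped Pointwise in
/-- A bounded function with compact support is an almost everywhere limit of smooth functions with
the same bound and supports in a common compact set, namely of its mollifications. -/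
theorem exists_contDiff_tendsto_ae {g : E → ℝ} (hg : AEStronglyMeasurable g μ) {M : ℝ}
    (hM : ∀ x, |g x| ≤ M) (hc : HasCompactSupport g) :
    ∃ (K : Set E) (G : ℕ → E → ℝ), IsCompact K ∧
      (∀ n, ContDiff ℝ ∞ (G n) ∧ (∀ x, |G n x| ≤ M) ∧ Function.support (G n) ⊆ K) ∧
      ∀ᵐ x ∂μ, Tendsto (fun n => G n x) atTop (𝓝 (g x)) := by
  have hM0 : 0 ≤ M := (abs_nonneg _).trans (hM 0)
  have hgint : Integrable g μ := by
    have h1 : IntegrableOn g (tsupport g) μ := by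
      refine ⟨hg.restrict, ?_⟩
      refine HasFiniteIntegral.restrict_of_bounded (C := M) ?_ (Eventually.of_forall hM)
      exact hc.isCompact.measure_lt_top
    exact (integrableOn_iff_integrable_of_support_subset (subset_tsupport g)).1 h1
  let φ : ℕ → ContDiffBump (0 : E) := fun n =>
    ⟨1 / ((n : ℝ) + 1), 2 * (1 / ((n : ℝ) + 1)), by positivity, by
      have : 0 < 1 / ((n : ℝ) + 1) := by positivity
      linarith⟩
  have hφ : Tendsto (fun n => (φ n).rOut) atTop (𝓝 0) := by
    have := (tendsto_one_div_add_atTop_nhds_zero_nat (𝕜 := ℝ)).const_mul 2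
    rwa [mul_zero] at this
  refine ⟨tsupport g + Metric.closedBall 0 2,
    fun n => MeasureTheory.convolution ((φ n).normed μ) g (ContinuousLinearMap.lsmul ℝ ℝ) μ,
    ?_, ?_, ?_⟩
  · exact hc.isCompact.add (isCompact_closedBall _ _)
  · intro n
    refine ⟨?_, ?_, ?_⟩
    · exact (φ n).hasCompactSupport_normed.contDiff_convolution_left _ (φ n).contDiff_normed
        hgint.locallyIntegrable
    · intro x
      have := dist_convolution_le (μ := μ) (f := (φ n).normed μ) (g := g) (x₀ := x) (z₀ := 0)
        (R := (φ n).rOut) hM0 (φ n).support_normed_eq.subset (φ n).nonneg_normed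
        (φ n).integral_normed hg (fun y _ => by simpa using hM y)
      simpa using this
    · refine (support_convolution_subset _).trans ?_
      rw [add_comm]
      refine Set.add_subset_add (subset_tsupport g) ?_
      rw [(φ n).support_normed_eq]
      refine Metric.ball_subset_closedBall.trans (Metric.closedBall_subset_closedBall ?_)
      change 2 * (1 / ((n : ℝ) + 1)) ≤ 2
      have : 1 / ((n : ℝ) + 1) ≤ 1 := by
        rw [div_le_one (by positivity)]; linarith [n.cast_nonneg (α := ℝ)]
      linarith
  · exact ContDiffBump.ae_convolution_tendsto_right_of_locallyIntegrable (K := 2) hφ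
      (Eventually.of_forall fun n => le_rfl) hgint.locallyIntegrable

/-- An inequality between `w` and smooth test functions extends to bounded measurable functions
with compact support. For `q = ∞` mollifications do not converge in norm, and the bound `M` of the
function takes the place of its norm. -/
theorem enorm_integral_mul_le_of_test {w : E → ℝ} (hw : LocallyIntegrable w μ) {C q : ℝ≥0∞}
    (hq : q ≠ 0) (hC : C ≠ ⊤)
    (h : ∀ φ : E → ℝ, ContDiff ℝ ∞ φ → HasCompactSupport φ →
      ‖∫ x, w x * φ x ∂μ‖ₑ ≤ C * eLpNorm φ q μ)
    {g : E → ℝ} (hg : AEStronglyMeasurable g μ) {M : ℝ} (hM : ∀ x, |g x| ≤ M)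
    (hc : HasCompactSupport g) {D : ℝ≥0∞} (hD : eLpNorm g q μ ≤ D)
    (htop : q = ⊤ → ENNReal.ofReal M ≤ D) :
    ‖∫ x, w x * g x ∂μ‖ₑ ≤ C * D := by
  obtain ⟨K, G, hK, hG, hlim⟩ := exists_contDiff_tendsto_ae hg hM hc
  have hM0 : 0 ≤ M := (abs_nonneg _).trans (hM 0)
  have hGc : ∀ n, HasCompactSupport (G n) := fun n =>
    HasCompactSupport.of_support_subset_isCompact hK (hG n).2.2
  have hbd : ∀ n x, |G n x| ≤ K.indicator (fun _ => M) x := by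
    intro n x
    by_cases hx : x ∈ K
    · simpa [hx] using (hG n).2.1 x
    · have : G n x = 0 := by
        by_contra hne
        exact hx ((hG n).2.2 hne)
      simp [hx, this]
  have h1 : Tendsto (fun n => ∫ x, w x * G n x ∂μ) atTop (𝓝 (∫ x, w x * g x ∂μ)) := by
    refine tendsto_integral_of_dominated_convergence (fun x => K.indicator (fun x => |w x| * M) x)
      ?_ ?_ ?_ ?_
    · intro n
      exact hw.aestronglyMeasurable.mul (hG n).1.continuous.aestronglyMeasurable
    · rw [integrable_indicator_iff hK.measurableSet]
      exact ((hw.integrableOn_isCompact hK).abs).mul_const M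
    · intro n
      refine Eventually.of_forall fun x => ?_
      have := hbd n x
      rw [norm_mul, Real.norm_eq_abs, Real.norm_eq_abs]
      by_cases hx : x ∈ K
      · simp only [hx, indicator_of_mem] at this ⊢
        gcongr
      · simp only [hx, not_false_eq_true, indicator_of_notMem] at this ⊢
        rw [le_antisymm this (abs_nonneg _)]; simp
    · filter_upwards [hlim] with x hx using hx.const_mul _
  have h1' : Tendsto (fun n => ‖∫ x, w x * G n x ∂μ‖ₑ) atTop (𝓝 ‖∫ x, w x * g x ∂μ‖ₑ) :=
    h1.enorm
  have h2 : ∀ n, ‖∫ x, w x * G n x ∂μ‖ₑ ≤ C * eLpNorm (G n) q μ := fun n => h _ (hG n).1 (hGc n)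
  by_cases hqt : q = ⊤
  · refine le_of_tendsto h1' (Eventually.of_forall fun n => (h2 n).trans ?_)
    gcongr
    refine le_trans ?_ (htop hqt)
    subst hqt
    rw [eLpNorm_exponent_top]
    refine eLpNormEssSup_le_of_ae_bound (Eventually.of_forall fun x => (hG n).2.1 x)
  · have hq' : 0 < q.toReal := ENNReal.toReal_pos hq hqt
    have h3 : Tendsto (fun n => eLpNorm (G n) q μ) atTop (𝓝 (eLpNorm g q μ)) := by
      simp_rw [eLpNorm_eq_lintegral_rpow_enorm_toReal hq hqt]
      refine (ENNReal.continuous_rpow_const.tendsto _).comp ?_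
      refine tendsto_lintegral_of_dominated_convergence'
        (fun x => K.indicator (fun _ => ENNReal.ofReal M ^ q.toReal) x) ?_ ?_ ?_ ?_
      · intro n
        exact ((hG n).1.continuous.aestronglyMeasurable.enorm).pow_const _
      · intro n
        refine Eventually.of_forall fun x => ?_
        have := hbd n x
        have he : ‖G n x‖ₑ = ENNReal.ofReal |G n x| := Real.enorm_eq_ofReal_abs _
        simp only [he]
        by_cases hx : x ∈ K
        · simp only [hx, indicator_of_mem] at this ⊢
          gcongr
        · simp only [hx, not_false_eq_true, indicator_of_notMem] at this ⊢
          rw [le_antisymm this (abs_nonneg _)]; simp [hq']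
      · rw [lintegral_indicator hK.measurableSet, setLIntegral_const]
        exact ENNReal.mul_ne_top (ENNReal.rpow_ne_top_of_nonneg hq'.le ENNReal.ofReal_ne_top)
          hK.measure_lt_top.ne
      · filter_upwards [hlim] with x hx
        exact (ENNReal.continuous_rpow_const.tendsto _).comp hx.enorm
    refine le_trans (le_of_tendsto_of_tendsto' h1'
      (ENNReal.Tendsto.const_mul h3 (Or.inr hC)) h2) ?_
    gcongr

/-- The case of the converse Hölder inequality in which the function is bounded with compact
support; there the extremal function `sign w · |w|^(p-1)` may be used. -/
theorem eLpNorm_le_of_test_of_bounded {f w : E → ℝ} (hw : LocallyIntegrable w μ)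
    {C p q : ℝ≥0∞} [hpq : ENNReal.HolderConjugate p q] (hC : C ≠ ⊤)
    (h : ∀ φ : E → ℝ, ContDiff ℝ ∞ φ → HasCompactSupport φ →
      ‖∫ x, w x * φ x ∂μ‖ₑ ≤ C * eLpNorm φ q μ)
    (hf : AEStronglyMeasurable f μ) {R : ℝ} (hR : ∀ x, |f x| ≤ R) (hc : HasCompactSupport f)
    (hfw : ∀ x, f x ≠ 0 → w x = f x) :
    eLpNorm f p μ ≤ C := by
  have hq0 : q ≠ 0 := ENNReal.HolderConjugate.ne_zero q p
  have hp0 : p ≠ 0 := ENNReal.HolderConjugate.ne_zero p q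
  have hR0 : 0 ≤ R := (abs_nonneg _).trans (hR 0)
  have hKfin : μ (tsupport f) < ⊤ := hc.isCompact.measure_lt_top
  have hsm : AEStronglyMeasurable (fun x => SignType.sign (f x) : E → ℝ) μ := by
    refine Measurable.comp_aemeasurable (g := fun y : ℝ => (SignType.sign y : ℝ)) ?_
      hf.aemeasurable |>.aestronglyMeasurable
    have : (fun y : ℝ => (SignType.sign y : ℝ)) = fun y => if 0 < y then 1 else if y < 0 then -1
        else 0 := by
      funext y
      rw [sign_apply]
      split_ifs <;> simp
    rw [this]
    exact Measurable.ite measurableSet_Ioi measurable_const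
      (Measurable.ite measurableSet_Iio measurable_const measurable_const)
  have hsign : ∀ y : ℝ, |(SignType.sign y : ℝ)| ≤ 1 := by
    intro y
    rcases lt_trichotomy y 0 with hy | hy | hy <;> simp [hy]
  by_cases hpt : p = ⊤
  · subst hpt
    have hq1 : q = 1 := (ENNReal.HolderConjugate.eq_top_iff_eq_one ⊤ q).1 rfl
    subst hq1
    rw [eLpNorm_exponent_top]
    refine eLpNormEssSup_le_of_ae_enorm_bound ?_
    -- The set `{C + δ ≤ ‖f‖}` is null for each `δ > 0`, as follows by testing with `sign f` on it.
    have key : ∀ k : ℕ, μ {x | C + (k + 1 : ℝ≥0∞)⁻¹ ≤ ‖f x‖ₑ} = 0 := by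
      intro k
      set δ : ℝ≥0∞ := (k + 1 : ℝ≥0∞)⁻¹
      have hδ : δ ≠ 0 := by simp [δ]
      set A : Set E := {x | C + δ ≤ ‖f x‖ₑ}
      have hA : NullMeasurableSet A μ := nullMeasurableSet_le aemeasurable_const hf.enorm
      have hAK : A ⊆ tsupport f := by
        intro x hx
        apply subset_tsupport
        intro h0
        simp only [A, mem_ofPred_eq, h0, enorm_zero, nonpos_iff_eq_zero, add_eq_zero] at hx
        exact hδ hx.2
      have hAfin : μ A ≠ ⊤ := ((measure_mono hAK).trans_lt hKfin).ne
      let g : E → ℝ := fun x => A.indicator (fun x => (SignType.sign (f x) : ℝ)) x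
      have hgm : AEStronglyMeasurable g μ := hsm.indicator₀ hA
      have hg1 : ∀ x, |g x| ≤ 1 := by
        intro x
        by_cases hx : x ∈ A
        · simpa [g, hx] using hsign _
        · simp [g, hx]
      have hgc : HasCompactSupport g := by
        refine HasCompactSupport.of_support_subset_isCompact hc.isCompact ?_
        intro x hx
        by_contra hxf
        have : x ∉ A := fun hA => hxf (hAK hA)
        simp [g, this] at hx
      have hgnorm : eLpNorm g 1 μ ≤ μ A := by
        rw [eLpNorm_one_eq_lintegral_enorm, ← lintegral_indicator_one₀ hA]
        refine lintegral_mono fun x => ?_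
        by_cases hx : x ∈ A
        · simp only [g, hx, indicator_of_mem, Pi.one_apply]
          rw [Real.enorm_eq_ofReal_abs]
          exact ENNReal.ofReal_le_one.2 (hsign _)
        · simp [g, hx]
      have h2 := enorm_integral_mul_le_of_test hw one_ne_zero hC h hgm hg1 hgc hgnorm
        (fun h => absurd h (by simp))
      have h3 : ∀ x, w x * g x = A.indicator (fun x => |f x|) x := by
        intro x
        by_cases hx : x ∈ A
        · have hne : f x ≠ 0 := by
            intro h0
            simp only [A, mem_ofPred_eq, h0, enorm_zero, nonpos_iff_eq_zero, add_eq_zero] at hx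
            exact hδ hx.2
          simp only [g, hx, indicator_of_mem, hfw x hne]
          exact self_mul_sign (f x)
        · simp [g, hx]
      have h4 : ‖∫ x, w x * g x ∂μ‖ₑ = ∫⁻ x in A, ‖f x‖ₑ ∂μ := by
        simp_rw [h3]
        rw [integral_indicator₀ hA, ← ofReal_integral_norm_eq_lintegral_enorm,
          Real.enorm_eq_ofReal_abs, abs_of_nonneg (integral_nonneg fun x => abs_nonneg _)]
        · rfl
        · refine ⟨hf.restrict, HasFiniteIntegral.restrict_of_bounded (C := R) hAfin.lt_top
            (Eventually.of_forall hR)⟩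
      have h5 : (C + δ) * μ A ≤ C * μ A := by
        refine le_trans ?_ (h4 ▸ h2)
        rw [← setLIntegral_const]
        refine lintegral_mono_ae ?_
        filter_upwards [ae_restrict_mem₀ hA] with x hx using hx
      by_contra hne
      have h6 : C + δ ≤ C := (ENNReal.mul_le_mul_iff_left hne hAfin).1 h5
      exact absurd h6 (not_le.2 (ENNReal.lt_add_right hC hδ))
    have key2 : μ (⋃ k : ℕ, {x | C + (k + 1 : ℝ≥0∞)⁻¹ ≤ ‖f x‖ₑ}) = 0 :=
      measure_iUnion_null key
    refine measure_mono_null ?_ key2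
    intro x hx
    simp only [mem_compl_iff, mem_ofPred_eq, not_le] at hx
    obtain ⟨n, hn⟩ := ENNReal.exists_inv_nat_lt (tsub_pos_of_lt hx).ne'
    refine mem_iUnion.2 ⟨n, ?_⟩
    simp only [mem_ofPred_eq]
    have : ((n : ℝ≥0∞) + 1)⁻¹ ≤ ‖f x‖ₑ - C := by
      refine le_trans ?_ hn.le
      gcongr
      exact le_self_add
    calc C + (n + 1 : ℝ≥0∞)⁻¹ ≤ C + (‖f x‖ₑ - C) := by gcongr
      _ = ‖f x‖ₑ := add_tsub_cancel_of_le hx.le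
  · set P := p.toReal with hP
    have hp1 : 1 ≤ p := ENNReal.HolderConjugate.one_le p q
    have hP1 : 1 ≤ P := by
      rw [hP, ← ENNReal.toReal_one]
      exact ENNReal.toReal_mono hpt hp1
    let g : E → ℝ := fun x => (SignType.sign (f x) : ℝ) * |f x| ^ (P - 1)
    have hgm : AEStronglyMeasurable g μ :=
      hsm.mul ((hf.aemeasurable.abs.pow_const _).aestronglyMeasurable)
    have hgR : ∀ x, |g x| ≤ R ^ (P - 1) := by
      intro x
      simp only [g, abs_mul]
      rw [abs_of_nonneg (Real.rpow_nonneg (abs_nonneg _) _)]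
      calc _ ≤ 1 * R ^ (P - 1) := by
            gcongr
            · exact hsign _
            · exact hR x
        _ = _ := one_mul _
    have hgc : HasCompactSupport g := by
      refine HasCompactSupport.of_support_subset_isCompact hc.isCompact ?_
      intro x hx
      apply subset_tsupport
      intro h0
      simp [g, h0] at hx
    set I : ℝ≥0∞ := ∫⁻ x, ‖f x‖ₑ ^ P ∂μ with hI
    have hfm : MemLp f p μ := by
      refine MemLp.mono_exponent_of_measure_support_ne_top (q := ⊤) ?_
        (s := tsupport f) (fun x hx => image_eq_zero_of_notMem_tsupport hx) hKfin.ne le_top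
      exact memLp_top_of_bound hf R (Eventually.of_forall hR)
    have hfP : eLpNorm f p μ = I ^ (1 / P) := eLpNorm_eq_lintegral_rpow_enorm_toReal hp0 hpt
    have hItop : I ≠ ⊤ := by
      intro h0
      have := hfm.2
      rw [hfP, h0, ENNReal.top_rpow_of_pos (by positivity)] at this
      exact absurd this (lt_irrefl _)
    have h3 : ∀ x, w x * g x = |f x| ^ P := by
      intro x
      by_cases hne : f x = 0
      · simp [g, hne, Real.zero_rpow (by linarith : P ≠ 0)]
      · simp only [g, hfw x hne]
        rw [← mul_assoc, self_mul_sign, mul_comm,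
          ← Real.rpow_add_one (abs_ne_zero.2 hne), sub_add_cancel]
    have h4 : ‖∫ x, w x * g x ∂μ‖ₑ = I := by
      simp_rw [h3]
      rw [integral_eq_lintegral_of_nonneg_ae (Eventually.of_forall fun x => by positivity)
        ((hf.aemeasurable.abs.pow_const _).aestronglyMeasurable)]
      have h5 : ∫⁻ x, ENNReal.ofReal (|f x| ^ P) ∂μ = I := by
        refine lintegral_congr fun x => ?_
        rw [Real.enorm_eq_ofReal_abs, ENNReal.ofReal_rpow_of_nonneg (abs_nonneg _) (by linarith)]
      rw [h5, Real.enorm_eq_ofReal_abs, abs_of_nonneg ENNReal.toReal_nonneg,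
        ENNReal.ofReal_toReal hItop]
    rcases eq_or_ne I 0 with hI0 | hI0
    · rw [hfP, hI0, ENNReal.zero_rpow_of_pos (by positivity)]
      exact zero_le
    by_cases hqt : q = ⊤
    · have hp1' : p = 1 := (ENNReal.HolderConjugate.eq_top_iff_eq_one q p).1 hqt
      have hP' : P = 1 := by rw [hP, hp1', ENNReal.toReal_one]
      have hg1 : ∀ x, |g x| ≤ 1 := fun x => by simpa [hP'] using hgR x
      have h2 := enorm_integral_mul_le_of_test hw hq0 hC h hgm hg1 hgc (D := 1)
        (by
          subst hqt
          rw [eLpNorm_exponent_top]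
          refine (eLpNormEssSup_le_of_ae_bound (Eventually.of_forall hg1)).trans ?_
          simp)
        (fun _ => by simp)
      rw [h4, mul_one] at h2
      rw [hfP, hP']
      simpa using h2
    · have hPQ : P.HolderConjugate q.toReal := by
        have := ENNReal.HolderConjugate.toReal_of_ne_top (p := p) (q := q) hpt hqt
        exact this
      have hgq : eLpNorm g q μ ≤ I ^ (1 / q.toReal) := by
        rw [eLpNorm_eq_lintegral_rpow_enorm_toReal hq0 hqt]
        refine ENNReal.rpow_le_rpow (lintegral_mono fun x => ?_)
          (by have := hPQ.symm.pos; positivity)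
        change ‖g x‖ₑ ^ q.toReal ≤ ‖f x‖ₑ ^ P
        by_cases hne : f x = 0
        · simp [g, hne, hPQ.symm.pos]
        · rw [Real.enorm_eq_ofReal_abs, Real.enorm_eq_ofReal_abs]
          simp only [g, abs_mul]
          rw [abs_of_nonneg (Real.rpow_nonneg (abs_nonneg _) _)]
          have : |(SignType.sign (f x) : ℝ)| = 1 := by
            rcases lt_or_gt_of_ne hne with hy | hy <;> simp [hy]
          rw [this, one_mul, ← ENNReal.ofReal_rpow_of_nonneg (abs_nonneg _) (by linarith),
            ← ENNReal.rpow_mul, hPQ.sub_one_mul_conj]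
      have h2 := enorm_integral_mul_le_of_test hw hq0 hC h hgm hgR hgc hgq
        (fun h => absurd h hqt)
      rw [h4] at h2
      rw [hfP]
      have h6 : I = I ^ (1 / P) * I ^ (1 / q.toReal) := by
        rw [← ENNReal.rpow_add _ _ hI0 hItop, one_div, one_div, hPQ.inv_add_inv_eq_one,
          ENNReal.rpow_one]
      nth_rw 1 [h6] at h2
      refine (ENNReal.mul_le_mul_iff_left ?_ ?_).1 h2
      · simp [hI0, hItop]
      · exact ENNReal.rpow_ne_top_of_nonneg (by have := hPQ.symm.pos; positivity) hItop

/-- Converse Hölder inequality: the `L^p` norm of a locally integrable function is at most its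
norm as a functional on smooth test functions with the `L^q` norm, `1/p + 1/q = 1`. -/
theorem eLpNorm_le_of_test {w : E → ℝ} (hw : LocallyIntegrable w μ)
    {C p q : ℝ≥0∞} [hpq : ENNReal.HolderConjugate p q]
    (h : ∀ φ : E → ℝ, ContDiff ℝ ∞ φ → HasCompactSupport φ →
      ‖∫ x, w x * φ x ∂μ‖ₑ ≤ C * eLpNorm φ q μ) :
    eLpNorm w p μ ≤ C := by
  rcases eq_or_ne C ⊤ with rfl | hC
  · exact le_top
  let w' := hw.aestronglyMeasurable.mk w
  have hww : w =ᵐ[μ] w' := hw.aestronglyMeasurable.ae_eq_mk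
  have hw'm : StronglyMeasurable w' := hw.aestronglyMeasurable.stronglyMeasurable_mk
  have hw' : LocallyIntegrable w' μ := fun x => by
    obtain ⟨U, hU, hUi⟩ := hw x
    exact ⟨U, hU, hUi.congr (ae_restrict_of_ae hww)⟩
  have h' : ∀ φ : E → ℝ, ContDiff ℝ ∞ φ → HasCompactSupport φ →
      ‖∫ x, w' x * φ x ∂μ‖ₑ ≤ C * eLpNorm φ q μ := by
    intro φ h1 h2
    rw [← integral_congr_ae (hww.mono fun x hx => by simp only [hx] : (fun x => w x * φ x) =ᵐ[μ] _)]
    exact h φ h1 h2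
  rw [eLpNorm_congr_ae hww]
  -- Truncations of `w`, to which the bounded case applies; the bound passes to the limit by Fatou.
  let A : ℕ → Set E := fun n => Metric.closedBall 0 n ∩ {x | |w' x| ≤ n}
  have hA : ∀ n, MeasurableSet (A n) := fun n =>
    measurableSet_closedBall.inter (measurableSet_le hw'm.measurable.abs measurable_const)
  let f : ℕ → E → ℝ := fun n => (A n).indicator w'
  have hf : ∀ n, eLpNorm (f n) p μ ≤ C := by
    intro n
    refine eLpNorm_le_of_test_of_bounded hw' hC h'
      (hw'm.indicator (hA n)).aestronglyMeasurable (R := n) ?_ ?_ ?_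
    · intro x
      by_cases hx : x ∈ A n
      · simpa [f, hx] using hx.2
      · simp [f, hx]
    · refine HasCompactSupport.of_support_subset_isCompact
        (isCompact_closedBall (0 : E) n) ?_
      exact (support_indicator_subset).trans inter_subset_left
    · intro x hx
      have : x ∈ A n := by
        by_contra hx'
        simp [f, hx'] at hx
      simp [f, this]
  refine (Lp.eLpNorm_lim_le_liminf_eLpNorm (f := f)
    (fun n => (hw'm.indicator (hA n)).aestronglyMeasurable) w' ?_).trans ?_
  · refine Eventually.of_forall fun x => ?_
    obtain ⟨n, hn⟩ := exists_nat_ge (max ‖x‖ |w' x|)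
    refine tendsto_const_nhds.congr' ?_
    filter_upwards [eventually_ge_atTop n] with m hm
    have hmn : (n : ℝ) ≤ m := by exact_mod_cast hm
    have : x ∈ A m := ⟨by simpa using ((le_max_left _ _).trans hn).trans hmn,
      ((le_max_right _ _).trans hn).trans hmn⟩
    simp [f, this]
  · exact (liminf_le_liminf (Eventually.of_forall hf)).trans (by simp)

end ConverseHolder

/-! ### Taylor expansion along a smooth flow -/

section Flow

variable {E : Type*} [NormedAddCommGroup E] [NormedSpace ℝ E] [FiniteDimensional ℝ E]
  [MeasurableSpace E] [BorelSpace E]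

/-- `flow` is a complete smooth flow, generated by the vector field `V`, that preserves the
measure `μ`. -/
structure IsSmoothFlow (μ : Measure E) (flow : ℝ → E → E) (V : E → E) : Prop where
  contDiff : ContDiff ℝ ∞ fun x : ℝ × E => flow x.1 x.2
  contDiff_field : ContDiff ℝ ∞ V
  zero : ∀ z, flow 0 z = z
  add : ∀ s t z, flow (s + t) z = flow s (flow t z)
  hasDerivAt_zero : ∀ z, HasDerivAt (fun h => flow h z) (V z) 0
  measurePreserving : ∀ h, MeasurePreserving (flow h) μ μ

/-- `v` is the weak derivative of `u` along the vector field `V`, whose formal adjoint is taken to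
be `-V`: the field has to be divergence-free, as it is if its flow preserves `μ`. For `∂_{x_i}` and
`Y` this is `IsWeakPDeriv` and `IsWeakYDeriv` by definition. -/
def IsWeakVDeriv (μ : Measure E) (V : E → E) (u v : E → ℝ) : Prop :=
  LocallyIntegrable u μ ∧ LocallyIntegrable v μ ∧
    ∀ φ : E → ℝ, ContDiff ℝ ∞ φ → HasCompactSupport φ →
      ∫ z, u z * fderiv ℝ φ z (V z) ∂μ = -∫ z, v z * φ z ∂μ

theorem integrable_mul_test {μ : Measure E} {u φ : E → ℝ} (hu : LocallyIntegrable u μ)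
    (hφ : Continuous φ) (hc : HasCompactSupport φ) : Integrable (fun z => u z * φ z) μ := by
  simpa [mul_comm] using hu.integrable_smul_left_of_hasCompactSupport hφ hc

namespace IsSmoothFlow

variable {μ : Measure E} {flow : ℝ → E → E} {V : E → E}

theorem contDiff_flow (hf : IsSmoothFlow μ flow V) (h : ℝ) : ContDiff ℝ ∞ (flow h) :=
  hf.contDiff.comp (contDiff_const.prodMk contDiff_id)

theorem flow_neg_flow (hf : IsSmoothFlow μ flow V) (h : ℝ) (z : E) : flow (-h) (flow h z) = z := by
  rw [← hf.add, neg_add_cancel, hf.zero]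

theorem flow_flow_neg (hf : IsSmoothFlow μ flow V) (h : ℝ) (z : E) : flow h (flow (-h) z) = z := by
  rw [← hf.add, add_neg_cancel, hf.zero]

/-- The time-`h` map as a homeomorphism. -/
def homeo (hf : IsSmoothFlow μ flow V) (h : ℝ) : E ≃ₜ E where
  toFun := flow h
  invFun := flow (-h)
  left_inv := hf.flow_neg_flow h
  right_inv := hf.flow_flow_neg h
  continuous_toFun := (hf.contDiff_flow h).continuous
  continuous_invFun := (hf.contDiff_flow (-h)).continuous

theorem integral_comp (hf : IsSmoothFlow μ flow V) (h : ℝ) (g : E → ℝ) :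
    ∫ z, g (flow h z) ∂μ = ∫ z, g z ∂μ :=
  (hf.measurePreserving h).integral_comp (hf.homeo h).measurableEmbedding g

theorem locallyIntegrable_comp (hf : IsSmoothFlow μ flow V) (h : ℝ) {u : E → ℝ}
    (hu : LocallyIntegrable u μ) : LocallyIntegrable (fun z => u (flow h z)) μ := by
  have := (locallyIntegrable_map_homeomorph (hf.homeo h) (f := u) (μ := μ)).1
    (by
      have : Measure.map (hf.homeo h) μ = μ := (hf.measurePreserving h).map_eq
      rwa [this])
  exact this

theorem hasCompactSupport_comp (hf : IsSmoothFlow μ flow V) (h : ℝ) {φ : E → ℝ}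
    (hc : HasCompactSupport φ) : HasCompactSupport fun z => φ (flow h z) :=
  hc.comp_homeomorph (hf.homeo h)

theorem contDiff_comp (hf : IsSmoothFlow μ flow V) (h : ℝ) {φ : E → ℝ}
    (hφ : ContDiff ℝ ∞ φ) : ContDiff ℝ ∞ fun z => φ (flow h z) :=
  hφ.comp (hf.contDiff_flow h)

theorem integral_comp_mul (hf : IsSmoothFlow μ flow V) (h : ℝ) (u φ : E → ℝ) :
    ∫ z, u (flow h z) * φ z ∂μ = ∫ z, u z * φ (flow (-h) z) ∂μ := by
  rw [← hf.integral_comp h fun z => u z * φ (flow (-h) z)]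
  simp only [hf.flow_neg_flow]

theorem hasDerivAt (hf : IsSmoothFlow μ flow V) (h : ℝ) (z : E) :
    HasDerivAt (fun h => flow h z) (V (flow h z)) h := by
  have h1 : HasDerivAt (fun t => flow t (flow h z)) (V (flow h z)) (h - h) := by
    rw [sub_self]; exact hf.hasDerivAt_zero _
  have h2 := h1.comp_sub_const (x := h) (a := h)
  refine h2.congr_of_eventuallyEq (Eventually.of_forall fun t => ?_)
  simp only
  rw [← hf.add, sub_add_cancel]

/-- Pairings of a locally integrable function with a test function that moves along the flow are
differentiable, since the derivative falls on the test function. -/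
theorem hasDerivAt_integral_zero (hf : IsSmoothFlow μ flow V) {u φ : E → ℝ}
    (hu : LocallyIntegrable u μ) (hφ : ContDiff ℝ ∞ φ) (hc : HasCompactSupport φ) :
    HasDerivAt (fun h => ∫ z, u z * φ (flow (-h) z) ∂μ)
      (-∫ z, u z * fderiv ℝ φ z (V z) ∂μ) 0 := by
  have hD : Continuous fun w => fderiv ℝ φ w (V w) :=
    (hφ.continuous_fderiv (by simp)).clm_apply hf.contDiff_field.continuous
  obtain ⟨M, hM⟩ := (hc.fderiv ℝ |>.isCompact).exists_bound_of_continuousOn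
    (f := fun w => fderiv ℝ φ w (V w)) hD.continuousOn
  have hM' : ∀ w, |fderiv ℝ φ w (V w)| ≤ max M 0 := by
    intro w
    by_cases hw : w ∈ tsupport (fderiv ℝ φ)
    · exact (hM w hw).trans (le_max_left _ _)
    · simp [image_eq_zero_of_notMem_tsupport hw]
  let K : Set E := (fun x : ℝ × E => flow x.1 x.2) '' (Metric.closedBall 0 1 ×ˢ tsupport φ)
  have hK : IsCompact K :=
    ((isCompact_closedBall 0 1).prod hc.isCompact).image hf.contDiff.continuous
  have hKmem : ∀ h ∈ Metric.ball (0 : ℝ) 1, ∀ z, z ∉ K → fderiv ℝ φ (flow (-h) z) = 0 := by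
    intro h hh z hz
    have : flow (-h) z ∉ tsupport φ := by
      intro hmem
      exact hz ⟨(h, flow (-h) z), ⟨Metric.ball_subset_closedBall hh, hmem⟩, hf.flow_flow_neg h z⟩
    by_contra hne
    exact this (support_fderiv_subset ℝ hne)
  have key := hasDerivAt_integral_of_dominated_loc_of_deriv_le (μ := μ) (x₀ := (0 : ℝ))
    (F := fun h z => u z * φ (flow (-h) z))
    (F' := fun h z => u z * -(fderiv ℝ φ (flow (-h) z) (V (flow (-h) z))))
    (bound := K.indicator fun z => |u z| * max M 0) (Metric.ball_mem_nhds 0 one_pos)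
    ?_ ?_ ?_ ?_ ?_ ?_
  · have h2 := key.2
    simp only [neg_zero, hf.zero, mul_neg] at h2
    rw [integral_neg] at h2
    exact h2
  · exact Eventually.of_forall fun h => hu.aestronglyMeasurable.mul
      (hf.contDiff_comp (-h) hφ).continuous.aestronglyMeasurable
  · exact integrable_mul_test hu (hf.contDiff_comp _ hφ).continuous (hf.hasCompactSupport_comp _ hc)
  · exact hu.aestronglyMeasurable.mul
      ((hD.comp (hf.contDiff_flow _).continuous).neg.aestronglyMeasurable)
  · refine Eventually.of_forall fun z h hh => ?_
    by_cases hz : z ∈ K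
    · simp only [hz, indicator_of_mem, norm_mul, norm_neg, Real.norm_eq_abs]
      gcongr
      exact hM' _
    · simp [hz, hKmem h hh z hz]
  · rw [integrable_indicator_iff hK.measurableSet]
    exact ((hu.integrableOn_isCompact hK).abs).mul_const _
  · refine Eventually.of_forall fun z h _ => ?_
    refine HasDerivAt.const_mul _ ?_
    have h1 : HasDerivAt (fun h => flow (-h) z) (-V (flow (-h) z)) h := by
      simpa [Function.comp_def] using (hf.hasDerivAt (-h) z).scomp h (hasDerivAt_neg h)
    have h2 := ((hφ.differentiable (by simp)) (flow (-h) z)).hasFDerivAt.comp_hasDerivAt h h1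
    simpa [Function.comp_def] using h2

/-- Pairings with test functions are differentiable along the flow, and the derivative is the
pairing with the weak derivative. -/
theorem hasDerivAt_integral (hf : IsSmoothFlow μ flow V) {u v φ : E → ℝ}
    (huv : IsWeakVDeriv μ V u v) (hφ : ContDiff ℝ ∞ φ) (hc : HasCompactSupport φ) (h : ℝ) :
    HasDerivAt (fun h => ∫ z, u (flow h z) * φ z ∂μ) (∫ z, v (flow h z) * φ z ∂μ) h := by
  have h1 : HasDerivAt (fun t => ∫ z, u z * φ (flow (-h) (flow (-t) z)) ∂μ)
      (∫ z, v z * φ (flow (-h) z) ∂μ) (h - h) := by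
    rw [sub_self]
    have h0 := hf.hasDerivAt_integral_zero huv.1 (hf.contDiff_comp (-h) hφ)
      (hf.hasCompactSupport_comp (-h) hc)
    rwa [huv.2.2 _ (hf.contDiff_comp (-h) hφ) (hf.hasCompactSupport_comp (-h) hc), neg_neg] at h0
  have h2 := h1.comp_sub_const (x := h) (a := h)
  rw [hf.integral_comp_mul]
  refine h2.congr_of_eventuallyEq (Eventually.of_forall fun t => ?_)
  simp only
  rw [hf.integral_comp_mul]
  refine integral_congr_ae (Eventually.of_forall fun z => ?_)
  simp only
  rw [← hf.add]
  ring_nf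

end IsSmoothFlow

/-- Taylor's formula for a chain `f 0, …, f M` of derivatives: the remainder of degree `M` is
bounded by the oscillation of `f M`. -/
theorem abs_sub_taylor_le (M : ℕ) (f : ℕ → ℝ → ℝ)
    (hf : ∀ m < M, ∀ h, HasDerivAt (f m) (f (m + 1) h) h) {r S : ℝ}
    (hS : ∀ τ, |τ| ≤ r → |f M τ - f M 0| ≤ S) :
    ∀ h, |h| ≤ r →
      |f 0 h - ∑ m ∈ Finset.range (M + 1), h ^ m / (m.factorial : ℝ) * f m 0| ≤ |h| ^ M * S := by
  induction M generalizing f with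
  | zero => intro h hh; simpa using hS h hh
  | succ M ih =>
    intro h hh
    let g : ℝ → ℝ := fun h =>
      f 0 h - ∑ m ∈ Finset.range (M + 1 + 1), h ^ m / (m.factorial : ℝ) * f m 0
    let g' : ℝ → ℝ := fun h =>
      f 1 h - ∑ m ∈ Finset.range (M + 1), h ^ m / (m.factorial : ℝ) * f (m + 1) 0
    have hS0 : 0 ≤ S := (abs_nonneg _).trans (hS 0 (by simpa using (abs_nonneg h).trans hh))
    have hg : ∀ t, HasDerivAt g (g' t) t := by
      intro t
      refine (hf 0 (by omega) t).sub ?_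
      simp only [Finset.sum_range_succ' _ (M + 1)]
      have : HasDerivAt (fun h : ℝ => ∑ m ∈ Finset.range (M + 1),
          h ^ (m + 1) / ((m + 1).factorial : ℝ) * f (m + 1) 0)
          (∑ m ∈ Finset.range (M + 1), t ^ m / (m.factorial : ℝ) * f (m + 1) 0) t := by
        refine HasDerivAt.fun_sum fun m _ => ?_
        have h1 := (((hasDerivAt_pow (m + 1) t).div_const ((m + 1).factorial : ℝ)).mul_const
          (f (m + 1) 0))
        refine h1.congr_deriv ?_
        congr 1
        rw [Nat.factorial_succ]
        push_cast
        have : (m.factorial : ℝ) ≠ 0 := by positivity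
        have : (m : ℝ) + 1 ≠ 0 := by positivity
        field_simp
      simpa using this.add_const (f 0 0)
    have hb : ∀ t ∈ Icc (-|h|) |h|, ‖g' t‖ ≤ |h| ^ M * S := by
      intro t ht
      have ht' : |t| ≤ |h| := abs_le.2 ht
      refine (ih (fun m => f (m + 1)) (fun m hm => hf (m + 1) (by omega)) hS t
        (ht'.trans hh)).trans ?_
      gcongr
    have h0 : g 0 = 0 := by
      simp only [g, Finset.sum_range_succ' _ (M + 1)]
      simp
    have := (convex_Icc (-|h|) |h|).norm_image_sub_le_of_norm_hasDerivWithin_le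
      (fun t _ => (hg t).hasDerivWithinAt) hb (x := 0) (y := h)
      ⟨by simp, abs_nonneg h⟩ ⟨neg_abs_le h, le_abs_self h⟩
    rw [h0, sub_zero, sub_zero] at this
    calc |g h| ≤ |h| ^ M * S * |h| := this
      _ = |h| ^ (M + 1) * S := by ring

/-- Hölder's inequality for a pairing. -/
theorem enorm_integral_mul_le {μ : Measure E} {w φ : E → ℝ} {p q : ℝ≥0∞}
    [ENNReal.HolderConjugate p q] (hw : AEStronglyMeasurable w μ) (hφ : AEStronglyMeasurable φ μ) :
    ‖∫ z, w z * φ z ∂μ‖ₑ ≤ eLpNorm w p μ * eLpNorm φ q μ := by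
  refine (enorm_integral_le_lintegral_enorm _).trans ?_
  have h := eLpNorm_smul_le_mul_eLpNorm (p := p) (q := q) (r := 1) hφ hw
  rwa [eLpNorm_one_eq_lintegral_enorm] at h

/-- Taylor's formula along a flow, with the remainder measured in `L^p` by the modulus of
continuity of the last weak derivative. -/
theorem IsSmoothFlow.eLpNorm_sub_taylor_le {μ : Measure E} [μ.IsAddHaarMeasure]
    {flow : ℝ → E → E} {V : E → E}
    (hf : IsSmoothFlow μ flow V) {p : ℝ≥0∞} (hp : 1 ≤ p) (M : ℕ) (U : ℕ → E → ℝ)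
    (hU : ∀ m ≤ M, LocallyIntegrable (U m) μ)
    (hD : ∀ m < M, IsWeakVDeriv μ V (U m) (U (m + 1))) {r : ℝ} {S : ℝ≥0∞} (hS : S ≠ ⊤)
    (hM : ∀ τ, |τ| ≤ r → eLpNorm (fun z => U M (flow τ z) - U M z) p μ ≤ S)
    {h : ℝ} (hh : |h| ≤ r) :
    eLpNorm (fun z => U 0 (flow h z) -
      ∑ m ∈ Finset.range (M + 1), h ^ m / (m.factorial : ℝ) * U m z) p μ
      ≤ ENNReal.ofReal (|h| ^ M) * S := by
  have : ENNReal.HolderConjugate p p.conjExponent := ENNReal.HolderConjugate.conjExponent hp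
  have hterm : ∀ m ∈ Finset.range (M + 1),
      LocallyIntegrable (fun z => h ^ m / (m.factorial : ℝ) * U m z) μ := fun m hm =>
    (hU m (by simpa [Nat.lt_succ_iff] using hm)).smul (h ^ m / (m.factorial : ℝ))
  have hsum : LocallyIntegrable (fun z => ∑ m ∈ Finset.range (M + 1),
      h ^ m / (m.factorial : ℝ) * U m z) μ := locallyIntegrable_finsetSum _ hterm
  refine eLpNorm_le_of_test (q := p.conjExponent)
    ((hf.locallyIntegrable_comp h (hU 0 (Nat.zero_le _))).sub hsum) ?_
  -- The pairings with a test function form a chain of derivatives of scalar functions of the time.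
  intro φ hφ hc
  have hφtop : eLpNorm φ p.conjExponent μ ≠ ⊤ :=
    (hφ.continuous.memLp_of_hasCompactSupport hc).2.ne
  have hi : ∀ m ≤ M, ∀ τ, Integrable (fun z => U m (flow τ z) * φ z) μ := fun m hm τ =>
    integrable_mul_test (hf.locallyIntegrable_comp τ (hU m hm)) hφ.continuous hc
  have hi0 : ∀ m ≤ M, Integrable (fun z => U m z * φ z) μ := fun m hm =>
    integrable_mul_test (hU m hm) hφ.continuous hc
  have hscalar := abs_sub_taylor_le M (fun m h => ∫ z, U m (flow h z) * φ z ∂μ)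
    (fun m hm h => hf.hasDerivAt_integral (hD m hm) hφ hc h) (r := r)
    (S := (S * eLpNorm φ p.conjExponent μ).toReal) ?_ h hh
  · have heq : ∫ z, (U 0 (flow h z) -
        ∑ m ∈ Finset.range (M + 1), h ^ m / (m.factorial : ℝ) * U m z) * φ z ∂μ =
        (∫ z, U 0 (flow h z) * φ z ∂μ) -
          ∑ m ∈ Finset.range (M + 1), h ^ m / (m.factorial : ℝ) * ∫ z, U m z * φ z ∂μ := by
      simp_rw [sub_mul, Finset.sum_mul, mul_assoc]
      rw [integral_sub (hi 0 (Nat.zero_le _) h), integral_finsetSum]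
      · simp_rw [integral_const_mul]
      · intro m hm
        exact (hi0 m (by simpa [Nat.lt_succ_iff] using hm)).const_mul _
      · exact integrable_finsetSum _ fun m hm =>
          (hi0 m (by simpa [Nat.lt_succ_iff] using hm)).const_mul _
    simp only [hf.zero] at hscalar
    change ‖∫ z, (U 0 (flow h z) -
        ∑ m ∈ Finset.range (M + 1), h ^ m / (m.factorial : ℝ) * U m z) * φ z ∂μ‖ₑ ≤ _
    rw [heq, Real.enorm_eq_ofReal_abs]
    refine (ENNReal.ofReal_le_ofReal hscalar).trans ?_
    rw [ENNReal.ofReal_mul (by positivity), ENNReal.ofReal_toReal (ENNReal.mul_ne_top hS hφtop),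
      mul_assoc]
  · intro τ hτ
    simp only [hf.zero]
    rw [← integral_sub (hi M le_rfl τ) (hi0 M le_rfl)]
    have h1 := enorm_integral_mul_le (p := p) (q := p.conjExponent) (φ := φ)
      ((hf.locallyIntegrable_comp τ (hU M le_rfl)).sub (hU M le_rfl)).aestronglyMeasurable
      hφ.continuous.aestronglyMeasurable
    have h2 : ‖∫ z, (U M (flow τ z) * φ z - U M z * φ z) ∂μ‖ₑ ≤
        S * eLpNorm φ p.conjExponent μ := by
      simp_rw [← sub_mul]
      refine h1.trans ?_
      gcongr
      exact hM τ hτ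
    rw [Real.enorm_eq_ofReal_abs] at h2
    exact (ENNReal.ofReal_le_iff_le_toReal (ENNReal.mul_ne_top hS hφtop)).1 h2

end Flow

/-! ### The flows of the generating fields -/

variable {r : ℕ} {d : Fin (r + 1) → ℕ} {B : Matrix (Idx d) (Idx d) ℝ}

/-- `volume` on `Pt d` is the product measure by definition only, so the instance for products has
to be transferred. -/
instance : (volume : Measure (Pt d)).IsAddHaarMeasure :=
  inferInstanceAs ((volume : Measure ℝ).prod (volume : Measure (Idx d → ℝ))).IsAddHaarMeasure

theorem isSmoothFlow_pflow (i : Idx d) :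
    IsSmoothFlow volume (pflow i) (fun _ : Pt d => ((0 : ℝ), (Pi.single i 1 : Idx d → ℝ))) where
  contDiff := by
    unfold pflow
    exact (contDiff_fst.comp contDiff_snd).prodMk ((contDiff_snd.comp contDiff_snd).add
      (contDiff_fst.smul contDiff_const))
  contDiff_field := contDiff_const
  zero z := by simp [pflow]
  add s t z := by
    simp only [pflow, Prod.mk.injEq, true_and]
    rw [add_smul]; abel
  hasDerivAt_zero z := by
    unfold pflow
    refine (hasDerivAt_const _ _).prodMk ?_
    simpa using ((hasDerivAt_id (0 : ℝ)).smul_const (Pi.single i 1 : Idx d → ℝ)).const_add z.2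
  measurePreserving h :=
    (MeasurePreserving.id _).prod (measurePreserving_add_right volume (h • Pi.single i 1))

section Matrix

/-- `B ^ m` has nonzero blocks only on the `m`-th diagonal below the main one. -/
theorem IsKolmogorovMatrix.pow_apply_eq_zero (hB : IsKolmogorovMatrix d B) (m : ℕ) :
    ∀ i l : Idx d, (i.1 : ℕ) ≠ (l.1 : ℕ) + m → (B ^ m) i l = 0 := by
  induction m with
  | zero =>
    intro i l h
    rw [pow_zero, Matrix.one_apply_ne]
    rintro rfl
    exact h rfl
  | succ m ih =>
    intro i l h
    rw [pow_succ', Matrix.mul_apply]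
    refine Finset.sum_eq_zero fun b _ => ?_
    by_cases h1 : (i.1 : ℕ) = (b.1 : ℕ) + 1
    · rw [ih b l (by omega), mul_zero]
    · rw [hB.eq_zero i b h1, zero_mul]

theorem IsKolmogorovMatrix.pow_eq_zero (hB : IsKolmogorovMatrix d B) {m : ℕ} (hm : r + 1 ≤ m) :
    B ^ m = 0 := by
  ext i l
  exact hB.pow_apply_eq_zero m i l (by have := i.1.isLt; omega)

theorem IsKolmogorovMatrix.exp_eq (hB : IsKolmogorovMatrix d B) (h : ℝ) :
    NormedSpace.exp (h • B) =
      ∑ m ∈ Finset.range (r + 1), (h ^ m / (m.factorial : ℝ)) • B ^ m := by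
  rw [NormedSpace.exp_eq_tsum ℝ]
  simp only
  rw [tsum_eq_sum (s := Finset.range (r + 1))]
  · refine Finset.sum_congr rfl fun m _ => ?_
    rw [smul_pow, smul_smul, div_eq_inv_mul]
  · intro m hm
    rw [smul_pow, hB.pow_eq_zero (by simpa using hm), smul_zero, smul_zero]

theorem IsKolmogorovMatrix.exp_mulVec (hB : IsKolmogorovMatrix d B) (h : ℝ) (x : Idx d → ℝ) :
    (NormedSpace.exp (h • B)).mulVec x =
      ∑ m ∈ Finset.range (r + 1), (h ^ m / (m.factorial : ℝ)) • (B ^ m).mulVec x := by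
  rw [hB.exp_eq, Matrix.sum_mulVec]
  simp only [Matrix.smul_mulVec]

theorem exp_add_mulVec (s t : ℝ) (x : Idx d → ℝ) :
    (NormedSpace.exp ((s + t) • B)).mulVec x =
      (NormedSpace.exp (s • B)).mulVec ((NormedSpace.exp (t • B)).mulVec x) := by
  rw [add_smul, Matrix.exp_add_of_commute _ _ ((Commute.refl B).smul_left s |>.smul_right t),
    Matrix.mulVec_mulVec]

/-- `exp (h B)` is unipotent and block triangular, so that the flow of `Y` preserves volume. -/
theorem IsKolmogorovMatrix.det_exp (hB : IsKolmogorovMatrix d B) (h : ℝ) :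
    (NormedSpace.exp (h • B)).det = 1 := by
  have hentry : ∀ i l : Idx d, (i.1 : ℕ) ≤ (l.1 : ℕ) →
      (NormedSpace.exp (h • B)) i l = (1 : Matrix (Idx d) (Idx d) ℝ) i l := by
    intro i l hil
    rw [hB.exp_eq, Matrix.sum_apply, Finset.sum_range_succ']
    rw [Finset.sum_eq_zero]
    · simp
    · intro m _
      rw [Matrix.smul_apply, hB.pow_apply_eq_zero _ _ _ (by omega), smul_zero]
  have htri : (NormedSpace.exp (h • B)).BlockTriangular
      (fun i : Idx d => OrderDual.toDual i.1) := by
    intro i l hil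
    have hlt : i.1 < l.1 := hil
    rw [hentry i l (by exact_mod_cast hlt.le), Matrix.one_apply_ne]
    rintro rfl
    exact lt_irrefl _ hlt
  rw [htri.det]
  refine Finset.prod_eq_one fun a _ => ?_
  have : (NormedSpace.exp (h • B)).toSquareBlock (fun i : Idx d => OrderDual.toDual i.1) a = 1 := by
    ext i l
    have : i.1.1 = l.1.1 := OrderDual.toDual_inj.1 (i.2.trans l.2.symm)
    rw [Matrix.toSquareBlock_def, Matrix.of_apply, hentry _ _ (by rw [this]),
      Matrix.one_apply, Matrix.one_apply]
    simp [Subtype.ext_iff]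
  rw [this, Matrix.det_one]

end Matrix

theorem contDiff_mulVec {F : Type*} [NormedAddCommGroup F] [NormedSpace ℝ F]
    (A : Matrix (Idx d) (Idx d) ℝ) {f : F → Idx d → ℝ} (hf : ContDiff ℝ ∞ f) :
    ContDiff ℝ ∞ fun x => A.mulVec (f x) :=
  (LinearMap.toContinuousLinearMap (Matrix.mulVecLin A)).contDiff.comp hf

theorem isSmoothFlow_yflow (hB : IsKolmogorovMatrix d B) :
    IsSmoothFlow volume (yflow B) (fun z : Pt d => ((1 : ℝ), B.mulVec z.2)) where
  contDiff := by
    unfold yflow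
    refine ((contDiff_fst.comp contDiff_snd).add contDiff_fst).prodMk ?_
    simp_rw [hB.exp_mulVec]
    refine ContDiff.sum fun m _ => ?_
    exact ((contDiff_fst.pow m).div_const _).smul
      (contDiff_mulVec _ (contDiff_snd.comp contDiff_snd))
  contDiff_field := contDiff_const.prodMk (contDiff_mulVec B contDiff_snd)
  zero z := by simp [yflow]
  add s t z := by
    simp only [yflow, exp_add_mulVec, Prod.mk.injEq, and_true]
    ring
  hasDerivAt_zero z := by
    unfold yflow
    refine HasDerivAt.prodMk ?_ ?_
    · simpa using (hasDerivAt_id (0 : ℝ)).const_add z.1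
    · simp_rw [hB.exp_mulVec]
      have h1 : ∀ m ∈ Finset.range (r + 1), HasDerivAt
          (fun h : ℝ => (h ^ m / (m.factorial : ℝ)) • (B ^ m).mulVec z.2)
          ((if m = 1 then (1 : ℝ) else 0) • (B ^ m).mulVec z.2) 0 := by
        intro m _
        refine HasDerivAt.smul_const ?_ _
        refine ((hasDerivAt_pow m (0 : ℝ)).div_const _).congr_deriv ?_
        rcases m with _ | _ | m <;> simp
      refine (HasDerivAt.fun_sum h1).congr_deriv ?_
      simp only [ite_smul, one_smul, zero_smul]
      rw [Finset.sum_ite_eq']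
      split_ifs with h
      · rw [pow_one]
      · have : B ^ 1 = 0 := hB.pow_eq_zero (by simpa using h)
        rw [pow_one] at this
        simp [this]
  measurePreserving h := by
    refine (measurePreserving_add_right volume h).prod (μa := volume) (μc := volume)
      (g := fun x => (NormedSpace.exp (h • B)).mulVec x) ?_
    refine ⟨(contDiff_mulVec _ contDiff_id).continuous.measurable, ?_⟩
    have := Real.map_matrix_volume_pi_eq_smul_volume_pi (M := NormedSpace.exp (h • B))
      (by rw [hB.det_exp h]; exact one_ne_zero)
    rw [hB.det_exp h, inv_one, abs_one, ENNReal.ofReal_one, one_smul] at this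
    exact this

/-- A letter: `some a` stands for `∂_{x_a}`, `a` in the first block, and `none` for `Y`. These
fields generate all others by commutators. -/
abbrev Letter (d : Fin (r + 1) → ℕ) : Type := Option (Fin (d 0))

namespace Letter

/-- The formal weight of a generating field. -/
def weight : Letter d → ℕ
  | none => 2
  | some _ => 1

/-- The generating field itself. -/
def field (B : Matrix (Idx d) (Idx d) ℝ) : Letter d → Pt d → Pt d
  | none => fun z => (1, B.mulVec z.2)
  | some a => fun _ => (0, Pi.single ⟨0, a⟩ 1)

/-- The flow of a generating field. -/
noncomputable def flow (B : Matrix (Idx d) (Idx d) ℝ) : Letter d → ℝ → Pt d → Pt d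
  | none => yflow B
  | some a => pflow ⟨0, a⟩

theorem isSmoothFlow (hB : IsKolmogorovMatrix d B) :
    ∀ X : Letter d, IsSmoothFlow volume (X.flow B) (X.field B)
  | none => isSmoothFlow_yflow hB
  | some a => isSmoothFlow_pflow ⟨0, a⟩

theorem one_le_weight : ∀ X : Letter d, 1 ≤ X.weight
  | none => by simp [weight]
  | some _ => le_rfl

end Letter

/-! ### Weak derivatives along vector fields -/

section WeakDeriv

variable {E : Type*} [NormedAddCommGroup E] [NormedSpace ℝ E] [FiniteDimensional ℝ E]
  [MeasurableSpace E] [BorelSpace E] {μ : Measure E} {V : E → E} {u u' v v' : E → ℝ}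

theorem continuous_fderiv_field (hV : Continuous V) {φ : E → ℝ} (hφ : ContDiff ℝ ∞ φ) :
    Continuous fun z => fderiv ℝ φ z (V z) :=
  (hφ.continuous_fderiv (by simp)).clm_apply hV

theorem contDiff_fderiv_field (hV : ContDiff ℝ ∞ V) {φ : E → ℝ} (hφ : ContDiff ℝ ∞ φ) :
    ContDiff ℝ ∞ fun z => fderiv ℝ φ z (V z) :=
  (hφ.fderiv_right (m := ∞) (by simp)).clm_apply hV

theorem hasCompactSupport_fderiv_field {φ : E → ℝ} (hc : HasCompactSupport φ) :
    HasCompactSupport fun z => fderiv ℝ φ z (V z) := by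
  refine (hc.fderiv ℝ).mono ?_
  intro z hz h0
  exact hz (by simp [h0])

theorem IsWeakVDeriv.congr_left (h : IsWeakVDeriv μ V u v) (hu : u =ᵐ[μ] u') :
    IsWeakVDeriv μ V u' v := by
  refine ⟨?_, h.2.1, fun φ h1 h2 => ?_⟩
  · intro x
    obtain ⟨U, hU, hUi⟩ := h.1 x
    exact ⟨U, hU, hUi.congr (ae_restrict_of_ae hu)⟩
  · rw [← h.2.2 φ h1 h2]
    exact integral_congr_ae (hu.mono fun x hx => by simp only [hx])

theorem IsWeakVDeriv.unique (h : IsWeakVDeriv μ V u v) (h' : IsWeakVDeriv μ V u v') :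
    v =ᵐ[μ] v' := by
  refine ae_eq_of_integral_contDiff_smul_eq h.2.1 h'.2.1 fun φ h1 h2 => ?_
  have := neg_inj.1 ((h.2.2 φ h1 h2).symm.trans (h'.2.2 φ h1 h2))
  simpa [mul_comm] using this

theorem IsWeakVDeriv.add (hV : Continuous V) (h : IsWeakVDeriv μ V u v)
    (h' : IsWeakVDeriv μ V u' v') :
    IsWeakVDeriv μ V (fun z => u z + u' z) fun z => v z + v' z := by
  refine ⟨h.1.add h'.1, h.2.1.add h'.2.1, fun φ h1 h2 => ?_⟩
  have hc := hasCompactSupport_fderiv_field (V := V) h2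
  have hφ := continuous_fderiv_field hV h1
  simp_rw [add_mul]
  rw [integral_add (integrable_mul_test h.1 hφ hc) (integrable_mul_test h'.1 hφ hc),
    integral_add (integrable_mul_test h.2.1 h1.continuous h2)
      (integrable_mul_test h'.2.1 h1.continuous h2), h.2.2 φ h1 h2, h'.2.2 φ h1 h2]
  ring

theorem IsWeakVDeriv.const_mul (c : ℝ) (h : IsWeakVDeriv μ V u v) :
    IsWeakVDeriv μ V (fun z => c * u z) fun z => c * v z := by
  refine ⟨h.1.smul c, h.2.1.smul c, fun φ h1 h2 => ?_⟩
  simp_rw [mul_assoc]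
  rw [integral_const_mul, integral_const_mul, h.2.2 φ h1 h2]
  ring

theorem eLpNorm_flow_sub_congr {T : E → E} (hT : MeasurePreserving T μ μ) (hu : u =ᵐ[μ] u')
    {p : ℝ≥0∞} :
    eLpNorm (fun z => u (T z) - u z) p μ = eLpNorm (fun z => u' (T z) - u' z) p μ := by
  refine eLpNorm_congr_ae ?_
  filter_upwards [hT.quasiMeasurePreserving.ae_eq_comp hu, hu] with z h1 h2
  simp only [Function.comp_apply] at h1
  rw [h1, h2]

end WeakDeriv

/-! ### Controlled functions -/

/-- `IsControlled B p F n u` says that `u` has weak derivatives along the generating fields up to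
intrinsic order `n`, and that those of order `n - m` have increments
`‖v(e^{τX}·) - v‖_p ≤ ρ^m F(ρ)` for `|τ| ≤ ρ^w`, along each generating field `X` of weight `w > m`,
that is, along each one by which `v` cannot be differentiated any more.
The same `F` serves at all levels, so that `F` is of the size `ρ^s` if `u` has regularity
`n + s`. -/
inductive IsControlled (B : Matrix (Idx d) (Idx d) ℝ) (p : ℝ≥0∞) (F : ℝ → ℝ≥0∞) :
    ℕ → (Pt d → ℝ) → Prop
  | mk (n : ℕ) (u : Pt d → ℝ) (v : Letter d → Pt d → ℝ) (hu : LocallyIntegrable u)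
      (hmod : ∀ X : Letter d, n < X.weight → ∀ ρ : ℝ, 0 < ρ → ∀ τ : ℝ, |τ| ≤ ρ ^ X.weight →
        eLpNorm (fun z => u (X.flow B τ z) - u z) p volume ≤ ENNReal.ofReal (ρ ^ n) * F ρ)
      (hweak : ∀ (X : Letter d) (m : ℕ), n = m + X.weight →
        IsWeakVDeriv volume (X.field B) u (v X))
      (hv : ∀ (X : Letter d) (m : ℕ), n = m + X.weight → IsControlled B p F m (v X)) :
      IsControlled B p F n u

namespace IsControlled

variable {p : ℝ≥0∞} {F F' : ℝ → ℝ≥0∞} {n : ℕ} {u u' : Pt d → ℝ}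

theorem locallyIntegrable (h : IsControlled B p F n u) : LocallyIntegrable u := by
  cases h; assumption

theorem eLpNorm_sub_le (h : IsControlled B p F n u) {X : Letter d} (hX : n < X.weight) {ρ : ℝ}
    (hρ : 0 < ρ) {τ : ℝ} (hτ : |τ| ≤ ρ ^ X.weight) :
    eLpNorm (fun z => u (X.flow B τ z) - u z) p volume ≤ ENNReal.ofReal (ρ ^ n) * F ρ := by
  cases h with | mk _ _ _ _ hmod _ _ => exact hmod X hX ρ hρ τ hτ

theorem exists_isWeakVDeriv {m : ℕ} {X : Letter d} (h : IsControlled B p F (m + X.weight) u) :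
    ∃ v, IsWeakVDeriv volume (X.field B) u v ∧ IsControlled B p F m v := by
  cases h with | mk _ _ v _ _ hweak hv => exact ⟨v X, hweak X m rfl, hv X m rfl⟩

theorem mono (h : IsControlled B p F n u) (hF : ∀ ρ, 0 < ρ → F ρ ≤ F' ρ) :
    IsControlled B p F' n u := by
  induction h with
  | mk n u v hu hmod hweak _ ih =>
    refine mk n u v hu (fun X hX ρ hρ τ hτ => (hmod X hX ρ hρ τ hτ).trans ?_) hweak ih
    gcongr
    exact hF ρ hρ

theorem congr_ae (hB : IsKolmogorovMatrix d B) (h : IsControlled B p F n u) (hu : u =ᵐ[volume] u') :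
    IsControlled B p F n u' := by
  cases h with
  | mk _ _ v hloc hmod hweak hv =>
    refine mk n u' v ?_ ?_ (fun X m hm => (hweak X m hm).congr_left hu) hv
    · intro x
      obtain ⟨U, hU, hUi⟩ := hloc x
      exact ⟨U, hU, hUi.congr (ae_restrict_of_ae hu)⟩
    · intro X hX ρ hρ τ hτ
      rw [← eLpNorm_flow_sub_congr ((X.isSmoothFlow hB).measurePreserving τ) hu]
      exact hmod X hX ρ hρ τ hτ

theorem const_mul (h : IsControlled B p F n u) (c : ℝ) :
    IsControlled B p (fun ρ => ENNReal.ofReal |c| * F ρ) n (fun z => c * u z) := by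
  induction h with
  | mk n u v hu hmod hweak _ ih =>
    refine mk n _ (fun X z => c * v X z) (hu.smul c) ?_ (fun X m hm => (hweak X m hm).const_mul c)
      ih
    intro X hX ρ hρ τ hτ
    have h1 : (fun z => c * u (X.flow B τ z) - c * u z) =
        c • fun z => u (X.flow B τ z) - u z := by
      funext z; simp [mul_sub]
    rw [h1, eLpNorm_const_smul, Real.enorm_eq_ofReal_abs, mul_left_comm]
    gcongr
    exact hmod X hX ρ hρ τ hτ

theorem add (hB : IsKolmogorovMatrix d B) (hp : 1 ≤ p) (h : IsControlled B p F n u)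
    (h' : IsControlled B p F' n u') :
    IsControlled B p (fun ρ => F ρ + F' ρ) n (fun z => u z + u' z) := by
  induction h generalizing u' with
  | mk n u v hu hmod hweak _ ih =>
    cases h' with
    | mk _ _ v' hu' hmod' hweak' hv' =>
      refine mk n _ (fun X z => v X z + v' X z) (hu.add hu') ?_
        (fun X m hm => (hweak X m hm).add (X.isSmoothFlow hB).contDiff_field.continuous
          (hweak' X m hm))
        fun X m hm => ih X m hm (hv' X m hm)
      intro X hX ρ hρ τ hτ
      have hf := X.isSmoothFlow hB
      have h1 : (fun z => u (X.flow B τ z) + u' (X.flow B τ z) - (u z + u' z)) =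
          (fun z => u (X.flow B τ z) - u z) + fun z => u' (X.flow B τ z) - u' z := by
        funext z; simp only [Pi.add_apply]; ring
      rw [h1, mul_add]
      refine (eLpNorm_add_le ((hf.locallyIntegrable_comp τ hu).sub hu).aestronglyMeasurable
        ((hf.locallyIntegrable_comp τ hu').sub hu').aestronglyMeasurable hp).trans ?_
      gcongr
      · exact hmod X hX ρ hρ τ hτ
      · exact hmod' X hX ρ hρ τ hτ

theorem zero (n : ℕ) : IsControlled B p F n (fun _ => 0) := by
  induction n using Nat.strong_induction_on with
  | _ n ih =>
    refine mk n _ (fun _ _ => 0) (locallyIntegrable_zero) ?_ ?_ ?_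
    · intro X _ ρ _ τ _
      simp
    · intro X m _
      exact ⟨locallyIntegrable_zero, locallyIntegrable_zero, fun φ _ _ => by simp⟩
    · intro X m hm
      exact ih m (by have := X.one_le_weight; omega)

theorem sum (hB : IsKolmogorovMatrix d B) (hp : 1 ≤ p) {ι : Type*} (s : Finset ι)
    {U : ι → Pt d → ℝ} {G : ι → ℝ → ℝ≥0∞} (h : ∀ i ∈ s, IsControlled B p (G i) n (U i)) :
    IsControlled B p (fun ρ => ∑ i ∈ s, G i ρ) n (fun z => ∑ i ∈ s, U i z) := by
  classical
  induction s using Finset.induction_on with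
  | empty => simpa using zero (B := B) (p := p) (F := fun _ => 0) n
  | insert a s ha ih =>
    simp only [Finset.sum_insert ha]
    exact (h a (by simp)).add hB hp (ih fun i hi => h i (by simp [hi]))

/-- The successive derivatives of `u` along a single generating field. -/
theorem exists_chain (X : Letter d) (n : ℕ) : ∀ u : Pt d → ℝ, IsControlled B p F n u →
    ∃ U : ℕ → Pt d → ℝ, U 0 = u ∧
      (∀ m < n / X.weight, IsWeakVDeriv volume (X.field B) (U m) (U (m + 1))) ∧
      ∀ m ≤ n / X.weight, IsControlled B p F (n - X.weight * m) (U m) := by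
  have hw := X.one_le_weight
  induction n using Nat.strong_induction_on with
  | _ n ih =>
    intro u h
    by_cases hn : n < X.weight
    · refine ⟨fun _ => u, rfl, ?_, ?_⟩
      · intro m hm
        rw [Nat.div_eq_of_lt hn] at hm
        exact absurd hm (Nat.not_lt_zero _)
      · intro m hm
        rw [Nat.div_eq_of_lt hn] at hm
        obtain rfl : m = 0 := by omega
        simpa using h
    · obtain ⟨m, rfl⟩ : ∃ m, n = m + X.weight := ⟨n - X.weight, by omega⟩
      obtain ⟨v, hv, hvc⟩ := h.exists_isWeakVDeriv
      obtain ⟨U, hU0, hU1, hU2⟩ := ih m (by omega) v hvc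
      have hdiv : (m + X.weight) / X.weight = m / X.weight + 1 := Nat.add_div_right _ hw
      refine ⟨fun k => Nat.casesOn k u U, rfl, ?_, ?_⟩
      · intro k hk
        rcases k with _ | k
        · simpa [hU0] using hv
        · exact hU1 k (by omega)
      · intro k hk
        rcases k with _ | k
        · simpa using h
        · have : m + X.weight - X.weight * (k + 1) = m - X.weight * k := by
            rw [mul_add, mul_one]; omega
          rw [this]
          exact hU2 k (by omega)

/-- Taylor's formula along one generating field of weight `w`. The chain of derivatives ends at
order `n mod w < w`, where the increments are controlled. -/
theorem eLpNorm_sub_taylor_le (hB : IsKolmogorovMatrix d B) (hp : 1 ≤ p) {X : Letter d}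
    {U : ℕ → Pt d → ℝ}
    (hU1 : ∀ m < n / X.weight, IsWeakVDeriv volume (X.field B) (U m) (U (m + 1)))
    (hU2 : ∀ m ≤ n / X.weight, IsControlled B p F (n - X.weight * m) (U m))
    {c : ℝ} (hc : |c| ≤ 1) {ρ : ℝ} (hρ : 0 < ρ) :
    eLpNorm (fun z => U 0 (X.flow B (c * ρ ^ X.weight) z) -
      ∑ m ∈ Finset.range (n / X.weight + 1),
        (c * ρ ^ X.weight) ^ m / (m.factorial : ℝ) * U m z) p volume ≤
      ENNReal.ofReal (ρ ^ n) * F ρ := by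
  have hw := X.one_le_weight
  rcases eq_or_ne (F ρ) ⊤ with hF | hF
  · rw [hF, ENNReal.mul_top]
    · exact le_top
    · simpa using pow_pos hρ n
  set M := n / X.weight with hM
  have hmod : X.weight * M + n % X.weight = n := Nat.div_add_mod _ _
  have hlt : n % X.weight < X.weight := Nat.mod_lt _ hw
  have hrem : n - X.weight * M = n % X.weight := by omega
  have hh : |c * ρ ^ X.weight| ≤ ρ ^ X.weight := by
    rw [abs_mul, abs_of_pos (pow_pos hρ _)]
    exact mul_le_of_le_one_left (pow_pos hρ _).le hc
  have hUM := hU2 M le_rfl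
  rw [hrem] at hUM
  refine ((X.isSmoothFlow hB).eLpNorm_sub_taylor_le hp M U
    (fun m hm => (hU2 m hm).locallyIntegrable) hU1
    (ENNReal.mul_ne_top ENNReal.ofReal_ne_top hF)
    (fun τ hτ => hUM.eLpNorm_sub_le hlt hρ hτ) hh).trans ?_
  rw [← mul_assoc, ← ENNReal.ofReal_mul (by positivity)]
  gcongr
  calc |c * ρ ^ X.weight| ^ M * ρ ^ (n % X.weight)
      ≤ (ρ ^ X.weight) ^ M * ρ ^ (n % X.weight) := by gcongr
    _ = ρ ^ n := by rw [← pow_mul, ← pow_add, hmod]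

end IsControlled

/-! ### Taylor expansion along products of flows -/

/-- The families `ρ ↦ G ρ` of products of the flows of the generating fields `X` of weight `w`,
run for times `c ρ^w` with `|c| ≤ 1`. -/
inductive IsAdmissible (B : Matrix (Idx d) (Idx d) ℝ) : (ℝ → Pt d → Pt d) → Prop
  | id : IsAdmissible B fun _ z => z
  | cons (X : Letter d) (c : ℝ) (hc : |c| ≤ 1) (G : ℝ → Pt d → Pt d) (hG : IsAdmissible B G) :
      IsAdmissible B fun ρ z => X.flow B (c * ρ ^ X.weight) (G ρ z)

namespace IsAdmissible

variable {G G' : ℝ → Pt d → Pt d}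

theorem measurePreserving (hB : IsKolmogorovMatrix d B) (hG : IsAdmissible B G) (ρ : ℝ) :
    MeasurePreserving (G ρ) := by
  induction hG with
  | id => exact MeasurePreserving.id _
  | cons X c _ G _ ih => exact ((X.isSmoothFlow hB).measurePreserving _).comp ih

theorem locallyIntegrable_comp (hB : IsKolmogorovMatrix d B) (hG : IsAdmissible B G) (ρ : ℝ)
    {u : Pt d → ℝ} (hu : LocallyIntegrable u) : LocallyIntegrable fun z => u (G ρ z) := by
  induction hG generalizing u with
  | id => exact hu
  | cons X c _ G _ ih => exact ih ((X.isSmoothFlow hB).locallyIntegrable_comp _ hu)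

theorem comp (hG : IsAdmissible B G) (hG' : IsAdmissible B G') :
    IsAdmissible B fun ρ z => G ρ (G' ρ z) := by
  induction hG with
  | id => exact hG'
  | cons X c hc G _ ih => exact cons X c hc _ ih

theorem single (X : Letter d) {c : ℝ} (hc : |c| ≤ 1) :
    IsAdmissible B fun ρ z => X.flow B (c * ρ ^ X.weight) z :=
  cons X c hc _ id

/-- Taylor expansion along an admissible family: `u ∘ G ρ` is a polynomial of degree `n` in `ρ` up
to an error of size `ρ^n F(ρ)`. -/
theorem exists_taylor (hB : IsKolmogorovMatrix d B) (hG : IsAdmissible B G) :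
    ∀ n : ℕ, ∃ K : ℝ≥0, ∀ (p : ℝ≥0∞) (F : ℝ → ℝ≥0∞) (u : Pt d → ℝ), 1 ≤ p →
      IsControlled B p F n u → ∃ v : ℕ → Pt d → ℝ, (∀ l, LocallyIntegrable (v l)) ∧
        ∀ ρ : ℝ, 0 < ρ →
          eLpNorm (fun z => u (G ρ z) - ∑ l ∈ Finset.range (n + 1), ρ ^ l * v l z) p volume ≤
            K * (ENNReal.ofReal (ρ ^ n) * F ρ) := by
  induction hG with
  | id =>
    intro n
    refine ⟨0, fun p F u hp hu => ⟨fun l => if l = 0 then u else fun _ => 0, ?_, ?_⟩⟩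
    · intro l
      by_cases hl : l = 0
      · simpa [hl] using hu.locallyIntegrable
      · simpa [hl] using locallyIntegrable_zero
    · intro ρ hρ
      simp [Finset.sum_range_succ']
  | cons X c hc G hG ih =>
    intro n
    choose K hK using ih
    set w := X.weight with hw
    set M := n / w with hM
    have hw1 : 1 ≤ w := X.one_le_weight
    refine ⟨1 + ∑ m ∈ Finset.range (M + 1), K (n - w * m), fun p F u hp hu => ?_⟩
    obtain ⟨U, hU0, hU1, hU2⟩ := IsControlled.exists_chain X n u hu
    have hmM : ∀ m ∈ Finset.range (M + 1), m ≤ M ∧ w * m ≤ n := by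
      intro m hm
      have hm' : m ≤ M := by simpa [Nat.lt_succ_iff] using hm
      refine ⟨hm', (Nat.mul_le_mul_left w hm').trans ?_⟩
      rw [mul_comm]
      exact Nat.div_mul_le_self n w
    have hex : ∀ m : ℕ, ∃ v : ℕ → Pt d → ℝ, (∀ l, LocallyIntegrable (v l)) ∧
        (m ≤ M → ∀ ρ : ℝ, 0 < ρ →
          eLpNorm (fun z => U m (G ρ z) -
            ∑ l ∈ Finset.range (n - w * m + 1), ρ ^ l * v l z) p volume ≤
            K (n - w * m) * (ENNReal.ofReal (ρ ^ (n - w * m)) * F ρ)) := by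
      intro m
      by_cases hm : m ≤ M
      · obtain ⟨v, hv1, hv2⟩ := hK (n - w * m) p F (U m) hp (hU2 m hm)
        exact ⟨v, hv1, fun _ => hv2⟩
      · exact ⟨fun _ _ => 0, fun _ => locallyIntegrable_zero, fun h => absurd h hm⟩
    choose v hv1 hv2 using hex
    let W : ℕ → ℕ → Pt d → ℝ := fun m k => if w * m ≤ k then v m (k - w * m) else fun _ => 0
    have hW : ∀ m k, LocallyIntegrable (W m k) := by
      intro m k
      simp only [W]
      split_ifs
      · exact hv1 _ _
      · exact locallyIntegrable_zero
    refine ⟨fun k z => ∑ m ∈ Finset.range (M + 1), c ^ m / (m.factorial : ℝ) * W m k z, ?_, ?_⟩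
    · intro k
      exact locallyIntegrable_finsetSum _ fun m _ => (hW m k).smul (c ^ m / (m.factorial : ℝ))
    intro ρ hρ
    -- The Taylor coefficients `U m` along the last flow have expansions `v m` along the others;
    -- their product is regrouped by powers of `ρ`.
    have hpoly : ∀ z, ∑ l ∈ Finset.range (n + 1),
        ρ ^ l * ∑ m ∈ Finset.range (M + 1), c ^ m / (m.factorial : ℝ) * W m l z =
        ∑ m ∈ Finset.range (M + 1), (c * ρ ^ w) ^ m / (m.factorial : ℝ) *
          ∑ l ∈ Finset.range (n - w * m + 1), ρ ^ l * v m l z := by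
      intro z
      simp_rw [Finset.mul_sum]
      rw [Finset.sum_comm]
      refine Finset.sum_congr rfl fun m hm => ?_
      have hn : n + 1 = w * m + (n - w * m + 1) := by have := (hmM m hm).2; omega
      rw [hn, Finset.sum_range_add, Finset.sum_eq_zero, zero_add]
      · refine Finset.sum_congr rfl fun l _ => ?_
        simp only [W, le_add_iff_nonneg_right, zero_le, if_true, add_tsub_cancel_left]
        rw [pow_add, mul_pow, pow_mul]
        ring
      · intro l hl
        have : ¬ w * m ≤ l := by simpa using hl
        simp [W, this]
    have hsplit : (fun z => u (X.flow B (c * ρ ^ w) (G ρ z)) - ∑ l ∈ Finset.range (n + 1),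
        ρ ^ l * ∑ m ∈ Finset.range (M + 1), c ^ m / (m.factorial : ℝ) * W m l z) =
        (fun z => (fun y => U 0 (X.flow B (c * ρ ^ w) y) - ∑ m ∈ Finset.range (M + 1),
          (c * ρ ^ w) ^ m / (m.factorial : ℝ) * U m y) (G ρ z)) +
        ∑ m ∈ Finset.range (M + 1), ((c * ρ ^ w) ^ m / (m.factorial : ℝ)) • fun z =>
          U m (G ρ z) - ∑ l ∈ Finset.range (n - w * m + 1), ρ ^ l * v m l z := by
      funext z
      rw [hpoly z]
      simp only [Pi.add_apply, Finset.sum_apply, Pi.smul_apply, smul_eq_mul, mul_sub,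
        Finset.sum_sub_distrib, hU0]
      ring
    have hUloc : ∀ m ≤ M, LocallyIntegrable (U m) := fun m hm => (hU2 m hm).locallyIntegrable
    have hRloc : LocallyIntegrable (fun y => U 0 (X.flow B (c * ρ ^ w) y) -
        ∑ m ∈ Finset.range (M + 1), (c * ρ ^ w) ^ m / (m.factorial : ℝ) * U m y) :=
      ((X.isSmoothFlow hB).locallyIntegrable_comp _ (hUloc 0 (Nat.zero_le _))).sub
        (locallyIntegrable_finsetSum _ fun m hm =>
          (hUloc m (hmM m hm).1).smul ((c * ρ ^ w) ^ m / (m.factorial : ℝ)))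
    have hSloc : ∀ m ∈ Finset.range (M + 1), LocallyIntegrable
        (((c * ρ ^ w) ^ m / (m.factorial : ℝ)) • fun z =>
          U m (G ρ z) - ∑ l ∈ Finset.range (n - w * m + 1), ρ ^ l * v m l z) := fun m hm =>
      ((hG.locallyIntegrable_comp hB ρ (hUloc m (hmM m hm).1)).sub
        (locallyIntegrable_finsetSum _ fun l _ => (hv1 m l).smul (ρ ^ l))).smul _
    rw [hsplit]
    refine (eLpNorm_add_le (hG.locallyIntegrable_comp hB ρ hRloc).aestronglyMeasurable
      (Finset.aestronglyMeasurable_sum _ fun m hm => (hSloc m hm).aestronglyMeasurable) hp).trans ?_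
    push_cast
    rw [add_mul, one_mul, Finset.sum_mul]
    refine add_le_add ?_ ?_
    · have := eLpNorm_comp_measurePreserving (p := p) hRloc.aestronglyMeasurable
        (hG.measurePreserving hB ρ)
      exact (this.le).trans (IsControlled.eLpNorm_sub_taylor_le hB hp hU1 hU2 hc hρ)
    · refine (eLpNorm_sum_le (fun m hm => (hSloc m hm).aestronglyMeasurable) hp).trans ?_
      refine Finset.sum_le_sum fun m hm => ?_
      rw [eLpNorm_const_smul, Real.enorm_eq_ofReal_abs]
      have hcoef : |(c * ρ ^ w) ^ m / (m.factorial : ℝ)| ≤ ρ ^ (w * m) := by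
        rw [abs_div, abs_pow, abs_mul, abs_of_pos (pow_pos hρ w), Nat.abs_cast, mul_pow, ← pow_mul]
        have h1 : (1 : ℝ) ≤ m.factorial := by exact_mod_cast m.factorial_pos
        rw [div_le_iff₀ (by linarith)]
        have h2 : |c| ^ m ≤ 1 := pow_le_one₀ (abs_nonneg _) hc
        have h3 : 0 < ρ ^ (w * m) := pow_pos hρ _
        nlinarith
      calc ENNReal.ofReal |(c * ρ ^ w) ^ m / (m.factorial : ℝ)| * eLpNorm (fun z =>
            U m (G ρ z) - ∑ l ∈ Finset.range (n - w * m + 1), ρ ^ l * v m l z) p volume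
          ≤ ENNReal.ofReal (ρ ^ (w * m)) *
            (K (n - w * m) * (ENNReal.ofReal (ρ ^ (n - w * m)) * F ρ)) := by
            gcongr
            exact hv2 m (hmM m hm).1 ρ hρ
        _ = K (n - w * m) * (ENNReal.ofReal (ρ ^ n) * F ρ) := by
            have : n = w * m + (n - w * m) := by have := (hmM m hm).2; omega
            have h4 : ρ ^ n = ρ ^ (w * m) * ρ ^ (n - w * m) := by rw [← pow_add, ← this]
            rw [h4, ENNReal.ofReal_mul (by positivity)]
            ring

end IsAdmissible

/-! ### Reaching the directions of block `j` -/

/-- Each coordinate vector of block `j + 1` is `B` applied to a vector of block `j`. -/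
theorem IsKolmogorovMatrix.exists_sum_mulVec_single (hB : IsKolmogorovMatrix d B) (j : Fin r)
    (a : Fin (d j.succ)) :
    ∃ c : Fin (d j.castSucc) → ℝ,
      ∑ b, c b • B.mulVec (Pi.single ⟨j.castSucc, b⟩ 1) = Pi.single ⟨j.succ, a⟩ 1 := by
  set A := B.submatrix (fun a : Fin (d j.succ) => (⟨j.succ, a⟩ : Idx d))
      (fun b : Fin (d j.castSucc) => (⟨j.castSucc, b⟩ : Idx d)) with hA
  have hsurj : Function.Surjective A.mulVecLin := by
    rw [← LinearMap.range_eq_top]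
    apply Submodule.eq_top_of_finrank_eq
    have := hB.rank_eq j
    rw [Matrix.rank] at this
    rw [this]
    simp
  obtain ⟨c, hc⟩ := hsurj (Pi.single a 1)
  refine ⟨c, ?_⟩
  funext i
  obtain ⟨j', a'⟩ := i
  simp only [Matrix.mulVec_single_one, Finset.sum_apply, Pi.smul_apply, smul_eq_mul,
    Matrix.col_apply]
  by_cases hj : j' = j.succ
  · subst hj
    have h1 := congrFun hc a'
    rw [Matrix.mulVecLin_apply, Matrix.mulVec, dotProduct] at h1
    have h2 : (Pi.single (⟨j.succ, a⟩ : Idx d) (1 : ℝ) : Idx d → ℝ) ⟨j.succ, a'⟩ =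
        (Pi.single a (1 : ℝ) : Fin (d j.succ) → ℝ) a' := by
      simp [Pi.single_apply]
    rw [h2, ← h1]
    refine Finset.sum_congr rfl fun b _ => ?_
    rw [hA, Matrix.submatrix_apply, mul_comm]
  · rw [Pi.single_eq_of_ne (by intro h; exact hj (congrArg Sigma.fst h))]
    refine Finset.sum_eq_zero fun b _ => ?_
    rw [hB.eq_zero _ _ (fun h => hj (Fin.ext (by simpa using h))), mul_zero]

/-- The vector with coordinates `y` in the first block and `0` elsewhere. -/
noncomputable def firstBlock (y : Fin (d 0) → ℝ) : Idx d → ℝ :=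
  ∑ a, y a • (Pi.single (⟨0, a⟩ : Idx d) 1)

theorem firstBlock_smul (c : ℝ) (y : Fin (d 0) → ℝ) : firstBlock (c • y) = c • firstBlock y := by
  simp [firstBlock, Finset.smul_sum, smul_smul]

theorem firstBlock_single (a : Fin (d 0)) :
    firstBlock (Pi.single a 1) = (Pi.single (⟨0, a⟩ : Idx d) 1 : Idx d → ℝ) := by
  rw [firstBlock, Finset.sum_eq_single a]
  · simp
  · intro b _ hb
    rw [Pi.single_eq_of_ne hb, zero_smul]
  · simp

theorem firstBlock_sum {ι : Type*} (s : Finset ι) (y : ι → Fin (d 0) → ℝ) :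
    firstBlock (∑ i ∈ s, y i) = ∑ i ∈ s, firstBlock (y i) := by
  simp only [firstBlock, Finset.sum_apply, Finset.sum_smul]
  exact Finset.sum_comm

/-- Each coordinate vector of block `j` is `B ^ j` applied to a vector of the first block. -/
theorem IsKolmogorovMatrix.exists_pow_mulVec_firstBlock (hB : IsKolmogorovMatrix d B) :
    ∀ (j : ℕ) (hj : j < r + 1) (a : Fin (d ⟨j, hj⟩)), ∃ y : Fin (d 0) → ℝ,
      (B ^ j).mulVec (firstBlock y) = Pi.single ⟨⟨j, hj⟩, a⟩ 1 := by
  intro j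
  induction j with
  | zero =>
    intro hj a
    refine ⟨Pi.single a 1, ?_⟩
    rw [pow_zero, Matrix.one_mulVec]
    exact firstBlock_single a
  | succ j ih =>
    intro hj a
    obtain ⟨c, hc⟩ := hB.exists_sum_mulVec_single ⟨j, by omega⟩ a
    choose y hy using ih (by omega)
    refine ⟨∑ b, c b • y b, ?_⟩
    rw [firstBlock_sum, pow_succ', ← Matrix.mulVec_mulVec, Matrix.mulVec_sum, Matrix.mulVec_sum]
    refine Eq.trans (Finset.sum_congr rfl fun b _ => ?_) hc
    rw [firstBlock_smul, Matrix.mulVec_smul, Matrix.mulVec_smul]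
    have := hy b
    rw [this]
    rfl

namespace IsAdmissible

theorem translate {y : Fin (d 0) → ℝ} (hy : ∀ a, |y a| ≤ 1) :
    IsAdmissible B fun ρ z => (z.1, z.2 + ρ • firstBlock y) := by
  have key : ∀ s : Finset (Fin (d 0)), IsAdmissible B fun ρ (z : Pt d) =>
      (z.1, z.2 + ρ • ∑ a ∈ s, y a • (Pi.single (⟨0, a⟩ : Idx d) (1 : ℝ) : Idx d → ℝ)) := by
    intro s
    induction s using Finset.induction_on with
    | empty => simpa using id
    | insert a s ha ih =>
      have := cons (some a) (y a) (hy a) _ ih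
      convert this using 3 with ρ z
      simp only [Letter.flow, Letter.weight, pflow, pow_one, Finset.sum_insert ha]
      rw [smul_add, smul_smul, mul_comm ρ, add_comm (_ • _) (ρ • _), add_assoc]
  exact key Finset.univ

/-- Conjugating the translation by `ρ y` with the flow of `Y` over the time `c ρ²` gives the
translation by `ρ exp (c ρ² B) y`. -/
theorem conj_translate {y : Fin (d 0) → ℝ} (hy : ∀ a, |y a| ≤ 1) {c : ℝ} (hc : |c| ≤ 1) :
    IsAdmissible B fun ρ z =>
      (z.1, z.2 + ρ • (NormedSpace.exp ((c * ρ ^ 2) • B)).mulVec (firstBlock y)) := by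
  have h := cons none c hc _
    ((translate (B := B) hy).comp (single none (c := -c) (by simpa using hc)))
  convert h using 3 with ρ z
  simp only [Letter.flow, Letter.weight, yflow]
  rw [Matrix.mulVec_add, ← exp_add_mulVec, Matrix.mulVec_smul]
  ext1
  · simp only; ring
  · simp

theorem sum_conj_translate {ι : Type*} (s : Finset ι) {y : ι → Fin (d 0) → ℝ}
    (hy : ∀ l a, |y l a| ≤ 1) {c : ι → ℝ} (hc : ∀ l, |c l| ≤ 1) :
    IsAdmissible B fun ρ z => (z.1, z.2 + ρ • ∑ l ∈ s,
      (NormedSpace.exp ((c l * ρ ^ 2) • B)).mulVec (firstBlock (y l))) := by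
  classical
  induction s using Finset.induction_on with
  | empty => simpa using id
  | insert l s hl ih =>
    have h := (conj_translate (B := B) (hy l) (hc l)).comp ih
    convert h using 3 with ρ z
    simp only [Finset.sum_insert hl]
    rw [smul_add, add_assoc, add_comm (ρ • Matrix.mulVec _ _)]

end IsAdmissible

/-- Nodes `c l` in `[-1, 1]`, with weights `α l` that annihilate all powers up to `r` except the
`j`-th. -/
theorem exists_vandermonde (r : ℕ) (j : Fin (r + 1)) : ∃ (c α : Fin (r + 1) → ℝ),
    (∀ l, |c l| ≤ 1) ∧ ∀ m : Fin (r + 1), ∑ l, α l * c l ^ (m : ℕ) = if m = j then 1 else 0 := by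
  let c : Fin (r + 1) → ℝ := fun l => (l : ℕ) / ((r : ℝ) + 1)
  have hinj : Function.Injective c := by
    intro l l' h
    have hr : (r : ℝ) + 1 ≠ 0 := by positivity
    have := (div_left_inj' hr).1 h
    exact Fin.ext (by exact_mod_cast this)
  have hdet : IsUnit (Matrix.vandermonde c).det :=
    (Matrix.det_vandermonde_ne_zero_iff.2 hinj).isUnit
  refine ⟨c, Matrix.vecMul (Pi.single j 1) (Matrix.vandermonde c)⁻¹, ?_, ?_⟩
  · intro l
    have h1 : ((l : ℕ) : ℝ) ≤ (r : ℝ) + 1 := by exact_mod_cast l.isLt.le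
    rw [abs_of_nonneg (by positivity), div_le_one (by positivity)]
    exact h1
  · intro m
    have h : Matrix.vecMul (Matrix.vecMul (Pi.single j 1) (Matrix.vandermonde c)⁻¹)
        (Matrix.vandermonde c) = Pi.single j 1 := by
      rw [Matrix.vecMul_vecMul, Matrix.nonsing_inv_mul _ hdet, Matrix.vecMul_one]
    have h2 := congrFun h m
    rw [Pi.single_apply] at h2
    rw [← h2]
    rfl

/-- Every coordinate direction of block `j` is reached by an admissible family: the conjugates
by the flow of `Y` of the translations by `ρ y` are the translations by `ρ exp (c ρ² B) y`, and a
Vandermonde system selects the term `ρ^(2j+1) B^j y` of a combination of these. -/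
theorem exists_isAdmissible_pflow (hB : IsKolmogorovMatrix d B) (j : Fin (r + 1)) (a : Fin (d j)) :
    ∃ κ : ℝ, 0 < κ ∧ κ ≤ 1 ∧ ∀ ε : ℝ, |ε| = 1 →
      IsAdmissible B fun ρ z => pflow ⟨j, a⟩ (ε * κ * ρ ^ (2 * (j : ℕ) + 1)) z := by
  obtain ⟨y, hy⟩ := hB.exists_pow_mulVec_firstBlock j j.isLt a
  obtain ⟨c, α, hc, hα⟩ := exists_vandermonde r j
  set S : ℝ := 1 + ∑ l, ∑ b, |α l * y b| with hS
  have hsum0 : ∀ l, 0 ≤ ∑ b, |α l * y b| := fun l => Finset.sum_nonneg fun _ _ => abs_nonneg _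
  have hS1 : 1 ≤ S := by
    have : 0 ≤ ∑ l, ∑ b, |α l * y b| := Finset.sum_nonneg fun l _ => hsum0 l
    linarith
  have hle : ∀ l b, |α l * y b| ≤ S := by
    intro l b
    have h1 : |α l * y b| ≤ ∑ b, |α l * y b| :=
      Finset.single_le_sum (f := fun b => |α l * y b|) (fun _ _ => abs_nonneg _) (Finset.mem_univ b)
    have h2 : ∑ b, |α l * y b| ≤ ∑ l, ∑ b, |α l * y b| :=
      Finset.single_le_sum (f := fun l => ∑ b, |α l * y b|) (fun l _ => hsum0 l) (Finset.mem_univ l)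
    linarith
  have hfac : (1 : ℝ) ≤ ((j : ℕ).factorial : ℝ) := by exact_mod_cast (j : ℕ).factorial_pos
  -- `1 / S` makes all coefficients at most `1`, and `j!` comes from the exponential series.
  refine ⟨1 / (S * ((j : ℕ).factorial : ℝ)), by positivity, ?_, ?_⟩
  · rw [div_le_one (by positivity)]
    nlinarith
  intro ε hε
  have h := IsAdmissible.sum_conj_translate (B := B) Finset.univ
    (y := fun l => (ε / S * α l) • y) (c := c) (fun l b => by
      simp only [Pi.smul_apply, smul_eq_mul]
      rw [mul_assoc, abs_mul, abs_div, hε, abs_of_pos (by linarith), one_div,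
        inv_mul_le_iff₀ (by linarith), mul_one]
      exact hle l b) hc
  convert h using 3 with ρ z
  simp only [pflow]
  congr 2
  have h1 : ∀ l, (NormedSpace.exp ((c l * ρ ^ 2) • B)).mulVec (firstBlock ((ε / S * α l) • y)) =
      ∑ m : Fin (r + 1), (ε / S * ((ρ ^ 2) ^ (m : ℕ) / ((m : ℕ).factorial : ℝ)) *
        (α l * c l ^ (m : ℕ))) • (B ^ (m : ℕ)).mulVec (firstBlock y) := by
    intro l
    rw [firstBlock_smul, Matrix.mulVec_smul, hB.exp_mulVec, Finset.smul_sum,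
      Finset.sum_range]
    refine Finset.sum_congr rfl fun m _ => ?_
    rw [smul_smul]
    congr 1
    rw [mul_pow]
    ring
  simp_rw [h1]
  rw [Finset.sum_comm]
  simp_rw [← Finset.sum_smul, ← Finset.mul_sum, hα]
  rw [Finset.sum_eq_single j]
  · rw [hy, smul_smul]
    congr 1
    simp only [if_true]
    rw [pow_succ, pow_mul]
    field_simp
  · intro m _ hm
    simp [hm]
  · simp

/-! ### Increments in the directions of block `j` -/

/-- A polynomial of degree `n` vanishes if, for each `ε > 0`, it is bounded by `ε ρ^n` at
arbitrarily small `ρ > 0`. -/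
theorem eq_zero_of_frequently_le (n : ℕ) : ∀ a : ℕ → ℝ,
    (∀ ε > 0, ∃ᶠ ρ in 𝓝[>] (0 : ℝ), |∑ l ∈ Finset.range (n + 1), ρ ^ l * a l| ≤ ε * ρ ^ n) →
    ∀ l ≤ n, a l = 0 := by
  induction n with
  | zero =>
    intro a h l hl
    obtain rfl : l = 0 := by omega
    by_contra hne
    obtain ⟨ρ, hρ⟩ := (h (|a 0| / 2) (by positivity)).exists
    simp only [zero_add, Finset.range_one, Finset.sum_singleton, pow_zero, one_mul, mul_one] at hρ
    have := abs_pos.2 hne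
    linarith
  | succ n ih =>
    intro a h
    have hcont : Tendsto (fun ρ : ℝ => ∑ l ∈ Finset.range (n + 1 + 1), ρ ^ l * a l) (𝓝[>] 0)
        (𝓝 (a 0)) := by
      have : Continuous fun ρ : ℝ => ∑ l ∈ Finset.range (n + 1 + 1), ρ ^ l * a l := by fun_prop
      have h2 := (this.tendsto 0).mono_left (nhdsWithin_le_nhds (s := Ioi 0))
      simpa [Finset.sum_range_succ'] using h2
    have ha0 : a 0 = 0 := by
      by_contra hne
      have hpos := abs_pos.2 hne
      have h1 : ∀ᶠ ρ in 𝓝[>] (0 : ℝ), |a 0| / 2 <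
          |∑ l ∈ Finset.range (n + 1 + 1), ρ ^ l * a l| :=
        hcont.abs.eventually_const_lt (by linarith)
      have h2 : ∀ᶠ ρ in 𝓝[>] (0 : ℝ), ρ ∈ Ioo (0 : ℝ) 1 := Ioo_mem_nhdsGT one_pos
      obtain ⟨ρ, hρ, h3, h4⟩ := ((h (|a 0| / 2) (by positivity)).and_eventually (h1.and h2)).exists
      have h5 : ρ ^ (n + 1) ≤ 1 := pow_le_one₀ h4.1.le h4.2.le
      nlinarith
    have hsucc := ih (fun l => a (l + 1)) (by
      intro ε hε
      refine ((h ε hε).and_eventually self_mem_nhdsWithin).mono ?_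
      rintro ρ ⟨h1, h2⟩
      have hρ : 0 < ρ := h2
      rw [Finset.sum_range_succ' _ (n + 1), ha0, mul_zero, add_zero] at h1
      have h3 : ∑ k ∈ Finset.range (n + 1), ρ ^ (k + 1) * a (k + 1) =
          ρ * ∑ k ∈ Finset.range (n + 1), ρ ^ k * a (k + 1) := by
        rw [Finset.mul_sum]
        refine Finset.sum_congr rfl fun k _ => by ring
      rw [h3, abs_mul, abs_of_pos hρ, pow_succ, ← mul_assoc, mul_comm ρ] at h1
      exact le_of_mul_le_mul_right h1 hρ)
    intro l hl
    rcases l with _ | l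
    · exact ha0
    · exact hsucc l (by omega)

/-- Increments in a direction of block `j`. If `2 j + 1 > n`, the Taylor polynomial of degree `n`
along an admissible family with end point `ε κ ρ^(2j+1)` in that direction reduces to its constant
term: it agrees to order `o(ρ^n)` with `u`, when tested against smooth functions. -/
theorem exists_eLpNorm_pflow_sub_le (hB : IsKolmogorovMatrix d B) (j : Fin (r + 1))
    (a : Fin (d j)) {n : ℕ} (hn : n ≤ 2 * (j : ℕ)) :
    ∃ (κ : ℝ) (K : ℝ≥0), 0 < κ ∧ κ ≤ 1 ∧ ∀ (p : ℝ≥0∞) (F : ℝ → ℝ≥0∞) (u : Pt d → ℝ), 1 ≤ p →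
      IsControlled B p F n u → (∀ η > 0, ∃ᶠ ρ in 𝓝[>] (0 : ℝ), F ρ ≤ ENNReal.ofReal η) →
      ∀ ε : ℝ, |ε| = 1 → ∀ ρ : ℝ, 0 < ρ →
        eLpNorm (fun z => u (pflow ⟨j, a⟩ (ε * κ * ρ ^ (2 * (j : ℕ) + 1)) z) - u z) p volume ≤
          K * (ENNReal.ofReal (ρ ^ n) * F ρ) := by
  obtain ⟨κ, hκ, hκ1, hadm⟩ := exists_isAdmissible_pflow hB j a
  have h1 : |(1 : ℝ)| = 1 := abs_one
  have h2 : |(-1 : ℝ)| = 1 := by simp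
  obtain ⟨K₁, hK₁⟩ := (hadm 1 h1).exists_taylor hB n
  obtain ⟨K₂, hK₂⟩ := (hadm (-1) h2).exists_taylor hB n
  refine ⟨κ, max K₁ K₂, hκ, hκ1, ?_⟩
  intro p F u hp hu hF ε hε
  have hex : ∃ v : ℕ → Pt d → ℝ, (∀ l, LocallyIntegrable (v l)) ∧ ∀ ρ : ℝ, 0 < ρ →
      eLpNorm (fun z => u (pflow ⟨j, a⟩ (ε * κ * ρ ^ (2 * (j : ℕ) + 1)) z) -
        ∑ l ∈ Finset.range (n + 1), ρ ^ l * v l z) p volume ≤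
          ((max K₁ K₂ : ℝ≥0) : ℝ≥0∞) * (ENNReal.ofReal (ρ ^ n) * F ρ) := by
    rcases eq_or_eq_neg_of_abs_eq hε with rfl | rfl
    · obtain ⟨v, hv, h⟩ := hK₁ p F u hp hu
      refine ⟨v, hv, fun ρ hρ => (h ρ hρ).trans ?_⟩
      gcongr
      exact le_max_left _ _
    · obtain ⟨v, hv, h⟩ := hK₂ p F u hp hu
      refine ⟨v, hv, fun ρ hρ => (h ρ hρ).trans ?_⟩
      gcongr
      exact le_max_right _ _
  obtain ⟨v, hv, hle⟩ := hex
  set K := max K₁ K₂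
  set W := 2 * (j : ℕ) + 1 with hW
  have hloc := hu.locallyIntegrable
  have hflow := isSmoothFlow_pflow (d := d) ⟨j, a⟩
  have : ENNReal.HolderConjugate p p.conjExponent := ENNReal.HolderConjugate.conjExponent hp
  -- The polynomial `∑ ρ^l v_l - u` has vanishing coefficients.
  have hcoef : ∀ l ≤ n, v l =ᵐ[volume] if l = 0 then u else fun _ => 0 := by
    have htest : ∀ φ : Pt d → ℝ, ContDiff ℝ ∞ φ → HasCompactSupport φ → ∀ l ≤ n,
        (∫ z, v l z * φ z) - (if l = 0 then ∫ z, u z * φ z else 0) = 0 := by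
      intro φ hφ hc
      refine eq_zero_of_frequently_le n
        (fun l => (∫ z, v l z * φ z) - (if l = 0 then ∫ z, u z * φ z else 0)) ?_
      intro δ hδ
      set A := eLpNorm φ p.conjExponent volume with hA
      have hAtop : A ≠ ⊤ := (hφ.continuous.memLp_of_hasCompactSupport hc).2.ne
      have hη : 0 < δ / (2 * (K * A.toReal + 1)) := by positivity
      -- The pairing with the increment in the direction of block `j` is `O(ρ^(2j+1))`.
      have hO : ∀ᶠ ρ in 𝓝[>] (0 : ℝ),
          |(∫ z, u (pflow ⟨j, a⟩ (ε * κ * ρ ^ W) z) * φ z) - ∫ z, u z * φ z| ≤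
            δ / 2 * ρ ^ n := by
        have hd := (hflow.hasDerivAt_integral_zero hloc hφ hc).isBigO_sub
        obtain ⟨C, hC⟩ := hd.bound
        have ht : Tendsto (fun ρ : ℝ => ε * κ * ρ ^ W) (𝓝[>] 0) (𝓝 0) := by
          have : Continuous fun ρ : ℝ => ε * κ * ρ ^ W := by fun_prop
          have h3 := (this.tendsto 0).mono_left (nhdsWithin_le_nhds (s := Ioi 0))
          simpa [hW] using h3
        have ht2 : Tendsto (fun ρ : ℝ => |C| * ρ) (𝓝[>] 0) (𝓝 0) := by
          have : Continuous fun ρ : ℝ => |C| * ρ := by fun_prop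
          have h3 := (this.tendsto 0).mono_left (nhdsWithin_le_nhds (s := Ioi 0))
          simpa using h3
        filter_upwards [ht.eventually hC, ht2.eventually_le_const (half_pos hδ),
          Ioo_mem_nhdsGT one_pos] with ρ hρ1 hρ2 hρ3
        simp only [neg_zero, hflow.zero, sub_zero, Real.norm_eq_abs] at hρ1
        rw [hflow.integral_comp_mul]
        refine hρ1.trans ?_
        have h4 : |ε * κ * ρ ^ W| ≤ ρ ^ (n + 1) := by
          rw [abs_mul, abs_mul, hε, one_mul, abs_of_pos hκ, abs_of_pos (pow_pos hρ3.1 _)]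
          calc κ * ρ ^ W ≤ 1 * ρ ^ W := by
                gcongr
                exact (pow_pos hρ3.1 _).le
            _ ≤ ρ ^ (n + 1) := by
                rw [one_mul]
                exact pow_le_pow_of_le_one hρ3.1.le hρ3.2.le (by omega)
        calc C * |ε * κ * ρ ^ W| ≤ |C| * ρ ^ (n + 1) := by
              gcongr
              exact le_abs_self C
          _ = |C| * ρ * ρ ^ n := by ring
          _ ≤ δ / 2 * ρ ^ n := by
              gcongr
              exact (pow_pos hρ3.1 _).le
      refine ((hF _ hη).and_eventually (hO.and self_mem_nhdsWithin)).mono ?_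
      rintro ρ ⟨hFρ, hOρ, hρ⟩
      have hρ : 0 < ρ := hρ
      have hi1 : Integrable fun z => u (pflow ⟨j, a⟩ (ε * κ * ρ ^ W) z) * φ z :=
        integrable_mul_test (hflow.locallyIntegrable_comp _ hloc) hφ.continuous hc
      have hi2 : ∀ l ∈ Finset.range (n + 1), Integrable fun z => ρ ^ l * v l z * φ z :=
        fun l _ => integrable_mul_test ((hv l).smul (ρ ^ l)) hφ.continuous hc
      have hsum : ∑ l ∈ Finset.range (n + 1),
          ρ ^ l * ((∫ z, v l z * φ z) - (if l = 0 then ∫ z, u z * φ z else 0)) =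
          ((∫ z, u (pflow ⟨j, a⟩ (ε * κ * ρ ^ W) z) * φ z) - ∫ z, u z * φ z) -
          ∫ z, (u (pflow ⟨j, a⟩ (ε * κ * ρ ^ W) z) -
            ∑ l ∈ Finset.range (n + 1), ρ ^ l * v l z) * φ z := by
        simp_rw [sub_mul, Finset.sum_mul]
        rw [integral_sub hi1 (integrable_finsetSum _ hi2), integral_finsetSum _ hi2]
        simp_rw [mul_assoc, integral_const_mul, mul_sub, Finset.sum_sub_distrib]
        have : ∑ l ∈ Finset.range (n + 1), ρ ^ l * (if l = 0 then ∫ z, u z * φ z else 0) =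
            ∫ z, u z * φ z := by
          rw [Finset.sum_range_succ']
          simp
        rw [this]
        ring
      have hR : |∫ z, (u (pflow ⟨j, a⟩ (ε * κ * ρ ^ W) z) -
            ∑ l ∈ Finset.range (n + 1), ρ ^ l * v l z) * φ z| ≤ δ / 2 * ρ ^ n := by
        have h3 := enorm_integral_mul_le (p := p) (q := p.conjExponent) (φ := φ)
          (((hflow.locallyIntegrable_comp (ε * κ * ρ ^ W) hloc).sub
            (locallyIntegrable_finsetSum (Finset.range (n + 1))
              fun l _ => (hv l).smul (ρ ^ l))).aestronglyMeasurable)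
          hφ.continuous.aestronglyMeasurable
        have h4 : ‖∫ z, (u (pflow ⟨j, a⟩ (ε * κ * ρ ^ W) z) -
            ∑ l ∈ Finset.range (n + 1), ρ ^ l * v l z) * φ z‖ₑ ≤
            ENNReal.ofReal (K * (ρ ^ n * (δ / (2 * (K * A.toReal + 1)))) * A.toReal) := by
          refine h3.trans ?_
          rw [ENNReal.ofReal_mul (by positivity), ENNReal.ofReal_mul (by positivity),
            ENNReal.ofReal_mul (by positivity), ENNReal.ofReal_toReal hAtop,
            ENNReal.ofReal_coe_nnreal]
          gcongr
          refine (hle ρ hρ).trans ?_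
          gcongr
        rw [Real.enorm_eq_ofReal_abs, ENNReal.ofReal_le_ofReal_iff (by positivity)] at h4
        refine h4.trans ?_
        have h5 : (K : ℝ) * A.toReal / (K * A.toReal + 1) ≤ 1 := by
          rw [div_le_one (by positivity)]
          linarith
        calc (K : ℝ) * (ρ ^ n * (δ / (2 * (K * A.toReal + 1)))) * A.toReal
            = δ / 2 * ρ ^ n * ((K : ℝ) * A.toReal / (K * A.toReal + 1)) := by
              field_simp
          _ ≤ δ / 2 * ρ ^ n * 1 := by gcongr
          _ = _ := mul_one _
      rw [hsum]
      refine (abs_sub _ _).trans ?_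
      linarith
    intro l hl
    have hl' : LocallyIntegrable (if l = 0 then u else fun _ => 0) := by
      split_ifs
      · exact hloc
      · exact locallyIntegrable_zero
    refine ae_eq_of_integral_contDiff_smul_eq (hv l) hl' fun φ hφ hc => ?_
    have := htest φ hφ hc l hl
    by_cases h0 : l = 0
    · subst h0
      simp only [if_true, smul_eq_mul] at this ⊢
      simpa [mul_comm] using sub_eq_zero.1 this
    · simp only [h0, if_false, sub_zero, smul_eq_mul, mul_zero, integral_zero] at this ⊢
      simpa [mul_comm] using this
  intro ρ hρ
  refine le_trans (le_of_eq ?_) (hle ρ hρ)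
  refine eLpNorm_congr_ae ?_
  have hall : ∀ᵐ z, ∀ l ∈ Finset.range (n + 1), v l z = (if l = 0 then u else fun _ => 0) z := by
    rw [Filter.eventually_all_finset]
    intro l hl
    exact hcoef l (by simpa [Nat.lt_succ_iff] using hl)
  filter_upwards [hall] with z hz
  congr 1
  rw [Finset.sum_congr rfl fun l hl => by rw [hz l hl], Finset.sum_range_succ']
  simp

/-! ### Commutators and the weak derivatives `Y^k ∂^β u` -/

/-- Smooth functions with compact support. -/
def IsTest (φ : Pt d → ℝ) : Prop := ContDiff ℝ ∞ φ ∧ HasCompactSupport φ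

theorem IsTest.pderiv {φ : Pt d → ℝ} (h : IsTest φ) (i : Idx d) : IsTest (pderiv i φ) :=
  ⟨contDiff_fderiv_field contDiff_const h.1, hasCompactSupport_fderiv_field h.2⟩

theorem contDiff_yfield : ContDiff ℝ ∞ fun z : Pt d => ((1 : ℝ), B.mulVec z.2) :=
  contDiff_const.prodMk (contDiff_mulVec B contDiff_snd)

theorem IsTest.yderiv {φ : Pt d → ℝ} (h : IsTest φ) : IsTest (yderiv B φ) :=
  ⟨contDiff_fderiv_field contDiff_yfield h.1, hasCompactSupport_fderiv_field h.2⟩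

theorem IsTest.iterate {φ : Pt d → ℝ} (h : IsTest φ) {A : (Pt d → ℝ) → Pt d → ℝ}
    (hA : ∀ ψ, IsTest ψ → IsTest (A ψ)) (k : ℕ) : IsTest (A^[k] φ) := by
  induction k with
  | zero => exact h
  | succ k ih => rw [Function.iterate_succ_apply']; exact hA _ ih

theorem IsTest.foldr {φ : Pt d → ℝ} (h : IsTest φ) (β : Idx d → ℕ) (L : List (Idx d)) :
    IsTest (L.foldr (fun i ψ => (Kolmogorov.pderiv i)^[β i] ψ) φ) := by
  induction L with
  | nil => exact h
  | cons i L ih => exact ih.iterate (fun ψ hψ => hψ.pderiv i) _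

/-- `[∂_{x_b}, Y] = ⟨B e_b, ∇⟩` on smooth functions. -/
theorem pderiv_yderiv_sub {φ : Pt d → ℝ} (hφ : ContDiff ℝ ∞ φ) (b : Idx d) (z : Pt d) :
    pderiv b (yderiv B φ) z - yderiv B (pderiv b φ) z =
      fderiv ℝ φ z (0, B.mulVec (Pi.single b 1)) := by
  have hd : DifferentiableAt ℝ (fderiv ℝ φ) z :=
    ((hφ.fderiv_right (m := ∞) (by simp)).differentiable (by simp)) z
  have hL : HasFDerivAt (fun z : Pt d => ((1 : ℝ), B.mulVec z.2))
      ((0 : Pt d →L[ℝ] ℝ).prod ((LinearMap.toContinuousLinearMap (Matrix.mulVecLin B)).comp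
        (ContinuousLinearMap.snd ℝ ℝ (Idx d → ℝ)))) z := by
    refine (hasFDerivAt_const (1 : ℝ) z).prodMk ?_
    exact (LinearMap.toContinuousLinearMap (Matrix.mulVecLin B)).hasFDerivAt.comp z
      hasFDerivAt_snd
  have h1 : pderiv b (yderiv B φ) z =
      fderiv ℝ (fderiv ℝ φ) z (0, Pi.single b 1) (1, B.mulVec z.2) +
        fderiv ℝ φ z (0, B.mulVec (Pi.single b 1)) := by
    have := (hd.hasFDerivAt.clm_apply hL).fderiv
    unfold pderiv yderiv
    rw [this]
    simp [add_comm]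
  have h2 : yderiv B (pderiv b φ) z =
      fderiv ℝ (fderiv ℝ φ) z (1, B.mulVec z.2) (0, Pi.single b 1) := by
    have := (hd.hasFDerivAt.clm_apply
      (hasFDerivAt_const ((0 : ℝ), (Pi.single b 1 : Idx d → ℝ)) z)).fderiv
    unfold pderiv yderiv
    rw [this]
    simp
  have hsymm : fderiv ℝ (fderiv ℝ φ) z (0, Pi.single b 1) (1, B.mulVec z.2) =
      fderiv ℝ (fderiv ℝ φ) z (1, B.mulVec z.2) (0, Pi.single b 1) :=
    (hφ.contDiffAt.isSymmSndFDerivAt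
      (by rw [minSmoothness_of_isRCLikeNormedField]; exact ENat.LEInfty.out)).eq _ _
  rw [h1, h2, hsymm]
  ring

/-- A direction `e_i` which is a combination of vectors `B e_b` inherits weak derivatives from the
directions `e_b`, because `⟨B e_b, ∇⟩ = ∂_{x_b} Y - Y ∂_{x_b}`. -/
theorem exists_isWeakPDeriv_of_commutator (hB : IsKolmogorovMatrix d B) {ι : Type*} [Fintype ι]
    (b : ι → Idx d) (c : ι → ℝ) (i : Idx d)
    (hc : ∑ l, c l • B.mulVec (Pi.single (b l) 1) = Pi.single i 1) {w : ℕ}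
    (ih : ∀ l, ∃ K : ℝ≥0, ∀ (p : ℝ≥0∞) (F : ℝ → ℝ≥0∞) (n : ℕ) (u : Pt d → ℝ), 1 ≤ p →
        IsControlled B p F (n + w) u →
        ∃ v, IsWeakPDeriv (b l) u v ∧ IsControlled B p (fun ρ => K * F ρ) n v) :
    ∃ K : ℝ≥0, ∀ (p : ℝ≥0∞) (F : ℝ → ℝ≥0∞) (n : ℕ) (u : Pt d → ℝ), 1 ≤ p →
        IsControlled B p F (n + (w + 2)) u →
        ∃ v, IsWeakPDeriv i u v ∧ IsControlled B p (fun ρ => K * F ρ) n v := by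
  choose K hK using ih
  refine ⟨∑ l, Real.nnabs (c l) * (K l + K l), fun p F n u hp hu => ?_⟩
  have hu1 : IsControlled B p F (n + 2 + w) u := by
    have : n + (w + 2) = n + 2 + w := by ring
    rwa [this] at hu
  have hu2 : IsControlled B p F (n + w + Letter.weight (d := d) none) u := by
    rw [← add_assoc] at hu
    exact hu
  choose q hq hqc using fun l => hK l p F (n + 2) u hp hu1
  choose y hy hyc using fun l =>
    IsControlled.exists_isWeakVDeriv (m := n) (X := (none : Letter d)) (hqc l)
  obtain ⟨g, hg, hgc⟩ := IsControlled.exists_isWeakVDeriv hu2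
  choose h hh hhc using fun l => hK l p F n g hp hgc
  have hcontrol := IsControlled.sum hB hp Finset.univ (n := n) fun l _ =>
    ((hhc l).add hB hp ((hyc l).const_mul (-1))).const_mul (c l)
  refine ⟨_, ?_, hcontrol.mono fun ρ _ => ?_⟩
  · refine ⟨hu.locallyIntegrable, hcontrol.locallyIntegrable, fun φ h1 h2 => ?_⟩
    have hφ : IsTest φ := ⟨h1, h2⟩
    have hpt : ∀ z, pderiv i φ z = ∑ l, c l *
        (pderiv (b l) (yderiv B φ) z - yderiv B (pderiv (b l) φ) z) := by
      intro z
      simp_rw [pderiv_yderiv_sub h1]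
      have : pderiv i φ z = fderiv ℝ φ z (ContinuousLinearMap.inr ℝ ℝ (Idx d → ℝ)
          (∑ l, c l • B.mulVec (Pi.single (b l) 1))) := by
        rw [hc]
        rfl
      rw [this, map_sum, map_sum]
      refine Finset.sum_congr rfl fun l _ => ?_
      rw [map_smul, map_smul, smul_eq_mul]
      rfl
    have hi1 : ∀ l, Integrable fun z => u z * pderiv (b l) (yderiv B φ) z := fun l =>
      integrable_mul_test hu.locallyIntegrable ((hφ.yderiv).pderiv _).1.continuous
        ((hφ.yderiv).pderiv _).2
    have hi2 : ∀ l, Integrable fun z => u z * yderiv B (pderiv (b l) φ) z := fun l =>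
      integrable_mul_test hu.locallyIntegrable ((hφ.pderiv _).yderiv).1.continuous
        ((hφ.pderiv _).yderiv).2
    have hi3 : ∀ l, Integrable fun z => y l z * φ z := fun l =>
      integrable_mul_test (hyc l).locallyIntegrable h1.continuous h2
    have hi4 : ∀ l, Integrable fun z => h l z * φ z := fun l =>
      integrable_mul_test (hhc l).locallyIntegrable h1.continuous h2
    have e1 : ∀ l, ∫ z, u z * pderiv (b l) (yderiv B φ) z = ∫ z, y l z * φ z := by
      intro l
      rw [(hq l).2.2 _ hφ.yderiv.1 hφ.yderiv.2]
      have := (hy l).2.2 φ h1 h2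
      change ∫ z, q l z * yderiv B φ z = _ at this
      rw [this, neg_neg]
    have e2 : ∀ l, ∫ z, u z * yderiv B (pderiv (b l) φ) z = ∫ z, h l z * φ z := by
      intro l
      have := hg.2.2 _ (hφ.pderiv (b l)).1 (hφ.pderiv (b l)).2
      change ∫ z, u z * yderiv B (pderiv (b l) φ) z = _ at this
      rw [this, (hh l).2.2 φ h1 h2, neg_neg]
    have l1 : ∫ z, u z * pderiv i φ z =
        ∑ l, c l * ((∫ z, y l z * φ z) - ∫ z, h l z * φ z) := by
      have : ∀ z, u z * pderiv i φ z = ∑ l, c l *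
          (u z * pderiv (b l) (yderiv B φ) z - u z * yderiv B (pderiv (b l) φ) z) := by
        intro z
        rw [hpt, Finset.mul_sum]
        exact Finset.sum_congr rfl fun l _ => by ring
      simp_rw [this]
      refine (integral_finsetSum Finset.univ (f := fun l z => c l *
        (u z * pderiv (b l) (yderiv B φ) z - u z * yderiv B (pderiv (b l) φ) z))
        fun l _ => ((hi1 l).sub (hi2 l)).const_mul (c l)).trans ?_
      refine Finset.sum_congr rfl fun l _ => ?_
      rw [← e1, ← e2, ← integral_sub (hi1 l) (hi2 l), ← integral_const_mul]
    have l2 : ∫ z, (∑ l, c l * (h l z + -1 * y l z)) * φ z =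
        ∑ l, c l * ((∫ z, h l z * φ z) - ∫ z, y l z * φ z) := by
      have : ∀ z, (∑ l, c l * (h l z + -1 * y l z)) * φ z = ∑ l, c l *
          (h l z * φ z - y l z * φ z) := by
        intro z
        rw [Finset.sum_mul]
        exact Finset.sum_congr rfl fun l _ => by ring
      simp_rw [this]
      refine (integral_finsetSum Finset.univ (f := fun l z => c l * (h l z * φ z - y l z * φ z))
        fun l _ => ((hi4 l).sub (hi3 l)).const_mul (c l)).trans ?_
      refine Finset.sum_congr rfl fun l _ => ?_
      rw [← integral_sub (hi4 l) (hi3 l), ← integral_const_mul]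
    rw [l1, l2, ← Finset.sum_neg_distrib]
    exact Finset.sum_congr rfl fun l _ => by ring
  · push_cast
    rw [Finset.sum_mul]
    refine Finset.sum_le_sum fun l _ => ?_
    have : ENNReal.ofReal |c l| = (Real.nnabs (c l) : ℝ≥0∞) := by
      rw [← Real.coe_nnabs, ENNReal.ofReal_coe_nnreal]
    rw [this]
    simp only [abs_neg, abs_one, ENNReal.ofReal_one, one_mul]
    rw [mul_assoc, add_mul]

/-- A controlled function has weak derivatives in the directions of block `j`, at the expense of
`2 j + 1` orders of control. -/
theorem exists_isWeakPDeriv (hB : IsKolmogorovMatrix d B) :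
    ∀ (j : ℕ) (hj : j < r + 1) (a : Fin (d ⟨j, hj⟩)), ∃ K : ℝ≥0,
      ∀ (p : ℝ≥0∞) (F : ℝ → ℝ≥0∞) (n : ℕ) (u : Pt d → ℝ), 1 ≤ p →
        IsControlled B p F (n + (2 * j + 1)) u →
        ∃ v, IsWeakPDeriv ⟨⟨j, hj⟩, a⟩ u v ∧ IsControlled B p (fun ρ => K * F ρ) n v := by
  intro j
  induction j with
  | zero =>
    intro hj a
    refine ⟨1, fun p F n u hp hu => ?_⟩
    obtain ⟨v, hv, hvc⟩ := IsControlled.exists_isWeakVDeriv (m := n) (X := some a) hu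
    exact ⟨v, hv, hvc.mono fun ρ _ => by simp⟩
  | succ j ih =>
    intro hj a
    obtain ⟨c, hc⟩ := hB.exists_sum_mulVec_single ⟨j, by omega⟩ a
    exact exists_isWeakPDeriv_of_commutator hB _ c _ hc (ih (by omega))

/-- Iterated weak derivatives: if each controlled function has a weak derivative `v` of weight `w`,
dual to `-A` on test functions, then it has iterated ones. -/
theorem exists_iterate {A : (Pt d → ℝ) → Pt d → ℝ} (hA : ∀ ψ, IsTest ψ → IsTest (A ψ)) {w : ℕ}
    (h : ∃ K : ℝ≥0, ∀ (p : ℝ≥0∞) (F : ℝ → ℝ≥0∞) (n : ℕ) (u : Pt d → ℝ), 1 ≤ p →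
      IsControlled B p F (n + w) u → ∃ v, IsControlled B p (fun ρ => K * F ρ) n v ∧
        ∀ φ, IsTest φ → ∫ z, u z * A φ z = -∫ z, v z * φ z) (k : ℕ) :
    ∃ K : ℝ≥0, ∀ (p : ℝ≥0∞) (F : ℝ → ℝ≥0∞) (n : ℕ) (u : Pt d → ℝ), 1 ≤ p →
      IsControlled B p F (n + w * k) u → ∃ v, IsControlled B p (fun ρ => K * F ρ) n v ∧
        ∀ φ, IsTest φ → ∫ z, u z * A^[k] φ z = (-1) ^ k * ∫ z, v z * φ z := by
  induction k with
  | zero =>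
    exact ⟨1, fun p F n u _ hu => ⟨u, hu.mono fun ρ _ => by simp, fun φ _ => by simp⟩⟩
  | succ k ih =>
    obtain ⟨K₁, h₁⟩ := h
    obtain ⟨K₂, h₂⟩ := ih
    refine ⟨K₂ * K₁, fun p F n u hp hu => ?_⟩
    have hu' : IsControlled B p F (n + w * k + w) u := by
      have : n + w * (k + 1) = n + w * k + w := by ring
      rwa [this] at hu
    obtain ⟨v₁, hv₁, hd₁⟩ := h₁ p F _ u hp hu'
    obtain ⟨v₂, hv₂, hd₂⟩ := h₂ p _ n v₁ hp hv₁
    refine ⟨v₂, hv₂.mono fun ρ _ => by push_cast; rw [mul_assoc], fun φ hφ => ?_⟩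
    rw [Function.iterate_succ_apply', hd₁ _ (hφ.iterate hA k), hd₂ φ hφ, pow_succ]
    ring

/-- Iterated weak partial derivatives, in the order of a list of variables. -/
theorem exists_foldr (hB : IsKolmogorovMatrix d B) (β : Idx d → ℕ) (L : List (Idx d)) :
    ∃ K : ℝ≥0, ∀ (p : ℝ≥0∞) (F : ℝ → ℝ≥0∞) (n : ℕ) (u : Pt d → ℝ), 1 ≤ p →
      IsControlled B p F (n + (L.map fun i => (2 * (i.1 : ℕ) + 1) * β i).sum) u →
      ∃ v, IsControlled B p (fun ρ => K * F ρ) n v ∧ ∀ φ, IsTest φ →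
        ∫ z, u z * L.foldr (fun i ψ => (pderiv i)^[β i] ψ) φ z =
          (-1) ^ (L.map β).sum * ∫ z, v z * φ z := by
  induction L with
  | nil =>
    exact ⟨1, fun p F n u _ hu => ⟨u, hu.mono fun ρ _ => by simp, fun φ _ => by simp⟩⟩
  | cons i L ih =>
    obtain ⟨K₁, h₁⟩ := exists_iterate (B := B) (A := pderiv i) (fun ψ hψ => hψ.pderiv i)
      (w := 2 * (i.1 : ℕ) + 1) (by
        obtain ⟨K, hK⟩ := exists_isWeakPDeriv hB i.1 i.1.isLt i.2
        refine ⟨K, fun p F n u hp hu => ?_⟩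
        obtain ⟨v, hv, hvc⟩ := hK p F n u hp hu
        exact ⟨v, hvc, fun φ hφ => hv.2.2 φ hφ.1 hφ.2⟩) (β i)
    obtain ⟨K₂, h₂⟩ := ih
    refine ⟨K₂ * K₁, fun p F n u hp hu => ?_⟩
    have hu' : IsControlled B p F (n + (L.map fun i => (2 * (i.1 : ℕ) + 1) * β i).sum +
        (2 * (i.1 : ℕ) + 1) * β i) u := by
      rw [List.map_cons, List.sum_cons, add_comm (_ * _), ← add_assoc] at hu
      exact hu
    obtain ⟨v₁, hv₁, hd₁⟩ := h₁ p F _ u hp hu'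
    obtain ⟨v₂, hv₂, hd₂⟩ := h₂ p _ n v₁ hp hv₁
    refine ⟨v₂, hv₂.mono fun ρ _ => by push_cast; rw [mul_assoc], fun φ hφ => ?_⟩
    rw [List.foldr_cons, hd₁ _ (hφ.foldr β L), hd₂ φ hφ, List.map_cons, List.sum_cons, pow_add]
    ring

theorem sum_map_idxList (f : Idx d → ℕ) : ((idxList d).map f).sum = ∑ i, f i := by
  have hflat : ∀ (L : List (Fin (r + 1))) (g : Fin (r + 1) → List (Idx d)),
      ((L.flatMap g).map f).sum = (L.map fun j => ((g j).map f).sum).sum := by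
    intro L g
    induction L with
    | nil => rfl
    | cons j L ih => simp [ih]
  rw [idxList, hflat, Fintype.sum_sigma, Fin.sum_univ_def]
  congr 1
  refine List.map_congr_left fun j _ => ?_
  rw [List.map_map, Fin.sum_univ_def]
  rfl

/-- The weak derivative `Y^k ∂^β u`. -/
theorem exists_isWeakDeriv (hB : IsKolmogorovMatrix d B) (k : ℕ) (β : Idx d → ℕ) :
    ∃ K : ℝ≥0, ∀ (p : ℝ≥0∞) (F : ℝ → ℝ≥0∞) (n : ℕ) (u : Pt d → ℝ), 1 ≤ p →
      IsControlled B p F (n + 2 * k + blength β) u →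
      ∃ v, IsWeakDeriv B k β u v ∧ IsControlled B p (fun ρ => K * F ρ) n v := by
  obtain ⟨K₁, h₁⟩ := exists_foldr hB β (idxList d)
  obtain ⟨K₂, h₂⟩ := exists_iterate (B := B) (A := yderiv B) (fun ψ hψ => hψ.yderiv) (w := 2)
    ⟨1, fun p F n u _ hu => by
      obtain ⟨v, hv, hvc⟩ := IsControlled.exists_isWeakVDeriv (m := n) (X := none) hu
      exact ⟨v, hvc.mono fun ρ _ => by simp, fun φ hφ => hv.2.2 φ hφ.1 hφ.2⟩⟩ k
  refine ⟨K₂ * K₁, fun p F n u hp hu => ?_⟩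
  obtain ⟨v₁, hv₁, hd₁⟩ := h₁ p F (n + 2 * k) u hp (by rwa [sum_map_idxList])
  obtain ⟨v₂, hv₂, hd₂⟩ := h₂ p _ n v₁ hp hv₁
  refine ⟨v₂, ⟨hu.locallyIntegrable, hv₂.locallyIntegrable, fun φ h1 h2 => ?_⟩,
    hv₂.mono fun ρ _ => by push_cast; rw [mul_assoc]⟩
  have hφ : IsTest φ := ⟨h1, h2⟩
  rw [mderiv, hd₁ _ (hφ.iterate (fun ψ hψ => hψ.yderiv) k), hd₂ φ hφ, sum_map_idxList, add_comm k,
    pow_add]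
  ring

theorem IsWeakDeriv.unique {k : ℕ} {β : Idx d → ℕ} {u v v' : Pt d → ℝ}
    (h : IsWeakDeriv B k β u v) (h' : IsWeakDeriv B k β u v') : v =ᵐ[volume] v' := by
  refine ae_eq_of_integral_contDiff_smul_eq h.2.1 h'.2.1 fun φ h1 h2 => ?_
  have := (h.2.2 φ h1 h2).symm.trans (h'.2.2 φ h1 h2)
  have := mul_left_cancel₀ (pow_ne_zero _ (by norm_num)) this
  simpa [mul_comm] using this

/-! ### Norms of functions of the scale -/

/-- The norm of `ρ ↦ ρ^(-σ) F(ρ)` in `L^q((0, ∞), dρ/ρ)`; for `q = ∞` a genuine supremum. -/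
noncomputable def scaleNorm (σ : ℝ) (q : ℝ≥0∞) (F : ℝ → ℝ≥0∞) : ℝ≥0∞ :=
  if q = ⊤ then ⨆ (ρ : ℝ) (_ : 0 < ρ), F ρ / ENNReal.ofReal (ρ ^ σ)
  else (∫⁻ ρ in Ioi (0 : ℝ), F ρ ^ q.toReal /
    ENNReal.ofReal (ρ ^ (1 + q.toReal * σ))) ^ (1 / q.toReal)

section ScaleNorm

variable {σ : ℝ} {q : ℝ≥0∞} {F G : ℝ → ℝ≥0∞}

theorem toReal_one_le (hq : 1 ≤ q) (hqt : q ≠ ⊤) : 1 ≤ q.toReal := by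
  rw [← ENNReal.toReal_one]
  exact ENNReal.toReal_mono hqt hq

theorem scaleNorm_const_mul_le (hq : 1 ≤ q) (K : ℝ≥0) :
    scaleNorm σ q (fun ρ => K * F ρ) ≤ K * scaleNorm σ q F := by
  unfold scaleNorm
  split_ifs with hqt
  · refine iSup₂_le fun ρ hρ => ?_
    rw [mul_div_assoc]
    gcongr
    exact le_iSup₂ (f := fun (ρ : ℝ) (_ : 0 < ρ) => F ρ / ENNReal.ofReal (ρ ^ σ)) ρ hρ
  · have hQ := toReal_one_le hq hqt
    have hQ0 : 0 < q.toReal := by linarith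
    have hK : (K : ℝ≥0∞) ^ q.toReal ≠ ⊤ :=
      ENNReal.rpow_ne_top_of_nonneg hQ0.le ENNReal.coe_ne_top
    simp_rw [ENNReal.mul_rpow_of_nonneg _ _ hQ0.le, mul_div_assoc]
    rw [lintegral_const_mul' _ _ hK, ENNReal.mul_rpow_of_nonneg _ _ (by positivity),
      ← ENNReal.rpow_mul, mul_one_div_cancel hQ0.ne', ENNReal.rpow_one]

theorem scaleNorm_add_le (hq : 1 ≤ q) (hF : Measurable F) (hG : Measurable G) :
    scaleNorm σ q (fun ρ => F ρ + G ρ) ≤ scaleNorm σ q F + scaleNorm σ q G := by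
  unfold scaleNorm
  split_ifs with hqt
  · refine iSup₂_le fun ρ hρ => ?_
    rw [ENNReal.add_div]
    gcongr
    · exact le_iSup₂ (f := fun (ρ : ℝ) (_ : 0 < ρ) => F ρ / ENNReal.ofReal (ρ ^ σ)) ρ hρ
    · exact le_iSup₂ (f := fun (ρ : ℝ) (_ : 0 < ρ) => G ρ / ENNReal.ofReal (ρ ^ σ)) ρ hρ
  · have hQ := toReal_one_le hq hqt
    set Q := q.toReal
    have hQ0 : 0 < Q := by linarith
    have key : ∀ H : ℝ → ℝ≥0∞, ∫⁻ ρ in Ioi (0 : ℝ), H ρ ^ Q / ENNReal.ofReal (ρ ^ (1 + Q * σ)) =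
        ∫⁻ ρ in Ioi (0 : ℝ), (H ρ / ENNReal.ofReal (ρ ^ ((1 + Q * σ) / Q))) ^ Q := by
      intro H
      refine setLIntegral_congr_fun measurableSet_Ioi fun ρ hρ => ?_
      have hρ : 0 < ρ := hρ
      rw [ENNReal.div_rpow_of_nonneg _ _ hQ0.le,
        ENNReal.ofReal_rpow_of_pos (Real.rpow_pos_of_pos hρ _), ← Real.rpow_mul hρ.le,
        div_mul_cancel₀ _ hQ0.ne']
    rw [key fun ρ => F ρ + G ρ, key F, key G]
    have hm : Measurable fun ρ : ℝ => ENNReal.ofReal (ρ ^ ((1 + Q * σ) / Q)) :=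
      (measurable_id.pow_const _).ennreal_ofReal
    refine le_trans (le_of_eq ?_)
      (ENNReal.lintegral_Lp_add_le (hF.div hm).aemeasurable (hG.div hm).aemeasurable hQ)
    simp only [Pi.add_apply, ENNReal.add_div]

theorem scaleNorm_zero (hq : 1 ≤ q) : scaleNorm σ q (fun _ => 0) = 0 := by
  have := scaleNorm_const_mul_le (σ := σ) (F := fun _ => 0) hq 0
  simpa using this

theorem scaleNorm_sum_le (hq : 1 ≤ q) {ι : Type*} (s : Finset ι) {H : ι → ℝ → ℝ≥0∞}
    (hH : ∀ i, Measurable (H i)) :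
    scaleNorm σ q (fun ρ => ∑ i ∈ s, H i ρ) ≤ ∑ i ∈ s, scaleNorm σ q (H i) := by
  classical
  induction s using Finset.induction_on with
  | empty => simp [scaleNorm_zero hq]
  | insert a s ha ih =>
    simp only [Finset.sum_insert ha]
    refine (scaleNorm_add_le hq (hH a) (Finset.measurable_fun_sum _ fun i _ => hH i)).trans ?_
    gcongr

theorem lintegral_Ioo_inv_eq_top {δ : ℝ} (hδ : 0 < δ) :
    ∫⁻ ρ in Ioo 0 δ, ENNReal.ofReal ρ⁻¹ = ⊤ := by
  by_contra hne
  have h1 : IntegrableOn (fun ρ : ℝ => ρ⁻¹) (Ioo 0 δ) := by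
    refine ⟨measurable_inv.aestronglyMeasurable, ?_⟩
    rw [hasFiniteIntegral_iff_ofReal]
    · exact Ne.lt_top hne
    · filter_upwards [ae_restrict_mem measurableSet_Ioo] with ρ hρ
      exact inv_nonneg.2 hρ.1.le
  have h2 : IntervalIntegrable (fun ρ : ℝ => ρ⁻¹) volume 0 δ := by
    rw [intervalIntegrable_iff_integrableOn_Ioo_of_le hδ.le]
    exact h1
  rcases intervalIntegrable_inv_iff.1 h2 with h | h
  · exact hδ.ne h
  · exact h (by simp [hδ.le])

/-- A function of finite scale norm of positive order is small along some scales tending to `0`. -/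
theorem frequently_le_of_scaleNorm_ne_top (hσ : 0 < σ) (hq : 1 ≤ q)
    (h : scaleNorm σ q F ≠ ⊤) {η : ℝ} (hη : 0 < η) :
    ∃ᶠ ρ in 𝓝[>] (0 : ℝ), F ρ ≤ ENNReal.ofReal η := by
  by_contra hcon
  rw [not_frequently] at hcon
  unfold scaleNorm at h
  split_ifs at h with hqt
  · set N := ⨆ (ρ : ℝ) (_ : 0 < ρ), F ρ / ENNReal.ofReal (ρ ^ σ) with hN
    have ht : Tendsto (fun ρ : ℝ => N * ENNReal.ofReal (ρ ^ σ)) (𝓝[>] 0) (𝓝 0) := by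
      have h1 : Tendsto (fun ρ : ℝ => ρ ^ σ) (𝓝[>] 0) (𝓝 0) := by
        have := (Real.continuousAt_rpow_const 0 σ (Or.inr hσ.le)).tendsto
        rw [Real.zero_rpow hσ.ne'] at this
        exact this.mono_left nhdsWithin_le_nhds
      have h2 := ENNReal.Tendsto.const_mul (ENNReal.tendsto_ofReal h1) (Or.inr h)
      simpa using h2
    have h3 : ∀ᶠ ρ in 𝓝[>] (0 : ℝ), N * ENNReal.ofReal (ρ ^ σ) < ENNReal.ofReal η :=
      ht.eventually_lt_const (by simpa using hη)
    obtain ⟨ρ, h4, h5, h6⟩ := (hcon.and (h3.and self_mem_nhdsWithin)).exists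
    have hρ : 0 < ρ := h6
    refine h4 (le_trans ?_ h5.le)
    have h7 : F ρ / ENNReal.ofReal (ρ ^ σ) ≤ N :=
      le_iSup₂ (f := fun (ρ : ℝ) (_ : 0 < ρ) => F ρ / ENNReal.ofReal (ρ ^ σ)) ρ hρ
    exact (ENNReal.div_le_iff (by simpa using Real.rpow_pos_of_pos hρ σ)
      ENNReal.ofReal_ne_top).1 h7
  · have hQ := toReal_one_le hq hqt
    set Q := q.toReal
    have hQ0 : 0 < Q := by linarith
    obtain ⟨δ, hδ, hsub⟩ := mem_nhdsGT_iff_exists_Ioo_subset.1 (hcon.and (Ioo_mem_nhdsGT one_pos))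
    have hδ : 0 < δ := hδ
    apply h
    rw [ENNReal.rpow_eq_top_iff]
    refine Or.inr ⟨?_, by positivity⟩
    rw [eq_top_iff]
    have hηQ : ENNReal.ofReal η ^ Q ≠ 0 := by
      simp [hη]
    -- Otherwise `F ≥ η` near `0`, where `ρ^(-1-Qσ) ≥ ρ⁻¹` is not integrable.
    calc ⊤ = ENNReal.ofReal η ^ Q * ∫⁻ ρ in Ioo 0 δ, ENNReal.ofReal ρ⁻¹ := by
          rw [lintegral_Ioo_inv_eq_top hδ, ENNReal.mul_top hηQ]
      _ = ∫⁻ ρ in Ioo 0 δ, ENNReal.ofReal η ^ Q * ENNReal.ofReal ρ⁻¹ := by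
          rw [lintegral_const_mul]
          exact measurable_inv.ennreal_ofReal
      _ ≤ ∫⁻ ρ in Ioo 0 δ, F ρ ^ Q / ENNReal.ofReal (ρ ^ (1 + Q * σ)) := by
          refine setLIntegral_mono' measurableSet_Ioo fun ρ hρ => ?_
          have h1 := hsub hρ
          have hρ0 : 0 < ρ := hρ.1
          have hle : ρ ^ (1 + Q * σ) ≤ ρ := by
            calc ρ ^ (1 + Q * σ) ≤ ρ ^ (1 : ℝ) :=
                  Real.rpow_le_rpow_of_exponent_ge hρ0 h1.2.2.le (by nlinarith)
              _ = ρ := Real.rpow_one ρ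
          rw [div_eq_mul_inv, ENNReal.ofReal_inv_of_pos hρ0]
          gcongr
          exact (not_le.1 h1.1).le
      _ ≤ _ := lintegral_mono_set Ioo_subset_Ioi_self

end ScaleNorm

/-! ### Moduli of continuity along flows -/

section Modulus

variable {E : Type*} [NormedAddCommGroup E] [NormedSpace ℝ E] [FiniteDimensional ℝ E]
  [MeasurableSpace E] [BorelSpace E] {μ : Measure E} {flow : ℝ → E → E} {V : E → E}
  {u : E → ℝ} {p : ℝ≥0∞}

theorem IsSmoothFlow.measurable_eLpNorm_sub [SFinite μ] (hf : IsSmoothFlow μ flow V)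
    (hu : AEStronglyMeasurable u μ) (hp : p ≠ 0) :
    Measurable fun τ => eLpNorm (fun z => u (flow τ z) - u z) p μ := by
  let u' := hu.mk u
  have hu' : Measurable u' := hu.stronglyMeasurable_mk.measurable
  have heq : (fun τ => eLpNorm (fun z => u (flow τ z) - u z) p μ) =
      fun τ => eLpNorm (fun z => u' (flow τ z) - u' z) p μ := by
    funext τ
    exact eLpNorm_flow_sub_congr (hf.measurePreserving τ) hu.ae_eq_mk
  rw [heq]
  have hg : Measurable fun x : ℝ × E => u' (flow x.1 x.2) - u' x.2 :=
    (hu'.comp hf.contDiff.continuous.measurable).sub (hu'.comp measurable_snd)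
  by_cases hpt : p = ⊤
  · subst hpt
    simp_rw [eLpNorm_exponent_top]
    refine measurable_of_Ioi fun c => ?_
    have hset : MeasurableSet {x : ℝ × E | c < ‖u' (flow x.1 x.2) - u' x.2‖ₑ} :=
      measurableSet_lt measurable_const hg.enorm
    have hm := measurable_measure_prodMk_left (ν := μ) hset
    have : (fun τ => eLpNormEssSup (fun z => u' (flow τ z) - u' z) μ) ⁻¹' Ioi c =
        (fun τ => μ (Prod.mk τ ⁻¹' {x : ℝ × E | c < ‖u' (flow x.1 x.2) - u' x.2‖ₑ})) ⁻¹' Ioi 0 := by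
      ext τ
      simp only [mem_preimage, mem_Ioi]
      rw [← not_le, ← not_le, nonpos_iff_eq_zero, not_iff_not]
      constructor
      · intro h
        have h1 := ae_le_eLpNormEssSup (f := fun z => u' (flow τ z) - u' z) (μ := μ)
        rw [ae_iff] at h1
        refine measure_mono_null ?_ h1
        intro z hz
        simp only [mem_preimage, mem_ofPred_eq] at hz ⊢
        exact fun h2 => absurd (h2.trans h) (not_le.2 hz)
      · intro h
        refine eLpNormEssSup_le_of_ae_enorm_bound ?_
        rw [ae_iff]
        refine measure_mono_null ?_ h
        intro z hz
        simpa using hz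
    rw [this]
    exact hm measurableSet_Ioi
  · simp_rw [eLpNorm_eq_lintegral_rpow_enorm_toReal hp hpt]
    exact ((hg.enorm.pow_const _).lintegral_prod_right').pow_const _

/-- Subadditivity of the modulus of continuity along a flow. -/
theorem IsSmoothFlow.eLpNorm_sub_le_add (hf : IsSmoothFlow μ flow V)
    (hu : LocallyIntegrable u μ) (hp : 1 ≤ p) (τ t : ℝ) :
    eLpNorm (fun z => u (flow τ z) - u z) p μ ≤
      eLpNorm (fun z => u (flow (τ + t) z) - u z) p μ +
        eLpNorm (fun z => u (flow t z) - u z) p μ := by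
  have hm : ∀ t, AEStronglyMeasurable (fun z => u (flow t z) - u z) μ := fun t =>
    ((hf.locallyIntegrable_comp t hu).sub hu).aestronglyMeasurable
  have h1 := eLpNorm_comp_measurePreserving (p := p) (hm τ) (hf.measurePreserving t)
  rw [← h1]
  have h2 : (fun z => u (flow τ z) - u z) ∘ flow t =
      (fun z => u (flow (τ + t) z) - u z) - fun z => u (flow t z) - u z := by
    funext z
    simp only [Function.comp_apply, Pi.sub_apply, hf.add]
    ring
  rw [h2]
  exact eLpNorm_sub_le (hm _) (hm _) hp

/-- The values of a subadditive modulus at times `|τ| ≤ h` are bounded by its average over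
`|t| < 2 h`: average the bound `θ τ ≤ θ (τ + t) + θ t` over `0 < t < h`. -/
theorem mul_rpow_le_lintegral {θ : ℝ → ℝ≥0∞} (hθ : Measurable θ)
    (hsub : ∀ τ t, θ τ ≤ θ (τ + t) + θ t) {Q : ℝ} (hQ : 1 ≤ Q) {h : ℝ} {τ : ℝ}
    (hτ : |τ| ≤ h) :
    ENNReal.ofReal h * θ τ ^ Q ≤ 2 ^ Q * ∫⁻ t in Ioo (-(2 * h)) (2 * h), θ t ^ Q := by
  have hQ0 : 0 ≤ Q := by linarith
  have hm : Measurable fun t => θ t ^ Q := hθ.pow_const Q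
  set I := ∫⁻ t in Ioo (-(2 * h)) (2 * h), θ t ^ Q with hI
  have h1 : ∫⁻ t in Ioo 0 h, θ (τ + t) ^ Q ≤ I := by
    rw [hI, ← lintegral_indicator measurableSet_Ioo, ← lintegral_indicator measurableSet_Ioo,
      ← lintegral_add_left_eq_self ((Ioo (-(2 * h)) (2 * h)).indicator fun t => θ t ^ Q) τ]
    refine lintegral_mono fun t => ?_
    by_cases ht : t ∈ Ioo 0 h
    · have : τ + t ∈ Ioo (-(2 * h)) (2 * h) := by
        have := abs_le.1 hτ
        constructor <;> linarith [ht.1, ht.2]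
      simp [ht, this]
    · simp [ht]
  have h2 : ∫⁻ t in Ioo 0 h, θ t ^ Q ≤ I := by
    refine lintegral_mono_set fun t ht => ?_
    constructor <;> linarith [ht.1, ht.2]
  calc ENNReal.ofReal h * θ τ ^ Q = ∫⁻ _ in Ioo 0 h, θ τ ^ Q := by
        rw [setLIntegral_const, Real.volume_Ioo, sub_zero, mul_comm]
    _ ≤ ∫⁻ t in Ioo 0 h, 2 ^ (Q - 1) * (θ (τ + t) ^ Q + θ t ^ Q) := by
        refine lintegral_mono fun t => ?_
        exact (ENNReal.rpow_le_rpow (hsub τ t) hQ0).trans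
          (ENNReal.rpow_add_le_mul_rpow_add_rpow _ _ hQ)
    _ = 2 ^ (Q - 1) * ((∫⁻ t in Ioo 0 h, θ (τ + t) ^ Q) + ∫⁻ t in Ioo 0 h, θ t ^ Q) := by
        rw [lintegral_const_mul' _ _
          (ENNReal.rpow_ne_top_of_nonneg (by linarith) ENNReal.ofNat_ne_top),
          lintegral_add_right _ hm]
    _ ≤ 2 ^ (Q - 1) * (I + I) := by gcongr
    _ = 2 ^ Q * I := by
        rw [← two_mul, ← mul_assoc]
        congr 1
        nth_rw 2 [← ENNReal.rpow_one 2]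
        rw [← ENNReal.rpow_add _ _ (by simp) (by simp), sub_add_cancel]

theorem lintegral_Ioi_rpow_le {c b : ℝ} (hc : 0 < c) (hb : 1 ≤ b) :
    ∫⁻ ρ in Ioi c, ENNReal.ofReal (ρ ^ (-1 - b)) ≤ ENNReal.ofReal (c ^ (-b)) := by
  have hlt : -1 - b < -1 := by linarith
  rw [← ofReal_integral_eq_lintegral_ofReal (integrableOn_Ioi_rpow_of_lt hlt hc),
    integral_Ioi_rpow_of_lt hlt hc]
  · apply ENNReal.ofReal_le_ofReal
    have h1 : -1 - b + 1 = -b := by ring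
    rw [h1, neg_div_neg_eq]
    exact div_le_self (Real.rpow_nonneg hc.le _) hb
  · filter_upwards [ae_restrict_mem measurableSet_Ioi] with ρ hρ
    exact Real.rpow_nonneg (hc.trans hρ).le _

/-- The modulus `θ*(h) = sup_{|τ| ≤ h} θ(τ)`, evaluated at `h = ρ^w`, has at most the
Besov norm of the subadditive modulus `θ`, up to a constant. -/
theorem lintegral_iSup_rpow_le {θ : ℝ → ℝ≥0∞} (hθ : Measurable θ)
    (hsub : ∀ τ t, θ τ ≤ θ (τ + t) + θ t) {Q : ℝ} (hQ : 1 ≤ Q) {w : ℕ} (hw : 1 ≤ w) {σ : ℝ}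
    (hσ : 0 < σ) :
    ∫⁻ ρ in Ioi (0 : ℝ), (⨆ (τ : ℝ) (_ : |τ| ≤ ρ ^ w), θ τ) ^ Q /
        ENNReal.ofReal (ρ ^ (1 + Q * σ)) ≤
      2 ^ Q * (ENNReal.ofReal (2 ^ (1 + Q * (σ / w))) *
        ∫⁻ h : ℝ, θ h ^ Q / ENNReal.ofReal (|h| ^ (1 + Q * (σ / w)))) := by
  have hQ0 : 0 < Q := by linarith
  have hw0 : (0 : ℝ) < w := by exact_mod_cast hw
  have hw1 : (1 : ℝ) ≤ w := by exact_mod_cast hw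
  -- The average over `|t| < 2 ρ^w` contributes the additional factor `ρ^(-w)`.
  set b : ℝ := Q * σ + w with hb
  have hb1 : 1 ≤ b := by
    have : 0 < Q * σ := by positivity
    linarith
  have hpt : ∀ ρ ∈ Ioi (0 : ℝ), (⨆ (τ : ℝ) (_ : |τ| ≤ ρ ^ w), θ τ) ^ Q /
        ENNReal.ofReal (ρ ^ (1 + Q * σ)) ≤
      2 ^ Q * ∫⁻ t : ℝ, {x : ℝ × ℝ | |x.2| < 2 * x.1 ^ w}.indicator
        (fun x => ENNReal.ofReal (x.1 ^ (-1 - b)) * θ x.2 ^ Q) (ρ, t) := by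
    intro ρ hρ
    have hρ : 0 < ρ := hρ
    have hρw : 0 < ρ ^ w := pow_pos hρ w
    have h1 : ∫⁻ t : ℝ, {x : ℝ × ℝ | |x.2| < 2 * x.1 ^ w}.indicator
        (fun x => ENNReal.ofReal (x.1 ^ (-1 - b)) * θ x.2 ^ Q) (ρ, t) =
        ENNReal.ofReal (ρ ^ (-1 - b)) * ∫⁻ t in Ioo (-(2 * ρ ^ w)) (2 * ρ ^ w), θ t ^ Q := by
      rw [← lintegral_const_mul' _ _ ENNReal.ofReal_ne_top, ← lintegral_indicator measurableSet_Ioo]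
      refine lintegral_congr fun t => ?_
      simp only [indicator, mem_ofPred_eq, mem_Ioo, abs_lt]
    have h2 : (⨆ (τ : ℝ) (_ : |τ| ≤ ρ ^ w), θ τ) ^ Q ≤
        2 ^ Q * (ENNReal.ofReal (ρ ^ w))⁻¹ *
          ∫⁻ t in Ioo (-(2 * ρ ^ w)) (2 * ρ ^ w), θ t ^ Q := by
      rw [← ENNReal.le_rpow_inv_iff hQ0]
      refine iSup₂_le fun τ hτ => ?_
      rw [ENNReal.le_rpow_inv_iff hQ0, mul_assoc, mul_left_comm, ← ENNReal.div_eq_inv_mul]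
      rw [ENNReal.le_div_iff_mul_le (Or.inl (by simpa using hρw)) (Or.inl ENNReal.ofReal_ne_top),
        mul_comm]
      exact mul_rpow_le_lintegral hθ hsub hQ hτ
    rw [h1]
    have h3 : ENNReal.ofReal (ρ ^ (-1 - b)) =
        (ENNReal.ofReal (ρ ^ w))⁻¹ * (ENNReal.ofReal (ρ ^ (1 + Q * σ)))⁻¹ := by
      rw [← ENNReal.ofReal_inv_of_pos hρw, ← ENNReal.ofReal_inv_of_pos (Real.rpow_pos_of_pos hρ _),
        ← ENNReal.ofReal_mul (by positivity), ← Real.rpow_natCast, ← Real.rpow_neg hρ.le,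
        ← Real.rpow_neg hρ.le, ← Real.rpow_add hρ]
      congr 2
      rw [hb]; ring
    rw [h3, div_eq_mul_inv]
    calc _ ≤ 2 ^ Q * (ENNReal.ofReal (ρ ^ w))⁻¹ *
          (∫⁻ t in Ioo (-(2 * ρ ^ w)) (2 * ρ ^ w), θ t ^ Q) *
            (ENNReal.ofReal (ρ ^ (1 + Q * σ)))⁻¹ := by gcongr
      _ = _ := by ring
  have hmeas : Measurable ({x : ℝ × ℝ | |x.2| < 2 * x.1 ^ w}.indicator
      fun x : ℝ × ℝ => ENNReal.ofReal (x.1 ^ (-1 - b)) * θ x.2 ^ Q) := by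
    refine Measurable.indicator ?_ ?_
    · exact ((measurable_fst.pow_const _).ennreal_ofReal).mul ((hθ.comp measurable_snd).pow_const _)
    · exact measurableSet_lt measurable_snd.abs ((measurable_fst.pow_const w).const_mul 2)
  calc _ ≤ ∫⁻ ρ in Ioi (0 : ℝ), 2 ^ Q * ∫⁻ t : ℝ, {x : ℝ × ℝ | |x.2| < 2 * x.1 ^ w}.indicator
        (fun x => ENNReal.ofReal (x.1 ^ (-1 - b)) * θ x.2 ^ Q) (ρ, t) :=
        setLIntegral_mono' measurableSet_Ioi hpt
    _ = 2 ^ Q * ∫⁻ t : ℝ, ∫⁻ ρ in Ioi (0 : ℝ), {x : ℝ × ℝ | |x.2| < 2 * x.1 ^ w}.indicator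
        (fun x => ENNReal.ofReal (x.1 ^ (-1 - b)) * θ x.2 ^ Q) (ρ, t) := by
        rw [lintegral_const_mul' _ _ (ENNReal.rpow_ne_top_of_nonneg hQ0.le (by simp)),
          lintegral_lintegral_swap]
        exact hmeas.aemeasurable
    _ ≤ 2 ^ Q * ∫⁻ h : ℝ, ENNReal.ofReal (2 ^ (1 + Q * (σ / w))) *
        (θ h ^ Q / ENNReal.ofReal (|h| ^ (1 + Q * (σ / w)))) := by
        refine mul_le_mul_right (lintegral_mono_ae ?_) _
        have hne : ∀ᵐ t : ℝ, t ≠ 0 := by simp [ae_iff]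
        filter_upwards [hne] with t ht
        have ht0 : 0 < |t| := abs_pos.2 ht
        set c : ℝ := (|t| / 2) ^ (1 / (w : ℝ)) with hc
        have hc0 : 0 < c := by positivity
        have hcw : c ^ w = |t| / 2 := by
          rw [hc, ← Real.rpow_natCast, ← Real.rpow_mul (by positivity), one_div,
            inv_mul_cancel₀ hw0.ne', Real.rpow_one]
        have h1 : ∫⁻ ρ in Ioi (0 : ℝ), {x : ℝ × ℝ | |x.2| < 2 * x.1 ^ w}.indicator
            (fun x => ENNReal.ofReal (x.1 ^ (-1 - b)) * θ x.2 ^ Q) (ρ, t) ≤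
            ∫⁻ ρ in Ioi c, ENNReal.ofReal (ρ ^ (-1 - b)) * θ t ^ Q := by
          rw [← lintegral_indicator measurableSet_Ioi, ← lintegral_indicator measurableSet_Ioi]
          refine lintegral_mono fun ρ => ?_
          by_cases hρ : ρ ∈ Ioi (0 : ℝ)
          · rw [indicator_of_mem hρ]
            by_cases hx : |t| < 2 * ρ ^ w
            · have hρc : ρ ∈ Ioi c := by
                have : c ^ w < ρ ^ w := by rw [hcw]; linarith
                exact lt_of_pow_lt_pow_left₀ w (le_of_lt hρ) this
              rw [indicator_of_mem hρc, indicator_of_mem (show (ρ, t) ∈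
                {x : ℝ × ℝ | |x.2| < 2 * x.1 ^ w} from hx)]
            · rw [indicator_of_notMem (show (ρ, t) ∉
                {x : ℝ × ℝ | |x.2| < 2 * x.1 ^ w} from hx)]
              exact zero_le
          · rw [indicator_of_notMem hρ]
            exact zero_le
        refine h1.trans ?_
        rw [lintegral_mul_const _ (measurable_id'.pow_const _).ennreal_ofReal]
        refine (mul_le_mul_left (lintegral_Ioi_rpow_le hc0 hb1) _).trans (le_of_eq ?_)
        have h2 : c ^ (-b) = 2 ^ (1 + Q * (σ / w)) * (|t| ^ (1 + Q * (σ / w)))⁻¹ := by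
          have e : 1 / (w : ℝ) * -b = -(1 + Q * (σ / w)) := by
            rw [hb]; field_simp; ring
          rw [hc, ← Real.rpow_mul (by positivity), e, Real.rpow_neg (by positivity),
            Real.div_rpow ht0.le (by norm_num), inv_div, div_eq_mul_inv]
        rw [h2, ENNReal.ofReal_mul (by positivity),
          ENNReal.ofReal_inv_of_pos (Real.rpow_pos_of_pos ht0 _), ENNReal.div_eq_inv_mul]
        ring
    _ = _ := by
        rw [lintegral_const_mul' _ _ ENNReal.ofReal_ne_top]

end Modulus

section Modulus

/-- The increments of `u` along a flow, over times at most `ρ^w` and normalised by `ρ^n`: a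
function of the scale `ρ`. -/
noncomputable def scaleModulus (flow : ℝ → Pt d → Pt d) (w n : ℕ) (p : ℝ≥0∞) (u : Pt d → ℝ)
    (ρ : ℝ) : ℝ≥0∞ :=
  (⨆ (τ : ℝ) (_ : |τ| ≤ ρ ^ w), eLpNorm (fun z => u (flow τ z) - u z) p volume) /
    ENNReal.ofReal (ρ ^ n)

variable {flow : ℝ → Pt d → Pt d} {V : Pt d → Pt d} {u : Pt d → ℝ} {p q : ℝ≥0∞} {w n : ℕ}

theorem measurable_scaleModulus : Measurable (scaleModulus flow w n p u) := by
  have h1 : Monotone fun h : ℝ =>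
      ⨆ (τ : ℝ) (_ : |τ| ≤ h), eLpNorm (fun z => u (flow τ z) - u z) p volume := by
    intro h h' hh
    exact iSup₂_le fun τ hτ => le_iSup₂ (f := fun (τ : ℝ) (_ : |τ| ≤ h') =>
      eLpNorm (fun z => u (flow τ z) - u z) p volume) τ (hτ.trans hh)
  exact (h1.measurable.comp (measurable_id.pow_const w)).div
    (measurable_id.pow_const n).ennreal_ofReal

theorem eLpNorm_sub_le_scaleModulus {ρ τ : ℝ} (hρ : 0 < ρ) (hτ : |τ| ≤ ρ ^ w) :
    eLpNorm (fun z => u (flow τ z) - u z) p volume ≤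
      ENNReal.ofReal (ρ ^ n) * scaleModulus flow w n p u ρ := by
  rw [scaleModulus, ENNReal.mul_div_cancel (by simpa using pow_pos hρ n) ENNReal.ofReal_ne_top]
  exact le_iSup₂ (f := fun (τ : ℝ) (_ : |τ| ≤ ρ ^ w) =>
      eLpNorm (fun z => u (flow τ z) - u z) p volume) τ hτ

/-- The norm of order `s` of the normalised modulus is bounded by the Besov norm of order `n + s`
along the flow. The constant is `8 = 2 * 2 ^ 2`, as the exponent `1 / q * (1 + q (n + s) / w)` is
at most `2`. -/
theorem scaleNorm_scaleModulus_le (hf : IsSmoothFlow volume flow V) (hu : LocallyIntegrable u)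
    (hp : 1 ≤ p) (hq : 1 ≤ q) (hw : 1 ≤ w) {s : ℝ} (hs : 0 < s) (hsw : (n : ℝ) + s ≤ w) :
    scaleNorm s q (scaleModulus flow w n p u) ≤ 8 * dirSeminorm flow w (n + s) p q u := by
  have hw0 : (0 : ℝ) < w := by exact_mod_cast hw
  have hσ : 0 < (n : ℝ) + s := by positivity
  have hσw : ((n : ℝ) + s) / w ≤ 1 := (div_le_one hw0).2 hsw
  unfold scaleNorm dirSeminorm
  split_ifs with hqt
  · refine le_trans (iSup₂_le fun ρ hρ => ?_) (le_mul_of_one_le_left' (by norm_num))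
    set D := ⨆ (h : ℝ) (_ : h ≠ 0), eLpNorm (fun z => u (flow h z) - u z) p volume /
      ENNReal.ofReal (|h| ^ (((n : ℝ) + s) / w)) with hD
    have hρn := pow_pos hρ n
    have hρs := Real.rpow_pos_of_pos hρ s
    rw [scaleModulus, ENNReal.div_le_iff (by simpa using hρs) ENNReal.ofReal_ne_top,
      ENNReal.div_le_iff (by simpa using hρn) ENNReal.ofReal_ne_top, mul_assoc,
      ← ENNReal.ofReal_mul hρs.le]
    refine iSup₂_le fun τ hτ => ?_
    by_cases h0 : τ = 0
    · subst h0
      simp [hf.zero]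
    · have h1 : eLpNorm (fun z => u (flow τ z) - u z) p volume /
          ENNReal.ofReal (|τ| ^ (((n : ℝ) + s) / w)) ≤ D :=
        le_iSup₂ (f := fun (h : ℝ) (_ : h ≠ 0) =>
          eLpNorm (fun z => u (flow h z) - u z) p volume /
            ENNReal.ofReal (|h| ^ (((n : ℝ) + s) / w))) τ h0
      have hτ0 : 0 < |τ| := abs_pos.2 h0
      rw [ENNReal.div_le_iff (by simpa using Real.rpow_pos_of_pos hτ0 _)
        ENNReal.ofReal_ne_top] at h1
      refine h1.trans ?_
      gcongr
      calc |τ| ^ (((n : ℝ) + s) / w) ≤ (ρ ^ w) ^ (((n : ℝ) + s) / w) := by gcongr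
        _ = ρ ^ s * ρ ^ n := by
          rw [← Real.rpow_natCast, ← Real.rpow_mul hρ.le, mul_div_cancel₀ _ hw0.ne', add_comm,
            Real.rpow_add hρ, Real.rpow_natCast]
  · have hQ := toReal_one_le hq hqt
    set Q := q.toReal
    have hQ0 : 0 < Q := by linarith
    set θ : ℝ → ℝ≥0∞ := fun τ => eLpNorm (fun z => u (flow τ z) - u z) p volume with hθ
    have hm : Measurable θ :=
      hf.measurable_eLpNorm_sub hu.aestronglyMeasurable (by positivity)
    have hsub : ∀ τ t, θ τ ≤ θ (τ + t) + θ t := hf.eLpNorm_sub_le_add hu hp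
    have key := lintegral_iSup_rpow_le hm hsub hQ hw hσ
    have h1 : ∫⁻ ρ in Ioi (0 : ℝ), scaleModulus flow w n p u ρ ^ Q /
        ENNReal.ofReal (ρ ^ (1 + Q * s)) = ∫⁻ ρ in Ioi (0 : ℝ),
          (⨆ (τ : ℝ) (_ : |τ| ≤ ρ ^ w), θ τ) ^ Q /
            ENNReal.ofReal (ρ ^ (1 + Q * ((n : ℝ) + s))) := by
      refine setLIntegral_congr_fun measurableSet_Ioi fun ρ hρ => ?_
      have hρ : 0 < ρ := hρ
      have hρn := pow_pos hρ n
      simp only [scaleModulus]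
      rw [ENNReal.div_rpow_of_nonneg _ _ hQ0.le, ENNReal.ofReal_rpow_of_pos hρn,
        ENNReal.div_eq_inv_mul, ENNReal.div_eq_inv_mul, ENNReal.div_eq_inv_mul, ← mul_assoc,
        ← ENNReal.ofReal_inv_of_pos (by positivity), ← ENNReal.ofReal_inv_of_pos (by positivity),
        ← ENNReal.ofReal_inv_of_pos (by positivity), ← ENNReal.ofReal_mul (by positivity)]
      congr 2
      rw [← Real.rpow_natCast, ← Real.rpow_mul hρ.le, ← mul_inv, ← Real.rpow_add hρ]
      congr 2
      ring
    rw [h1]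
    have h2 : (2 : ℝ≥0∞) ^ Q * ENNReal.ofReal (2 ^ (1 + Q * (((n : ℝ) + s) / w))) ≤ 8 ^ Q := by
      have h3 : (2 : ℝ) ^ (1 + Q * (((n : ℝ) + s) / w)) ≤ 2 ^ (2 * Q) := by
        refine Real.rpow_le_rpow_of_exponent_le (by norm_num) ?_
        nlinarith
      calc (2 : ℝ≥0∞) ^ Q * ENNReal.ofReal (2 ^ (1 + Q * (((n : ℝ) + s) / w)))
          ≤ 2 ^ Q * ENNReal.ofReal (2 ^ (2 * Q)) := by gcongr
        _ = 2 ^ Q * 2 ^ (2 * Q) := by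
            rw [← ENNReal.ofReal_rpow_of_pos (by norm_num : (0 : ℝ) < 2), ENNReal.ofReal_ofNat]
        _ = 8 ^ Q := by
            rw [ENNReal.rpow_mul, ← ENNReal.mul_rpow_of_nonneg _ _ hQ0.le]
            norm_num
    rw [← mul_assoc] at key
    calc _ ≤ (8 ^ Q * ∫⁻ h : ℝ, θ h ^ Q /
          ENNReal.ofReal (|h| ^ (1 + Q * (((n : ℝ) + s) / w)))) ^ (1 / Q) := by
          refine ENNReal.rpow_le_rpow (key.trans ?_) (by positivity)
          gcongr
      _ = _ := by
          rw [ENNReal.mul_rpow_of_nonneg _ _ (by positivity), ← ENNReal.rpow_mul,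
            mul_one_div_cancel hQ0.ne', ENNReal.rpow_one]

end Modulus

/-! ### Besov functions are controlled -/

section BesovControl

variable {u u' : Pt d → ℝ} {p q : ℝ≥0∞} {s : ℝ}

theorem dirSeminorm_congr_ae {flow : ℝ → Pt d → Pt d}
    (hf : ∀ h, MeasurePreserving (flow h)) (hu : u =ᵐ[volume] u') (m σ : ℝ) :
    dirSeminorm flow m σ p q u = dirSeminorm flow m σ p q u' := by
  unfold dirSeminorm
  simp only [fun h => eLpNorm_flow_sub_congr (hf h) hu (p := p)]

theorem besovSeminorm_congr_ae (hB : IsKolmogorovMatrix d B) (hu : u =ᵐ[volume] u') (n : ℕ) :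
    besovSeminorm B s p q n u = besovSeminorm B s p q n u' := by
  have hP : ∀ (i : Idx d) v, IsWeakPDeriv i u v ↔ IsWeakPDeriv i u' v := fun i v =>
    ⟨fun h => IsWeakVDeriv.congr_left h hu, fun h => IsWeakVDeriv.congr_left h hu.symm⟩
  have hY : ∀ v, IsWeakYDeriv B u v ↔ IsWeakYDeriv B u' v := fun v =>
    ⟨fun h => IsWeakVDeriv.congr_left h hu, fun h => IsWeakVDeriv.congr_left h hu.symm⟩
  have hp : ∀ (i : Idx d) σ, pSeminorm i σ p q u = pSeminorm i σ p q u' := fun i σ =>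
    dirSeminorm_congr_ae (isSmoothFlow_pflow i).measurePreserving hu _ _
  have hy : ∀ σ, ySeminorm B σ p q u = ySeminorm B σ p q u' := fun σ =>
    dirSeminorm_congr_ae (isSmoothFlow_yflow hB).measurePreserving hu _ _
  match n with
  | 0 => simp only [besovSeminorm, hp, hy]
  | 1 => simp only [besovSeminorm, hP, hy]
  | n + 2 => simp only [besovSeminorm, hP, hY]

/-- The infimum over the weak derivatives in `besovSeminorm` is attained. -/
theorem exists_besovSeminorm_le_iInf (hB : IsKolmogorovMatrix d B) {V : Pt d → Pt d} {n : ℕ}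
    (h : ⨅ (v : Pt d → ℝ) (_ : IsWeakVDeriv volume V u v), besovSeminorm B s p q n v < ⊤) :
    ∃ v, IsWeakVDeriv volume V u v ∧ besovSeminorm B s p q n v ≤
      ⨅ (v : Pt d → ℝ) (_ : IsWeakVDeriv volume V u v), besovSeminorm B s p q n v := by
  obtain ⟨v, hv⟩ := iInf_lt_iff.1 h
  obtain ⟨hv, _⟩ := iInf_lt_iff.1 hv
  exact ⟨v, hv, le_iInf₂ fun v' hv' => (besovSeminorm_congr_ae hB (hv.unique hv') n).le⟩

/-- A function of finite Besov quasi-norm `|u|_{n+s,p,q}` is controlled to order `n` by a function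
of the scale whose norm of order `s` is bounded by that quasi-norm. -/
theorem exists_isControlled (hB : IsKolmogorovMatrix d B) (hp : 1 ≤ p) (hq : 1 ≤ q) (hs0 : 0 < s)
    (hs1 : s < 1) (n : ℕ) : ∀ u : Pt d → ℝ, LocallyIntegrable u → besovSeminorm B s p q n u < ⊤ →
      ∃ F : ℝ → ℝ≥0∞, Measurable F ∧ IsControlled B p F n u ∧
        scaleNorm s q F ≤ 8 * besovSeminorm B s p q n u := by
  induction n using Nat.strong_induction_on with
  | _ n ih =>
    intro u hu hfin
    match n with
    | 0 =>
      simp only [besovSeminorm] at hfin ⊢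
      let Fa : Fin (d 0) → ℝ → ℝ≥0∞ := fun a => scaleModulus (pflow ⟨0, a⟩) 1 0 p u
      let FY : ℝ → ℝ≥0∞ := scaleModulus (yflow B) 2 0 p u
      have hFa : Measurable fun ρ => ∑ a, Fa a ρ :=
        Finset.measurable_fun_sum _ fun a _ => measurable_scaleModulus
      refine ⟨fun ρ => ∑ a, Fa a ρ + FY ρ, hFa.add measurable_scaleModulus, ?_, ?_⟩
      · refine .mk 0 u (fun _ => u) hu ?_ ?_ ?_
        · intro X _ ρ hρ τ hτ
          match X with
          | none =>
            refine (eLpNorm_sub_le_scaleModulus (w := 2) (n := 0) hρ hτ).trans ?_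
            gcongr
            exact le_add_self
          | some a =>
            refine (eLpNorm_sub_le_scaleModulus (w := 1) (n := 0) hρ hτ).trans ?_
            gcongr
            exact (Finset.single_le_sum (f := fun a => Fa a ρ) (fun _ _ => zero_le)
              (Finset.mem_univ a)).trans le_self_add
        · intro X m hm
          have := X.one_le_weight
          omega
        · intro X m hm
          have := X.one_le_weight
          omega
      · refine (scaleNorm_add_le hq hFa measurable_scaleModulus).trans ?_
        rw [mul_add, Finset.mul_sum]
        refine add_le_add ((scaleNorm_sum_le hq _ fun a => measurable_scaleModulus).trans
          (Finset.sum_le_sum fun a _ => ?_)) ?_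
        · have := scaleNorm_scaleModulus_le (w := 1) (n := 0) (isSmoothFlow_pflow ⟨0, a⟩) hu hp hq
            le_rfl hs0 (by simpa using hs1.le)
          simpa [pSeminorm] using this
        · have := scaleNorm_scaleModulus_le (w := 2) (n := 0) (isSmoothFlow_yflow hB) hu hp hq
            one_le_two hs0 (by push_cast; linarith)
          simpa [ySeminorm] using this
    | 1 =>
      simp only [besovSeminorm] at hfin ⊢
      have hfa : ∀ a : Fin (d 0), ⨅ (v : Pt d → ℝ) (_ : IsWeakPDeriv ⟨0, a⟩ u v),
          besovSeminorm B s p q 0 v < ⊤ := fun a =>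
        ENNReal.sum_lt_top.1 (lt_of_le_of_lt le_self_add hfin) a (Finset.mem_univ a)
      choose v hv hvle using fun a => exists_besovSeminorm_le_iInf hB (hfa a)
      choose Fa hFam hFac hFan using fun a => ih 0 (by omega) (v a) (hv a).2.1
        (lt_of_le_of_lt (hvle a) (hfa a))
      let FY : ℝ → ℝ≥0∞ := scaleModulus (yflow B) 2 1 p u
      have hFa : Measurable fun ρ => ∑ a, Fa a ρ :=
        Finset.measurable_fun_sum _ fun a _ => hFam a
      refine ⟨fun ρ => ∑ a, Fa a ρ + FY ρ, hFa.add measurable_scaleModulus, ?_, ?_⟩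
      · refine .mk 1 u (fun X => X.elim u v) hu ?_ ?_ ?_
        · intro X hX ρ hρ τ hτ
          match X with
          | none =>
            refine (eLpNorm_sub_le_scaleModulus (w := 2) (n := 1) hρ hτ).trans ?_
            gcongr
            exact le_add_self
          | some a => exact absurd hX (lt_irrefl _)
        · intro X m hm
          match X with
          | none =>
            simp only [Letter.weight] at hm
            omega
          | some a => exact hv a
        · intro X m hm
          match X with
          | none =>
            simp only [Letter.weight] at hm
            omega
          | some a =>
            simp only [Letter.weight] at hm
            obtain rfl : m = 0 := by omega
            refine (hFac a).mono fun ρ _ => ?_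
            exact (Finset.single_le_sum (f := fun a => Fa a ρ) (fun _ _ => zero_le)
              (Finset.mem_univ a)).trans le_self_add
      · refine (scaleNorm_add_le hq hFa measurable_scaleModulus).trans ?_
        rw [mul_add, Finset.mul_sum]
        refine add_le_add ((scaleNorm_sum_le hq _ hFam).trans
          (Finset.sum_le_sum fun a _ => (hFan a).trans ?_)) ?_
        · gcongr
          exact hvle a
        · have := scaleNorm_scaleModulus_le (w := 2) (n := 1) (isSmoothFlow_yflow hB) hu hp hq
            one_le_two hs0 (by push_cast; linarith)
          simpa [ySeminorm] using this
    | n + 2 =>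
      simp only [besovSeminorm] at hfin ⊢
      have hfa : ∀ a : Fin (d 0), ⨅ (v : Pt d → ℝ) (_ : IsWeakPDeriv ⟨0, a⟩ u v),
          besovSeminorm B s p q (n + 1) v < ⊤ := fun a =>
        ENNReal.sum_lt_top.1 (lt_of_le_of_lt le_self_add hfin) a (Finset.mem_univ a)
      have hfY : ⨅ (v : Pt d → ℝ) (_ : IsWeakYDeriv B u v),
          besovSeminorm B s p q n v < ⊤ := lt_of_le_of_lt le_add_self hfin
      choose v hv hvle using fun a => exists_besovSeminorm_le_iInf hB (hfa a)
      choose Fa hFam hFac hFan using fun a => ih (n + 1) (by omega) (v a) (hv a).2.1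
        (lt_of_le_of_lt (hvle a) (hfa a))
      obtain ⟨y, hy, hyle⟩ := exists_besovSeminorm_le_iInf hB hfY
      obtain ⟨FY, hFYm, hFYc, hFYn⟩ := ih n (by omega) y hy.2.1 (lt_of_le_of_lt hyle hfY)
      have hFa : Measurable fun ρ => ∑ a, Fa a ρ :=
        Finset.measurable_fun_sum _ fun a _ => hFam a
      refine ⟨fun ρ => ∑ a, Fa a ρ + FY ρ, hFa.add hFYm, ?_, ?_⟩
      · refine .mk (n + 2) u (fun X => X.elim y v) hu ?_ ?_ ?_
        · intro X hX ρ hρ τ hτ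
          match X with
          | none =>
            simp only [Letter.weight] at hX
            omega
          | some a =>
            simp only [Letter.weight] at hX
            omega
        · intro X m hm
          match X with
          | none => exact hy
          | some a => exact hv a
        · intro X m hm
          match X with
          | none =>
            simp only [Letter.weight] at hm
            obtain rfl : m = n := by omega
            exact hFYc.mono fun ρ _ => le_add_self
          | some a =>
            simp only [Letter.weight] at hm
            obtain rfl : m = n + 1 := by omega
            refine (hFac a).mono fun ρ _ => ?_
            exact (Finset.single_le_sum (f := fun a => Fa a ρ) (fun _ _ => zero_le)
              (Finset.mem_univ a)).trans le_self_add
      · refine (scaleNorm_add_le hq hFa hFYm).trans ?_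
        rw [mul_add, Finset.mul_sum]
        refine add_le_add ((scaleNorm_sum_le hq _ hFam).trans
          (Finset.sum_le_sum fun a _ => (hFan a).trans ?_)) (hFYn.trans ?_)
        · gcongr
          exact hvle a
        · gcongr
          exact hyle

end BesovControl

/-! ### From increments to the Besov norm in a direction -/

/-- The substitution `h = κ ρ^W`. -/
theorem lintegral_Ioi_comp_mul_pow {κ : ℝ} (hκ : 0 < κ) {W : ℕ} (hW : 1 ≤ W) (g : ℝ → ℝ≥0∞) :
    ∫⁻ h in Ioi (0 : ℝ), g h =
      ∫⁻ ρ in Ioi (0 : ℝ), ENNReal.ofReal (κ * (W * ρ ^ (W - 1))) * g (κ * ρ ^ W) := by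
  have himg : (fun ρ : ℝ => κ * ρ ^ W) '' Ioi 0 = Ioi 0 := by
    ext h
    constructor
    · rintro ⟨ρ, hρ, rfl⟩
      have hρ : 0 < ρ := hρ
      exact mul_pos hκ (pow_pos hρ W)
    · intro hh
      have hh : 0 < h := hh
      refine ⟨(h / κ) ^ (1 / (W : ℝ)), Real.rpow_pos_of_pos (by positivity) _, ?_⟩
      have hW0 : (W : ℝ) ≠ 0 := by exact_mod_cast (by omega : W ≠ 0)
      simp only
      rw [← Real.rpow_natCast, ← Real.rpow_mul (by positivity), one_div, inv_mul_cancel₀ hW0,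
        Real.rpow_one]
      field_simp
  have hinj : InjOn (fun ρ : ℝ => κ * ρ ^ W) (Ioi 0) := by
    intro ρ hρ ρ' hρ' h
    have h1 := mul_left_cancel₀ hκ.ne' h
    exact (pow_left_inj₀ (le_of_lt hρ) (le_of_lt hρ') (by omega)).1 h1
  have key := lintegral_image_eq_lintegral_abs_deriv_mul measurableSet_Ioi
    (fun ρ _ => (((hasDerivAt_pow W ρ).const_mul κ).hasDerivWithinAt)) hinj g
  rw [himg] at key
  rw [key]
  refine setLIntegral_congr_fun measurableSet_Ioi fun ρ hρ => ?_
  have hρ : 0 < ρ := hρ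
  rw [abs_of_nonneg (by positivity)]

theorem lintegral_le_Ioi_add (g : ℝ → ℝ≥0∞) :
    ∫⁻ h : ℝ, g h ≤ (∫⁻ h in Ioi (0 : ℝ), g h) + ∫⁻ h in Ioi (0 : ℝ), g (-h) := by
  have h1 : ∫⁻ h in Iic (0 : ℝ), g h = ∫⁻ h in Ioi (0 : ℝ), g (-h) := by
    rw [setLIntegral_congr (Iio_ae_eq_Iic (a := (0 : ℝ)) (μ := volume)).symm]
    have := (Measure.measurePreserving_neg (volume : Measure ℝ)).setLIntegral_comp_preimage_emb
      (MeasurableEquiv.neg ℝ).measurableEmbedding g (Iio 0)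
    rw [← this]
    simp
  rw [← h1, ← lintegral_add_compl g (measurableSet_Ioi (a := (0 : ℝ))), compl_Ioi]

/-- If the modulus `θ` at time `±κ ρ^W` is bounded by `ρ^n F(ρ)`, then its Besov norm of order
`(n + s) / W` is bounded by the norm of order `s` of `F`. -/
theorem dirSeminorm_le_scaleNorm {flow : ℝ → Pt d → Pt d} {u : Pt d → ℝ} {p q : ℝ≥0∞}
    {F : ℝ → ℝ≥0∞} {κ s : ℝ} {K : ℝ≥0} (hκ : 0 < κ) (hκ1 : κ ≤ 1) {n W : ℕ} (hW : 1 ≤ W)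
    (hq : 1 ≤ q) (hs : 0 < s) (hsW : (n : ℝ) + s ≤ W)
    (h : ∀ ε : ℝ, |ε| = 1 → ∀ ρ : ℝ, 0 < ρ →
      eLpNorm (fun z => u (flow (ε * κ * ρ ^ W) z) - u z) p volume ≤
        K * (ENNReal.ofReal (ρ ^ n) * F ρ)) :
    dirSeminorm flow 1 ((n + s) / W) p q u ≤
      ENNReal.ofReal (2 * W * κ⁻¹) * K * scaleNorm s q F := by
  have hW0 : (0 : ℝ) < W := by exact_mod_cast hW
  have hW1 : (1 : ℝ) ≤ W := by exact_mod_cast hW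
  set σ : ℝ := (n + s) / W with hσ
  have hσ0 : 0 < σ := by positivity
  have hσ1 : σ ≤ 1 := (div_le_one hW0).2 hsW
  have hWσ : W * σ = n + s := by rw [hσ, mul_div_cancel₀ _ hW0.ne']
  set θ : ℝ → ℝ≥0∞ := fun h => eLpNorm (fun z => u (flow h z) - u z) p volume with hθ
  have hκσ : κ ^ (-σ) ≤ κ⁻¹ := by
    rw [← Real.rpow_neg_one]
    exact Real.rpow_le_rpow_of_exponent_ge hκ hκ1 (by linarith)
  unfold dirSeminorm scaleNorm
  simp only [div_one]
  split_ifs with hqt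
  · refine iSup₂_le fun t ht => ?_
    have ht0 : 0 < |t| := abs_pos.2 ht
    set N := ⨆ (ρ : ℝ) (_ : 0 < ρ), F ρ / ENNReal.ofReal (ρ ^ s) with hN
    set ρ : ℝ := (|t| / κ) ^ (1 / (W : ℝ)) with hρdef
    have hρ : 0 < ρ := by positivity
    have hρW : κ * ρ ^ W = |t| := by
      rw [hρdef, ← Real.rpow_natCast, ← Real.rpow_mul (by positivity), one_div,
        inv_mul_cancel₀ hW0.ne', Real.rpow_one]
      field_simp
    have hsgn : abs (t / |t|) = 1 := by rw [abs_div, abs_abs, div_self ht0.ne']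
    have hteq : t / |t| * κ * ρ ^ W = t := by
      rw [mul_assoc, hρW, div_mul_cancel₀ _ ht0.ne']
    have h1 := h _ hsgn ρ hρ
    rw [hteq] at h1
    have hρs := Real.rpow_pos_of_pos hρ s
    have h2 : F ρ ≤ N * ENNReal.ofReal (ρ ^ s) := by
      rw [← ENNReal.div_le_iff (by simpa using hρs) ENNReal.ofReal_ne_top]
      exact le_iSup₂ (f := fun (ρ : ℝ) (_ : 0 < ρ) => F ρ / ENNReal.ofReal (ρ ^ s)) ρ hρ
    have htσ : 0 < |t| ^ σ := Real.rpow_pos_of_pos ht0 σ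
    rw [ENNReal.div_le_iff (by simpa using htσ) ENNReal.ofReal_ne_top]
    have h3 : ρ ^ n * ρ ^ s ≤ 2 * W * κ⁻¹ * |t| ^ σ := by
      have : |t| ^ σ = κ ^ σ * (ρ ^ n * ρ ^ s) := by
        rw [← hρW, Real.mul_rpow hκ.le (by positivity), ← Real.rpow_natCast, ← Real.rpow_natCast,
          ← Real.rpow_mul hρ.le, hWσ, Real.rpow_add hρ]
      rw [this]
      have h4 : 1 ≤ κ⁻¹ * κ ^ σ := by
        calc (1 : ℝ) = κ ^ (-σ) * κ ^ σ := by rw [← Real.rpow_add hκ]; simp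
          _ ≤ _ := by gcongr
      have h5 : 0 < ρ ^ n * ρ ^ s := by positivity
      nlinarith [mul_le_mul_of_nonneg_right h4 h5.le]
    calc eLpNorm (fun z => u (flow t z) - u z) p volume
        ≤ K * (ENNReal.ofReal (ρ ^ n) * (N * ENNReal.ofReal (ρ ^ s))) := by
          refine h1.trans ?_
          gcongr
      _ = ENNReal.ofReal (ρ ^ n * ρ ^ s) * K * N := by
          rw [ENNReal.ofReal_mul (by positivity)]
          ring
      _ ≤ ENNReal.ofReal (2 * W * κ⁻¹ * |t| ^ σ) * K * N := by gcongr
      _ = _ := by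
          rw [ENNReal.ofReal_mul (by positivity)]
          ring
  · have hQ := toReal_one_le hq hqt
    set Q := q.toReal
    have hQ0 : 0 < Q := by linarith
    set J := ∫⁻ ρ in Ioi (0 : ℝ), F ρ ^ Q / ENNReal.ofReal (ρ ^ (1 + Q * s)) with hJ
    have hKQ : (K : ℝ≥0∞) ^ Q ≠ ⊤ := ENNReal.rpow_ne_top_of_nonneg hQ0.le ENNReal.coe_ne_top
    have hhalf : ∀ ε : ℝ, |ε| = 1 →
        ∫⁻ t in Ioi (0 : ℝ), θ (ε * t) ^ Q / ENNReal.ofReal (|ε * t| ^ (1 + Q * σ)) ≤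
          ENNReal.ofReal (W * κ ^ (-(Q * σ))) * ((K : ℝ≥0∞) ^ Q * J) := by
      intro ε hε
      rw [lintegral_Ioi_comp_mul_pow hκ hW, hJ, ← lintegral_const_mul' _ _ hKQ,
        ← lintegral_const_mul' _ _ ENNReal.ofReal_ne_top]
      refine setLIntegral_mono' measurableSet_Ioi fun ρ hρ => ?_
      have hρ : 0 < ρ := hρ
      have h1 : θ (ε * (κ * ρ ^ W)) ^ Q ≤
          (K : ℝ≥0∞) ^ Q * (ENNReal.ofReal (ρ ^ (Q * n)) * F ρ ^ Q) := by
        have h2 := h ε hε ρ hρ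
        rw [mul_assoc] at h2
        refine (ENNReal.rpow_le_rpow h2 hQ0.le).trans (le_of_eq ?_)
        rw [ENNReal.mul_rpow_of_nonneg _ _ hQ0.le, ENNReal.mul_rpow_of_nonneg _ _ hQ0.le,
          ENNReal.ofReal_rpow_of_pos (pow_pos hρ n), ← Real.rpow_natCast, ← Real.rpow_mul hρ.le,
          mul_comm (n : ℝ)]
      have habs : |ε * (κ * ρ ^ W)| = κ * ρ ^ W := by
        rw [abs_mul, hε, one_mul, abs_of_pos (by positivity)]
      rw [habs]
      have hpow : κ * (W * ρ ^ (W - 1)) * (ρ ^ (Q * n) * ((κ * ρ ^ W) ^ (1 + Q * σ))⁻¹) =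
          W * κ ^ (-(Q * σ)) * (ρ ^ (1 + Q * s))⁻¹ := by
        have e1 : ρ ^ (W - 1) = ρ ^ ((W : ℝ) - 1) := by
          rw [← Real.rpow_natCast, Nat.cast_sub hW, Nat.cast_one]
        have e2 : (ρ ^ W) ^ (1 + Q * σ) = ρ ^ ((W : ℝ) + Q * (n + s)) := by
          rw [← Real.rpow_natCast, ← Real.rpow_mul hρ.le, ← hWσ]
          congr 1
          ring
        have e3 : κ = κ ^ (1 : ℝ) := (Real.rpow_one κ).symm
        rw [Real.mul_rpow hκ.le (by positivity), e1, e2, mul_inv, ← Real.rpow_neg hρ.le,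
          ← Real.rpow_neg hρ.le, ← Real.rpow_neg hκ.le]
        calc κ * (W * ρ ^ ((W : ℝ) - 1)) * (ρ ^ (Q * n) *
              (κ ^ (-(1 + Q * σ)) * ρ ^ (-((W : ℝ) + Q * (n + s)))))
            = W * (κ ^ (1 : ℝ) * κ ^ (-(1 + Q * σ))) * (ρ ^ ((W : ℝ) - 1) * ρ ^ (Q * n) *
              ρ ^ (-((W : ℝ) + Q * (n + s)))) := by rw [Real.rpow_one]; ring
          _ = _ := by
              rw [← Real.rpow_add hκ, ← Real.rpow_add hρ, ← Real.rpow_add hρ]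
              congr 2
              · congr 1; ring
              · ring
      have hpos : 0 < (κ * ρ ^ W) ^ (1 + Q * σ) := Real.rpow_pos_of_pos (by positivity) _
      have hpos' : 0 < ρ ^ (1 + Q * s) := Real.rpow_pos_of_pos hρ _
      calc ENNReal.ofReal (κ * (W * ρ ^ (W - 1))) *
            (θ (ε * (κ * ρ ^ W)) ^ Q / ENNReal.ofReal ((κ * ρ ^ W) ^ (1 + Q * σ)))
          ≤ ENNReal.ofReal (κ * (W * ρ ^ (W - 1))) *
            ((K : ℝ≥0∞) ^ Q * (ENNReal.ofReal (ρ ^ (Q * n)) * F ρ ^ Q) /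
              ENNReal.ofReal ((κ * ρ ^ W) ^ (1 + Q * σ))) := by gcongr
        _ = ENNReal.ofReal (κ * (W * ρ ^ (W - 1)) *
              (ρ ^ (Q * n) * ((κ * ρ ^ W) ^ (1 + Q * σ))⁻¹)) * ((K : ℝ≥0∞) ^ Q * F ρ ^ Q) := by
            rw [ENNReal.ofReal_mul (p := κ * (W * ρ ^ (W - 1))) (by positivity),
              ENNReal.ofReal_mul (p := ρ ^ (Q * n)) (by positivity),
              ENNReal.ofReal_inv_of_pos hpos, ENNReal.div_eq_inv_mul]
            ring
        _ = _ := by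
            rw [hpow, ENNReal.ofReal_mul (p := W * κ ^ (-(Q * σ))) (by positivity),
              ENNReal.ofReal_inv_of_pos hpos',
              ENNReal.div_eq_inv_mul]
            ring
    have htot : ∫⁻ t : ℝ, θ t ^ Q / ENNReal.ofReal (|t| ^ (1 + Q * σ)) ≤
        (ENNReal.ofReal (2 * W * κ⁻¹) * K) ^ Q * J := by
      have h1 := hhalf 1 abs_one
      have h2 := hhalf (-1) (by simp)
      simp only [one_mul, neg_mul] at h1 h2
      refine (lintegral_le_Ioi_add _).trans ((add_le_add h1 h2).trans ?_)
      rw [← two_mul, ← mul_assoc, ← mul_assoc, ENNReal.mul_rpow_of_nonneg _ _ hQ0.le]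
      gcongr
      rw [ENNReal.ofReal_rpow_of_pos (by positivity), ← ENNReal.ofReal_ofNat,
        ← ENNReal.ofReal_mul (by norm_num)]
      apply ENNReal.ofReal_le_ofReal
      have h3 : κ ^ (-(Q * σ)) ≤ (κ⁻¹) ^ Q := by
        rw [Real.inv_rpow hκ.le, ← Real.rpow_neg hκ.le]
        exact Real.rpow_le_rpow_of_exponent_ge hκ hκ1 (by nlinarith)
      have h4 : 2 * (W : ℝ) ≤ (2 * W) ^ Q := by
        calc 2 * (W : ℝ) = (2 * W) ^ (1 : ℝ) := (Real.rpow_one _).symm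
          _ ≤ _ := Real.rpow_le_rpow_of_exponent_le (by linarith) hQ
      rw [Real.mul_rpow (by positivity) (by positivity), ← mul_assoc]
      gcongr
    calc _ ≤ ((ENNReal.ofReal (2 * W * κ⁻¹) * K) ^ Q * J) ^ (1 / Q) :=
          ENNReal.rpow_le_rpow htot (by positivity)
      _ = _ := by
          rw [ENNReal.mul_rpow_of_nonneg _ _ (by positivity), ← ENNReal.rpow_mul,
            mul_one_div_cancel hQ0.ne', ENNReal.rpow_one]

end Kolmogorov

theorem corollary2p6 {r : ℕ} (d : Fin (r + 1) → ℕ)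
    (B : Matrix (Kolmogorov.Idx d) (Kolmogorov.Idx d) ℝ)
    (hB : Kolmogorov.IsKolmogorovMatrix d B)
    (n : ℕ) (s : ℝ) (hs0 : 0 < s) (hs1 : s < 1) (k : ℕ) (β : Kolmogorov.Idx d → ℕ)
    (j : Fin (r + 1))
    (hlt : (n : ℝ) + s - 2 * (k : ℝ) - (Kolmogorov.blength β : ℝ) < 2 * ((j : ℕ) : ℝ) + 1)
    (hnonneg : 0 ≤ (n : ℝ) + s - 2 * (k : ℝ) - (Kolmogorov.blength β : ℝ)) :
    ∃ c : ℝ≥0, ∀ p q : ℝ≥0∞, 1 ≤ p → 1 ≤ q →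
      ∀ u : Kolmogorov.Pt d → ℝ, Kolmogorov.MemBesov B n s p q u →
        (∃ v : Kolmogorov.Pt d → ℝ, Kolmogorov.IsWeakDeriv B k β u v) ∧
        ∀ v : Kolmogorov.Pt d → ℝ, Kolmogorov.IsWeakDeriv B k β u v →
          ∀ a : Fin (d j),
            Kolmogorov.pSeminorm ⟨j, a⟩
                (((n : ℝ) + s - 2 * (k : ℝ) - (Kolmogorov.blength β : ℝ)) /
                  (2 * ((j : ℕ) : ℝ) + 1)) p q v
              ≤ (c : ℝ≥0∞) * Kolmogorov.besovSeminorm B s p q n u := by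
  open Kolmogorov in
  -- As `0 < s < 1`, the order is `m + s` with a natural number `m ≤ 2 j`.
  obtain ⟨m, rfl⟩ : ∃ m : ℕ, n = m + 2 * k + blength β := by
    have h1 : 2 * (k : ℝ) + blength β < n + 1 := by linarith
    have h2 : 2 * k + blength β < n + 1 := by exact_mod_cast h1
    exact ⟨n - (2 * k + blength β), by omega⟩
  have horder : ((m + 2 * k + blength β : ℕ) : ℝ) + s - 2 * (k : ℝ) - (blength β : ℝ) = m + s := by
    push_cast
    ring
  rw [horder] at hlt ⊢
  have hm : m ≤ 2 * (j : ℕ) := by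
    have h1 : (m : ℝ) < 2 * (j : ℕ) + 1 := by linarith
    have h2 : m < 2 * (j : ℕ) + 1 := by exact_mod_cast h1
    omega
  obtain ⟨K₁, hK₁⟩ := exists_isWeakDeriv hB k β
  choose κ K₂ hκ hκ1 hK₂ using fun a : Fin (d j) => exists_eLpNorm_pflow_sub_le hB j a hm
  set W := 2 * (j : ℕ) + 1 with hW
  have hWr : 2 * ((j : ℕ) : ℝ) + 1 = (W : ℝ) := by rw [hW]; push_cast; ring
  rw [hWr] at hlt ⊢
  -- The factor `8` is the one in `exists_isControlled`.
  refine ⟨∑ a, Real.toNNReal (2 * W * (κ a)⁻¹) * K₂ a * (K₁ * 8), fun p q hp hq u hu => ?_⟩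
  have hfin : besovSeminorm B s p q (m + 2 * k + blength β) u < ⊤ :=
    lt_of_le_of_lt le_add_self hu.2
  have huLp : MemLp u p := ⟨hu.1, lt_of_le_of_lt le_self_add hu.2⟩
  obtain ⟨F, hFm, hF, hFn⟩ := exists_isControlled hB hp hq hs0 hs1 _ u
    (huLp.locallyIntegrable hp) hfin
  obtain ⟨v₀, hv₀, hv₀c⟩ := hK₁ p F m u hp hF
  refine ⟨⟨v₀, hv₀⟩, fun v hv a => ?_⟩
  have hvc : IsControlled B p (fun ρ => K₁ * F ρ) m v := hv₀c.congr_ae hB (hv₀.unique hv)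
  have hnorm : scaleNorm s q (fun ρ => K₁ * F ρ) ≤
      K₁ * (8 * besovSeminorm B s p q (m + 2 * k + blength β) u) :=
    (scaleNorm_const_mul_le hq K₁).trans (by gcongr)
  have hnt : scaleNorm s q (fun ρ => K₁ * F ρ) ≠ ⊤ :=
    (lt_of_le_of_lt hnorm (ENNReal.mul_lt_top ENNReal.coe_lt_top
      (ENNReal.mul_lt_top (by simp) hfin))).ne
  have hmod := hK₂ a p _ v hp hvc fun η hη => frequently_le_of_scaleNorm_ne_top hs0 hq hnt hη
  have hmain := dirSeminorm_le_scaleNorm (q := q) (hκ a) (hκ1 a) (by omega : 1 ≤ W) hq hs0 hlt.le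
    hmod
  calc pSeminorm ⟨j, a⟩ ((m + s) / W) p q v
      ≤ ENNReal.ofReal (2 * W * (κ a)⁻¹) * K₂ a * scaleNorm s q (fun ρ => K₁ * F ρ) := hmain
    _ ≤ ENNReal.ofReal (2 * W * (κ a)⁻¹) * K₂ a *
        (K₁ * (8 * besovSeminorm B s p q (m + 2 * k + blength β) u)) := by gcongr
    _ = ((Real.toNNReal (2 * W * (κ a)⁻¹) * K₂ a * (K₁ * 8) : ℝ≥0) : ℝ≥0∞) *
        besovSeminorm B s p q (m + 2 * k + blength β) u := by
        push_cast
        rw [ENNReal.ofReal]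
        ring
    _ ≤ _ := by
        gcongr
        exact Finset.single_le_sum
          (f := fun a => Real.toNNReal (2 * W * (κ a)⁻¹) * K₂ a * (K₁ * 8))
          (fun _ _ => zero_le) (Finset.mem_univ a)
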